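/- **Setting.** Let $m\le N$ be positive integers and let $B=(b_{ji})$ be an $m\times N$ random matrix whose entries are independent copies of a symmetric real random variable $X$ with unit variance; put $A:=\frac1{\sqrt m}B$. For $s\ge 1$ an integer and $x\in\mathbb R^N$ let $\sigma_s(x)_1:=\inf\{\|x-z\|_1 : z\in\mathbb R^N,\ \#\{j: z_j\ne 0\}\le s\}$, and let $s_*:=m/\log(eN/m)$. For $w\in\mathbb R^m$ and $\alpha\ge 0$ let $\|w\|^{(\alpha)}:=\max\{\|w\|_2,\alpha\|w\|_\infty\}$. For $\eta\ge 0$ and $y\in\mathbb R^m$ let $\Delta_{1,\eta}(y)$ denote any minimizer of $\|z\|_1$ over all $z\in\mathbb R^N$ with $\|Az-y\|_2\le\eta$ (for $\eta=0$ the constraint is $Az=y$). $X$ satisfies the weak moment assumption of order $k$ with constants $\kappa_1>0$ and $\gamma\ge\frac12$ if $\|X\|_{L_p}\le\kappa_1p^\gamma$ for all real $4\le p\le k$. $X$ is super-Gaussian with parameter $\sigma>0$ if $\mathbb P(|\sigma g|>t)\le\mathbb P(|X|>t)$ for all $t>0$, where $g$ is a standard normal variable. **Theorem 2.6.** Fix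 $\eta\ge0$ and an integer $s\ge1$. (a) Assume that $X$ fulfills the weak moment assumption of order $\max\{4,\log N\}$ with constants $\kappa_1>0$ and $\gamma\ge\frac12$. Then there are constants $\tilde c_1,\tilde c_2,\tilde c_3,\tilde C,C,D,E>0$ depending only on $\kappa_1$ and $\gamma$ such that, if $$N\ge\tilde C m,\qquad m\ge\tilde c_3(\log N)^{\max\{2\gamma-1,1\}},\qquad s\le\tilde c_2 s_*,$$ then with probability at least $1-3e^{-\tilde c_1m}$ the following holds: for all $x\in\mathbb R^N$ and $w\in\mathbb R^m$, the minimization problem defining $\Delta_{1,\eta}(Ax+w)$ has a solution, and every solution satisfies, for all $1\le p\le2$, $$\|x-\Delta_{1,\eta}(Ax+w)\|_p\le\frac{C}{s^{1-1/p}}\,\sigma_s(x)_1+s_*^{1/p-1/2}\Big(D\eta+E\,\frac{\|w\|^{(\sqrt{\log(eN/m)})}}{\|w\|_2}\max\{\|w\|_2-\eta,0\}\Big),$$ where the term with the factor $E$ is read as $0$ if $w=0$. (b) Assume that $X$ fulfills the weak moment assumption of order $\max\{4,\log N\}$ with constants $\kappa_1>0$ and $\gamma\ge\frac12$ and is additionally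 super-Gaussian with parameter $0<\sigma\le1$. Then there are constants $\tilde c_1,\tilde c_2,\tilde C,C,D,E>0$ depending only on $\kappa_1$, $\gamma$ and $\sigma$ such that, if $$N\ge\tilde C m,\qquad m\ge(\log N)^{\max\{2\gamma-1,1\}},\qquad s\le\tilde c_2 s_*,$$ then with probability at least $1-3e^{-\tilde c_1m}$ the following holds: for all $x\in\mathbb R^N$ and $w\in\mathbb R^m$, the minimization problem defining $\Delta_{1,\eta}(Ax+w)$ has a solution, and every solution satisfies, for all $1\le p\le2$, $$\|x-\Delta_{1,\eta}(Ax+w)\|_p\le\frac{C}{s^{1-1/p}}\,\sigma_s(x)_1+s_*^{1/p-1/2}\big(D\eta+E\max\{\|w\|_2-\eta,0\}\big).$$ -/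

import Mathlib

open MeasureTheory ProbabilityTheory
open scoped ENNReal

namespace NoiseBlind

noncomputable section

/-- The `ℓ_p`-norm of a finite real vector, `1 ≤ p ≤ ∞`: `(∑ |x_j|^p)^(1/p)` for finite `p`,
`max |x_j|` for `p = ∞`. -/
def vecNorm {n : ℕ} (p : ℝ≥0∞) (x : Fin n → ℝ) : ℝ := ‖WithLp.toLp p x‖

/-- The clipped `ℓ₂`-norm with parameter `α`. -/
def clippedNorm {n : ℕ} (α : ℝ) (w : Fin n → ℝ) : ℝ :=
  max (vecNorm 2 w) (α * vecNorm ∞ w)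

/-- The `ℓ₁`-error `σ_s(x)₁` of the best `s`-term approximation
(`hammingNorm z` is the number of nonzero coordinates of `z`). -/
def bestTermError {n : ℕ} (s : ℕ) (x : Fin n → ℝ) : ℝ :=
  sInf {r : ℝ | ∃ z : Fin n → ℝ, hammingNorm z ≤ s ∧ r = vecNorm 1 (x - z)}

/-- `s_* = m / log (e N / m)`. -/
def sStar (m N : ℕ) : ℝ := (m : ℝ) / Real.log (Real.exp 1 * N / m)

/-- The set `{z : ‖A z - y‖₂ ≤ η}` of feasible points. -/
def feasible {m N : ℕ} (A : Matrix (Fin m) (Fin N) ℝ) (η : ℝ) (y : Fin m → ℝ) :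
    Set (Fin N → ℝ) :=
  {z | vecNorm 2 (A.mulVec z - y) ≤ η}

/-- The set of all solutions of quadratically constrained `ℓ₁`-minimization: minimize `‖z‖₁`
subject to `‖A z - y‖₂ ≤ η`. For `η = 0` the constraint reads `A z = y`. -/
def decoder {m N : ℕ} (A : Matrix (Fin m) (Fin N) ℝ) (η : ℝ) (y : Fin m → ℝ) :
    Set (Fin N → ℝ) :=
  {z | z ∈ feasible A η y ∧ IsMinOn (vecNorm 1) (feasible A η y) z}

section Random

variable {Ω Ω' : Type*} [MeasurableSpace Ω] [MeasurableSpace Ω']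

/-- `X` is symmetric (`X` and `-X` have the same law) with unit variance. Variance one entails a
finite second moment, and symmetry then entails mean zero. -/
structure SymmetricUnitVariance (X : Ω → ℝ) (P : Measure Ω) : Prop where
  symmetric : IdentDistrib X (fun ω => -X ω) P P
  variance_eq : variance X P = 1

/-- `‖X‖_{L_p} ≤ κ p^γ` for all real `4 ≤ p ≤ k` (in particular these moments are finite). -/
def WeakMoment (X : Ω → ℝ) (P : Measure Ω) (k κ γ : ℝ) : Prop :=
  ∀ p : ℝ, 4 ≤ p → p ≤ k → eLpNorm X (ENNReal.ofReal p) P ≤ ENNReal.ofReal (κ * p ^ γ)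

/-- `ℙ(|σ g| > t) ≤ ℙ(|X| > t)` for all `t > 0`, with `g` standard normal. -/
def SuperGaussian (X : Ω → ℝ) (P : Measure Ω) (σ : ℝ) : Prop :=
  ∀ t : ℝ, 0 < t → gaussianReal 0 1 {g | t < |σ * g|} ≤ P {ω | t < |X ω|}

/-- The entries of the random matrix `B` are independent copies of `X`. -/
structure IIDEntries {m N : ℕ} (B : Ω → Matrix (Fin m) (Fin N) ℝ) (P : Measure Ω)
    (X : Ω' → ℝ) (Q : Measure Ω') : Prop where
  measurable : ∀ j i, Measurable (fun ω => B ω j i)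
  indep : iIndepFun (fun (q : Fin m × Fin N) (ω : Ω) => B ω q.1 q.2) P
  ident : ∀ j i, IdentDistrib (fun ω => B ω j i) X P Q

/-- The property `good` holds with probability at least `r`: it holds on a measurable event
of probability at least `r`. -/
def HoldsWithProb (P : Measure Ω) (r : ℝ) (good : Ω → Prop) : Prop :=
  ∃ G : Set Ω, MeasurableSet G ∧ r ≤ P.real G ∧ ∀ ω ∈ G, good ω

end Random

/-- The measurement matrix `A = B / √m`. -/
def scaled {m N : ℕ} (B : Matrix (Fin m) (Fin N) ℝ) : Matrix (Fin m) (Fin N) ℝ :=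
  (1 / Real.sqrt m) • B

/-- The error estimates for the decoder with the matrix `A`: for all `x`, `w` the program with
data `A x + w` has a solution, and each solution obeys the `ℓ_p`-estimate for all `1 ≤ p ≤ 2`.
The function `noise w` is the noise term. -/
def RobustRecovery {m N : ℕ} (A : Matrix (Fin m) (Fin N) ℝ) (η : ℝ) (s : ℕ) (C : ℝ)
    (noise : (Fin m → ℝ) → ℝ) : Prop :=
  ∀ (x : Fin N → ℝ) (w : Fin m → ℝ),
    (decoder A η (A.mulVec x + w)).Nonempty ∧
    ∀ z ∈ decoder A η (A.mulVec x + w), ∀ p : ℝ, 1 ≤ p → p ≤ 2 →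
      vecNorm (ENNReal.ofReal p) (x - z) ≤
        C / (s : ℝ) ^ (1 - 1 / p) * bestTermError s x
          + sStar m N ^ (1 / p - 1 / 2) * noise w

end

end NoiseBlind

open NoiseBlind

/-!
The argument separates into two events for the matrix and a deterministic step.

*Small ball estimate.* Let `b` have independent coordinates with the law of `X`, and let `y` be a
direction. If the law of `b` is tilted by the density `∏ (1 + v_j φ (b_j))` with `|v_j| ≤ 1` and
`φ x = x / (1 + x²)`, then the mean of `⟨b, y⟩` moves to a multiple of `⟨v, y⟩`, the variance does
not grow, and the density has second moment at most `exp |v|²`. Two applications of the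
Cauchy-Schwarz inequality give `ℙ(⟨b, y⟩ ≥ c ⟨v, y⟩) ≥ β exp (-|v|²)`, with constants that depend
on the fourth moment of `X` only (`SymmLaw.le_measure_dotProduct_ge`). For a super-Gaussian `X`
the coordinates of `y` that are too large for a tilt, if they carry most of its norm, reach the
level by the tails of the corresponding entries alone
(`SymmLaw.le_measure_dotProduct_ge_of_superGaussian`).

*Small ball method.* McDiarmid's inequality together with a symmetrization and contraction
argument turns the small ball estimate into a bound that is uniform over a set of directions, up
to the mean width of this set with respect to the sum of the samples (`exists_event_sum_ramp_ge`).
It is applied twice.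

* To the columns of the matrix, at the level `α = √(log (e N / m))`: every direction on the sphere
  of the relevant dual norm is reached by some column, since the expected number of
  successes, of order `N (m / N) ^ (1 / 4)`, exceeds the mean width relative to the level and the
  deviations, both of order `√(N m)`, once `N / m` is large (`SymmLaw.exists_event_columns`). By the Hahn-Banach theorem every
  `w` is then of the form `A u` with `‖u‖₁ ≤ d √s_* q(w)`, where `q` is the clipped norm in
  general and the `ℓ₂`-norm in the super-Gaussian case (`exists_event_quotient`).

* To the rows, with `v = y` as a tilt: `‖A v‖₂` is bounded below uniformly over the unit vectors
  with `‖v‖₁ ≤ √(a s_*)` (`SymmLaw.exists_event_rows`). The mean width of this set is controlled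
  by a moment of order about `log (N / s_*)` of the sums of `m` entries. This moment has Gaussian
  size because the truncated exponential series `∑_{i ≤ q} l ^ i E S ^ i / i!` is
  submultiplicative over independent symmetric summands (`sum_moments_le_pow`,
  `integral_sum_pow_le`); it is here that the lower bound for `m` in terms of `log N` enters.

*Recovery.* If `u` absorbs the part of the noise beyond the level `η`, then `x + u` is feasible,
so that a solution `z` has `‖z‖₁ ≤ ‖x + u‖₁`. Together with the lower bound for `‖A v‖₂` this
bounds `x - z` in `ℓ₁` and in `ℓ₂`, and interpolation at the scale `√s_*` gives all `1 ≤ p ≤ 2`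
(`robustRecovery_of_lower_bound`).
-/

/-! ### Concentration and symmetrization on product spaces -/

namespace NoiseBlind

section Product

variable {E : Type*} [MeasurableSpace E] (ν : Measure E) [IsProbabilityMeasure ν]

lemma integral_pi_succ {n : ℕ} (f : (Fin (n + 1) → E) → ℝ) :
    ∫ y, f y ∂Measure.pi (fun _ => ν) =
      ∫ p : E × (Fin n → E), f (Fin.cons p.1 p.2) ∂(ν.prod (Measure.pi fun _ => ν)) := by
  rw [← ((measurePreserving_piFinSuccAbove (fun _ : Fin (n + 1) => ν) 0).symm).integral_comp']
  simp [MeasurableEquiv.piFinSuccAbove_symm_apply, Fin.insertNthEquiv]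

lemma measurable_cons {n : ℕ} :
    Measurable (fun p : E × (Fin n → E) => (Fin.cons p.1 p.2 : Fin (n + 1) → E)) := by
  refine measurable_pi_lambda _ fun i => ?_
  refine Fin.cases ?_ (fun j => ?_) i
  · simpa using measurable_fst
  · simpa [Function.comp_def] using (measurable_pi_apply j).comp measurable_snd

/-- The exponential moment bound behind McDiarmid's inequality, by induction on the number of
points: the conditional mean given the first point ranges in an interval of length one, to which
Hoeffding's lemma applies. -/
lemma integral_exp_le_of_bounded_differences (l : ℝ) : ∀ (n : ℕ) (f : (Fin n → E) → ℝ),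
    Measurable f → (∃ C, ∀ y, |f y| ≤ C) →
    (∀ i y a, |f (Function.update y i a) - f y| ≤ 1) →
    ∫ y, Real.exp (l * (f y - ∫ z, f z ∂Measure.pi fun _ => ν)) ∂Measure.pi (fun _ => ν)
      ≤ Real.exp (n * l ^ 2 / 8)
  | 0, f, _, _, _ => by
      have h : ∀ y, f y = f default := fun y => by rw [Subsingleton.elim y default]
      simp [h]
  | n + 1, f, hf, ⟨C, hC⟩, hd => by
      set F : E × (Fin n → E) → ℝ := fun p => f (Fin.cons p.1 p.2) with hF
      have hFm : Measurable F := hf.comp measurable_cons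
      set g : E → ℝ := fun a => ∫ z, F (a, z) ∂Measure.pi (fun _ => ν) with hg
      have hgm : Measurable g := hFm.stronglyMeasurable.integral_prod_right.measurable
      have hFi : ∀ a, Integrable (fun z => F (a, z)) (Measure.pi fun _ => ν) := fun a =>
        Integrable.of_bound (hFm.comp measurable_prodMk_left).aestronglyMeasurable C
          (.of_forall fun z => hC _)
      have hFI : Integrable F (ν.prod (Measure.pi fun _ => ν)) :=
        Integrable.of_bound hFm.aestronglyMeasurable C (.of_forall fun z => hC _)
      have hgd : ∀ a b, g a - g b ≤ 1 := fun a b => by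
        rw [hg, ← integral_sub (hFi a) (hFi b)]
        calc _ ≤ ∫ z : Fin n → E, (1 : ℝ) ∂Measure.pi (fun _ => ν) := by
              refine integral_mono ((hFi a).sub (hFi b)) (integrable_const _) fun z => ?_
              have := hd 0 (Fin.cons b z) a
              rw [Fin.update_cons_zero] at this
              exact (le_abs_self _).trans this
          _ = 1 := by simp
      have hgC : ∀ a, |g a| ≤ C := fun a => by
        have := norm_integral_le_of_norm_le_const (μ := Measure.pi fun _ : Fin n => ν)
          (f := fun z => F (a, z)) (C := C) (.of_forall fun z => hC (Fin.cons a z))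
        simpa using this
      obtain ⟨a₀⟩ : Nonempty E := nonempty_of_isProbabilityMeasure ν
      have hbdd : BddBelow (Set.range g) := ⟨-C, by
        rintro _ ⟨a, rfl⟩; exact (abs_le.1 (hgC a)).1⟩
      have hmem : ∀ a, g a ∈ Set.Icc (⨅ b, g b) ((⨅ b, g b) + 1) := fun a => by
        have : Nonempty E := ⟨a₀⟩
        refine ⟨ciInf_le hbdd a, ?_⟩
        have : g a - 1 ≤ ⨅ b, g b := le_ciInf fun b => by linarith [hgd a b]
        linarith
      have hint : ∫ z, f z ∂Measure.pi (fun _ => ν) = ∫ a, g a ∂ν := by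
        rw [integral_pi_succ, integral_prod _ hFI]
      have hHoef := (hasSubgaussianMGF_of_mem_Icc (μ := ν) hgm.aemeasurable
        (.of_forall hmem)).mgf_le l
      have hc : ((((‖(⨅ b, g b) + 1 - ⨅ b, g b‖₊ / 2) ^ 2 : NNReal)) : ℝ) * l ^ 2 / 2
          = l ^ 2 / 8 := by
        simp; ring
      rw [hc] at hHoef
      unfold mgf at hHoef
      have hexpF : ∀ c : ℝ, Integrable (fun p => Real.exp (l * (F p - c)))
          (ν.prod (Measure.pi fun _ => ν)) := fun c => by
        refine Integrable.of_bound (by fun_prop) (Real.exp (|l| * (C + |c|)))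
          (.of_forall fun p => ?_)
        rw [Real.norm_eq_abs, Real.abs_exp, Real.exp_le_exp]
        refine (le_abs_self _).trans ?_
        rw [abs_mul]
        gcongr
        exact (abs_sub _ _).trans (by gcongr; exact hC _)
      have hexpg : Integrable (fun a => Real.exp (l * (g a - ∫ a, g a ∂ν))) ν := by
        refine Integrable.of_bound (by fun_prop) (Real.exp (|l| * (C + |∫ a, g a ∂ν|)))
          (.of_forall fun p => ?_)
        rw [Real.norm_eq_abs, Real.abs_exp, Real.exp_le_exp]
        refine (le_abs_self _).trans ?_
        rw [abs_mul]
        gcongr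
        exact (abs_sub _ _).trans (by gcongr; exact hgC _)
      rw [hint, integral_pi_succ, integral_prod _ (hexpF _)]
      calc ∫ a, ∫ z, Real.exp (l * (F (a, z) - ∫ a, g a ∂ν)) ∂Measure.pi (fun _ => ν) ∂ν
          ≤ ∫ a, Real.exp (l * (g a - ∫ a, g a ∂ν)) * Real.exp (n * l ^ 2 / 8) ∂ν := by
            refine integral_mono (hexpF _).integral_prod_left (hexpg.mul_const _) fun a => ?_
            have ih := integral_exp_le_of_bounded_differences l n (fun z => F (a, z))
              (hFm.comp measurable_prodMk_left) ⟨C, fun z => hC _⟩ (fun i z b => by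
                have := hd i.succ (Fin.cons a z) b
                rwa [← Fin.cons_update] at this)
            have : ∀ z, Real.exp (l * (F (a, z) - ∫ a, g a ∂ν)) =
                Real.exp (l * (g a - ∫ a, g a ∂ν)) * Real.exp (l * (F (a, z) - g a)) :=
              fun z => by rw [← Real.exp_add]; ring_nf
            simp only [this]
            rw [integral_const_mul]
            exact mul_le_mul_of_nonneg_left ih (Real.exp_nonneg _)
        _ ≤ Real.exp (l ^ 2 / 8) * Real.exp (n * l ^ 2 / 8) := by
            rw [integral_mul_const]
            exact mul_le_mul_of_nonneg_right hHoef (Real.exp_nonneg _)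
        _ = Real.exp ((n + 1 : ℕ) * l ^ 2 / 8) := by
            rw [← Real.exp_add]; push_cast; ring_nf

/-- McDiarmid's inequality: a function of `n` independent identically distributed points that
changes by at most one with each of them exceeds its mean by `u` with probability at most
`exp (-2 u² / n)`. -/
lemma measure_ge_le_of_bounded_differences {n : ℕ} {f : (Fin n → E) → ℝ} (hf : Measurable f)
    {C : ℝ} (hC : ∀ y, |f y| ≤ C) (hd : ∀ i y a, |f (Function.update y i a) - f y| ≤ 1)
    {u : ℝ} (hu : 0 ≤ u) :
    (Measure.pi fun _ : Fin n => ν).real {y | u ≤ f y - ∫ z, f z ∂Measure.pi fun _ => ν}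
      ≤ Real.exp (-2 * u ^ 2 / n) := by
  have hs : HasSubgaussianMGF (fun y => f y - ∫ z, f z ∂Measure.pi fun _ => ν)
      ((n : NNReal) / 4) (Measure.pi fun _ : Fin n => ν) := by
    refine ⟨fun l => ?_, fun l => ?_⟩
    · refine Integrable.of_bound (by fun_prop)
        (Real.exp (|l| * (C + |∫ z, f z ∂Measure.pi fun _ => ν|))) (.of_forall fun p => ?_)
      rw [Real.norm_eq_abs, Real.abs_exp, Real.exp_le_exp]
      refine (le_abs_self _).trans ?_
      rw [abs_mul]
      gcongr
      exact (abs_sub _ _).trans (by gcongr; exact hC _)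
    · refine (integral_exp_le_of_bounded_differences ν l n f hf ⟨C, hC⟩ hd).trans (le_of_eq ?_)
      push_cast
      ring_nf
  refine (hs.measure_ge_le hu).trans (le_of_eq ?_)
  push_cast
  congr 1
  rcases eq_or_ne (n : ℝ) 0 with h | h
  · simp [h]
  · field_simp; norm_num

lemma integrable_sum_pi {U : E → ℝ} (hI : Integrable U ν) (n : ℕ) :
    Integrable (fun y : Fin n → E => ∑ k, U (y k)) (Measure.pi fun _ => ν) :=
  integrable_finsetSum _ fun _ _ => integrable_comp_eval (μ := fun _ : Fin n => ν) hI

section Supremum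

variable {ι : Type*} [Finite ι] [Nonempty ι]

lemma abs_ciSup_le {a : ι → ℝ} {c : ℝ} (h : ∀ i, |a i| ≤ c) : |⨆ i, a i| ≤ c := by
  obtain ⟨i⟩ := ‹Nonempty ι›
  exact abs_le.2 ⟨(abs_le.1 (h i)).1.trans (le_ciSup (Finite.bddAbove_range a) i),
    have : Nonempty ι := ⟨i⟩; ciSup_le fun j => (abs_le.1 (h j)).2⟩

lemma integrable_ciSup {F : Type*} [MeasurableSpace F] {P : Measure F} {U : ι → F → ℝ}
    (hU : ∀ i, Measurable (U i)) (hI : ∀ i, Integrable (U i) P) :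
    Integrable (fun y => ⨆ i, U i y) P := by
  have := Fintype.ofFinite ι
  refine Integrable.mono' (g := fun y => ∑ i, |U i y|)
    (integrable_finsetSum _ fun i _ => (hI i).abs) (Measurable.iSup hU).aestronglyMeasurable
    (.of_forall fun y => ?_)
  exact abs_ciSup_le fun i => Finset.single_le_sum (f := fun i => |U i y|)
    (fun i _ => abs_nonneg _) (Finset.mem_univ i)

/-- A comparison of expected suprema that holds for one sample, whatever the shift `Z`, carries
over to sums over `n` independent samples: the samples are exchanged one after the other. -/
lemma integral_ciSup_sum_le {U V : ι → E → ℝ} (hU : ∀ i, Measurable (U i))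
    (hV : ∀ i, Measurable (V i)) (hUI : ∀ i, Integrable (U i) ν) (hVI : ∀ i, Integrable (V i) ν)
    (h : ∀ Z : ι → ℝ, ∫ y, ⨆ i, (Z i + U i y) ∂ν ≤ ∫ y, ⨆ i, (Z i + V i y) ∂ν) :
    ∀ (n : ℕ) (Z : ι → ℝ),
      ∫ y : Fin n → E, ⨆ i, (Z i + ∑ k, U i (y k)) ∂Measure.pi (fun _ => ν) ≤
        ∫ y : Fin n → E, ⨆ i, (Z i + ∑ k, V i (y k)) ∂Measure.pi (fun _ => ν)
  | 0, Z => by simp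
  | n + 1, Z => by
      have key : ∀ {A : ι → E → ℝ} {B : ι → E → ℝ}, (∀ i, Measurable (A i)) →
          (∀ i, Measurable (B i)) → (∀ i, Integrable (A i) ν) → (∀ i, Integrable (B i) ν) →
          Integrable (fun p : E × (Fin n → E) => ⨆ i, (Z i + (A i p.1 + ∑ k, B i (p.2 k))))
            (ν.prod (Measure.pi fun _ => ν)) := fun hA hB hAI hBI => by
        refine integrable_ciSup (fun i => ?_) fun i => ?_
        · have := hA i
          have := hB i
          fun_prop
        · exact (integrable_const _).add (((hAI i).comp_fst _).add
            ((integrable_sum_pi ν (hBI i) n).comp_snd _))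
      rw [integral_pi_succ, integral_pi_succ]
      simp only [Fin.sum_univ_succ, Fin.cons_zero, Fin.cons_succ]
      have hUV := key hU hV hUI hVI
      have hVV := key hV hV hVI hVI
      have hUU := key hU hU hUI hUI
      rw [integral_prod _ hUU]
      calc _ ≤ ∫ a, ∫ z : Fin n → E, ⨆ i, (Z i + (U i a + ∑ k, V i (z k)))
              ∂Measure.pi (fun _ => ν) ∂ν := by
            refine integral_mono hUU.integral_prod_left hUV.integral_prod_left fun a => ?_
            simpa only [add_assoc] using
              integral_ciSup_sum_le hU hV hUI hVI h n (fun i => Z i + U i a)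
        _ = ∫ z : Fin n → E, ∫ a, ⨆ i, (Z i + (U i a + ∑ k, V i (z k))) ∂ν
              ∂Measure.pi (fun _ => ν) := by
            rw [integral_integral_swap]
            exact hUV
        _ ≤ ∫ z : Fin n → E, ∫ a, ⨆ i, (Z i + (V i a + ∑ k, V i (z k))) ∂ν
              ∂Measure.pi (fun _ => ν) := by
            refine integral_mono hUV.integral_prod_right hVV.integral_prod_right fun z => ?_
            have := h (fun i => Z i + ∑ k, V i (z k))
            simpa only [add_assoc, add_comm, add_left_comm] using this
        _ = _ := by rw [← integral_prod_symm _ hVV]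

/-- Symmetrization and contraction in one step, for a single sample: if `ψ i` varies between any
two indices at most as much as `V i`, which changes sign under the measure-preserving map `S`,
then `E ψ - ψ` may be replaced by `2 V` under an expected supremum. -/
lemma integral_ciSup_sub_le {ψ V : ι → E → ℝ} {S : E → E} (hS : MeasurePreserving S ν ν)
    (hψ : ∀ i, Measurable (ψ i)) (hV : ∀ i, Measurable (V i))
    (hψI : ∀ i, Integrable (ψ i) ν) (hVI : ∀ i, Integrable (V i) ν)
    (hVS : ∀ i y, V i (S y) = -V i y)
    (hL : ∀ i j y, |ψ i y - ψ j y| ≤ |V i y - V j y|) (Z : ι → ℝ) :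
    ∫ y, ⨆ i, (Z i + ((∫ z, ψ i z ∂ν) - ψ i y)) ∂ν ≤ ∫ y, ⨆ i, (Z i + 2 * V i y) ∂ν := by
  have hb : ∀ a : ι → ℝ, ∀ i, a i ≤ ⨆ j, a j := fun a => le_ciSup (Finite.bddAbove_range a)
  have hI : ∀ (c : ℝ) {A : ι → E → ℝ}, (∀ i, Measurable (A i)) → (∀ i, Integrable (A i) ν) →
      Integrable (fun y => ⨆ i, (Z i + c * A i y)) ν := fun c A hA hAI =>
    integrable_ciSup (fun i => by have := hA i; fun_prop)
      fun i => (integrable_const _).add ((hAI i).const_mul c)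
  set a := fun y => ⨆ i, (Z i + 2 * ψ i y) with ha
  set b := fun y => ⨆ i, (Z i + (-2) * ψ i y) with hb'
  have haI : Integrable a ν := hI 2 hψ hψI
  have hbI : Integrable b ν := hI (-2) hψ hψI
  set v := fun y => ⨆ i, (Z i + 2 * V i y) with hv
  set v' := fun y => ⨆ i, (Z i + (-2) * V i y) with hv'
  have hvI : Integrable v ν := hI 2 hV hVI
  have hvI' : Integrable v' ν := hI (-2) hV hVI
  have step1 : ∫ y, ⨆ i, (Z i + ((∫ z, ψ i z ∂ν) - ψ i y)) ∂ν
      ≤ ∫ y, ((∫ z, a z ∂ν) + b y) / 2 ∂ν := by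
    refine integral_mono ?_ (((integrable_const _).add hbI).div_const 2) fun y => ?_
    · exact integrable_ciSup (fun i => by have := hψ i; fun_prop)
        fun i => (integrable_const _).add ((integrable_const _).sub (hψI i))
    · refine ciSup_le fun i => ?_
      have h1 : Z i + 2 * ∫ z, ψ i z ∂ν ≤ ∫ z, a z ∂ν := by
        rw [← integral_const_mul]
        calc _ = ∫ z, (Z i + 2 * ψ i z) ∂ν := by
              rw [integral_add (integrable_const _) ((hψI i).const_mul 2)]; simp
          _ ≤ _ := integral_mono ((integrable_const _).add ((hψI i).const_mul 2)) haI
              fun z => hb (fun i => Z i + 2 * ψ i z) i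
      have h2 := hb (fun i => Z i + (-2) * ψ i y) i
      simp only [hb']
      linarith
  have step2 : ∀ y, a y + b y ≤ v y + v' y := fun y => by
    have : ∀ i j, (Z i + 2 * ψ i y) + (Z j + (-2) * ψ j y) ≤ v y + v' y := fun i j => by
      have h1 := hL i j y
      have h2 := (le_abs_self _).trans h1
      rcases abs_cases (V i y - V j y) with ⟨h, _⟩ | ⟨h, _⟩
      · have h3 := hb (fun i => Z i + 2 * V i y) i
        have h4 := hb (fun i => Z i + (-2) * V i y) j
        simp only [hv, hv']
        linarith
      · have h3 := hb (fun i => Z i + 2 * V i y) j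
        have h4 := hb (fun i => Z i + (-2) * V i y) i
        simp only [hv, hv']
        linarith
    have h1 : ∀ j, a y ≤ v y + v' y - (Z j + (-2) * ψ j y) := fun j =>
      ciSup_le fun i => by linarith [this i j]
    have h2 : b y ≤ v y + v' y - a y := ciSup_le fun j => by linarith [h1 j]
    linarith
  have step3 : ∫ y, v' y ∂ν = ∫ y, v y ∂ν := by
    have h1 : v' = fun y => v (S y) := by
      ext y; simp only [hv, hv', hVS]; congr 1; ext i; ring
    rw [h1]
    have := integral_map (f := v) hS.measurable.aemeasurable (by
      rw [hS.map_eq]; exact hvI.aestronglyMeasurable)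
    rw [← this, hS.map_eq]
  calc _ ≤ ∫ y, ((∫ z, a z ∂ν) + b y) / 2 ∂ν := step1
    _ = (∫ y, (a y + b y) ∂ν) / 2 := by
        rw [integral_div, integral_add (integrable_const _) hbI, integral_add haI hbI]; simp
    _ ≤ (∫ y, (v y + v' y) ∂ν) / 2 := by
        gcongr
        exacts [haI.add hbI, hvI.add hvI', fun y => step2 y]
    _ = ∫ y, v y ∂ν := by rw [integral_add hvI hvI', step3]; ring

end Supremum

end Product

end NoiseBlind

/-! ### The small ball method -/

namespace NoiseBlind

/-- The piecewise linear function that is `0` up to `t`, `1` from `2 t` on, and linear between. -/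
noncomputable def ramp (t s : ℝ) : ℝ := max 0 (min 1 ((s - t) / t))

lemma ramp_nonneg (t s : ℝ) : 0 ≤ ramp t s := le_max_left _ _

lemma ramp_le_one (t s : ℝ) : ramp t s ≤ 1 := max_le zero_le_one (min_le_left _ _)

lemma continuous_ramp (t : ℝ) : Continuous (ramp t) := by unfold ramp; fun_prop

lemma ramp_eq_one {t s : ℝ} (ht : 0 < t) (h : 2 * t ≤ s) : ramp t s = 1 := by
  have : 1 ≤ (s - t) / t := by rw [le_div_iff₀ ht]; linarith
  simp [ramp, this]

lemma ramp_eq_zero {t s : ℝ} (ht : 0 < t) (h : s ≤ t) : ramp t s = 0 := by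
  have : (s - t) / t ≤ 0 := div_nonpos_of_nonpos_of_nonneg (by linarith) ht.le
  rw [ramp, max_eq_left]
  exact (min_le_right _ _).trans this

lemma abs_ramp_sub_le {t : ℝ} (ht : 0 < t) (a b : ℝ) : |ramp t a - ramp t b| ≤ |a - b| / t := by
  have h1 : |ramp t a - ramp t b| ≤ |(a - t) / t - (b - t) / t| :=
    (abs_max_sub_max_le_max _ _ _ _).trans <| by
      simpa using abs_min_sub_min_le_max 1 ((a - t) / t) 1 ((b - t) / t)
  refine h1.trans (le_of_eq ?_)
  rw [← sub_div, abs_div, abs_of_pos ht]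
  congr 2
  ring

lemma ramp_le_sq {t s : ℝ} (ht : 0 < t) : t ^ 2 * ramp t s ≤ s ^ 2 := by
  rcases le_total s t with h | h
  · rw [ramp_eq_zero ht h, mul_zero]; positivity
  · calc t ^ 2 * ramp t s ≤ t ^ 2 * 1 := by gcongr; exact ramp_le_one _ _
      _ ≤ s ^ 2 := by rw [mul_one]; gcongr

section SmallBall

variable {d n : ℕ} (ν : Measure (Fin d → ℝ)) [IsProbabilityMeasure ν]

/-- The small ball method for a finite family of directions. The supremum over the family of the
deficit of the ramp sums below their means changes by at most one with each sample, and its mean is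
bounded by the mean width, since `ramp t` is `1 / t`-Lipschitz. -/
lemma measure_sum_ramp_lt_le (hS : MeasurePreserving Neg.neg ν ν)
    (hI : ∀ j, Integrable (fun b => b j) ν) {ι : Type*} [Finite ι] [Nonempty ι]
    {y : ι → Fin d → ℝ} {t β W u : ℝ} (ht : 0 < t) (hu : 0 ≤ u)
    (hβ : ∀ i, β ≤ ν.real {b | 2 * t ≤ b ⬝ᵥ y i}) {w : (Fin n → Fin d → ℝ) → ℝ}
    (hw : Integrable w (Measure.pi fun _ => ν))
    (hwy : ∀ i b, (∑ k, b k) ⬝ᵥ y i ≤ w b) (hW : ∫ b, w b ∂Measure.pi (fun _ => ν) ≤ W) :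
    (Measure.pi fun _ : Fin n => ν).real
        {b | ∃ i, ∑ k, ramp t (b k ⬝ᵥ y i) < n * β - 2 * W / t - u}
      ≤ Real.exp (-2 * u ^ 2 / n) := by
  set ψ : ι → (Fin d → ℝ) → ℝ := fun i b => ramp t (b ⬝ᵥ y i) with hψ
  set V : ι → (Fin d → ℝ) → ℝ := fun i b => (b ⬝ᵥ y i) / t with hV
  have hdot : ∀ i, Continuous fun b : Fin d → ℝ => b ⬝ᵥ y i := fun i => by
    unfold dotProduct; fun_prop
  have hψm : ∀ i, Measurable (ψ i) := fun i => ((continuous_ramp t).comp (hdot i)).measurable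
  have hVm : ∀ i, Measurable (V i) := fun i => ((hdot i).div_const t).measurable
  have hψ1 : ∀ i b, |ψ i b| ≤ 1 := fun i b => by
    rw [abs_of_nonneg (ramp_nonneg _ _)]; exact ramp_le_one _ _
  have hψI : ∀ i, Integrable (ψ i) ν := fun i =>
    Integrable.of_bound (hψm i).aestronglyMeasurable 1 (.of_forall fun b => hψ1 i b)
  have hVI : ∀ i, Integrable (V i) ν := fun i =>
    (integrable_finsetSum _ fun j _ => (hI j).mul_const (y i j)).div_const t
  have hψE : ∀ i, β ≤ ∫ b, ψ i b ∂ν := fun i => by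
    have hm : MeasurableSet {b : Fin d → ℝ | 2 * t ≤ b ⬝ᵥ y i} :=
      measurableSet_le measurable_const (hdot i).measurable
    calc β ≤ ∫ b, Set.indicator {b | 2 * t ≤ b ⬝ᵥ y i} 1 b ∂ν := by
          rw [integral_indicator_one hm]; exact hβ i
      _ ≤ _ := by
          refine integral_mono ((integrable_const 1).indicator hm) (hψI i) fun b => ?_
          by_cases hb : 2 * t ≤ b ⬝ᵥ y i
          · simp [hb, hψ, ramp_eq_one ht hb]
          · simp [hb, hψ, ramp_nonneg]
  have hψE1 : ∀ i, |∫ b, ψ i b ∂ν| ≤ 1 := fun i => by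
    simpa using norm_integral_le_of_norm_le_const (μ := ν) (f := ψ i) (C := 1)
      (.of_forall (hψ1 i))
  set f : (Fin n → Fin d → ℝ) → ℝ := fun b => ⨆ i, ∑ k, ((∫ z, ψ i z ∂ν) - ψ i (b k)) with hf
  have hbd : ∀ b : Fin n → Fin d → ℝ,
      BddAbove (Set.range fun i => ∑ k, ((∫ z, ψ i z ∂ν) - ψ i (b k))) :=
    fun b => Finite.bddAbove_range _
  have hfm : Measurable f := Measurable.iSup fun i => by
    have := hψm i
    fun_prop
  have hfC : ∀ b, |f b| ≤ n * 2 := fun b => abs_ciSup_le fun i => by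
    refine (Finset.abs_sum_le_sum_abs _ _).trans ?_
    calc _ ≤ ∑ _k : Fin n, (2 : ℝ) := Finset.sum_le_sum fun k _ =>
          (abs_sub _ _).trans (by linarith [hψE1 i, hψ1 i (b k)])
      _ = _ := by simp
  have hone : ∀ (b b' : Fin n → Fin d → ℝ) (k : Fin n), (∀ j ≠ k, b j = b' j) →
      f b ≤ f b' + 1 := fun b b' k hbb => ciSup_le fun i => by
    have h1 := le_ciSup (hbd b') i
    have h2 : ∑ j, ((∫ z, ψ i z ∂ν) - ψ i (b j)) - ∑ j, ((∫ z, ψ i z ∂ν) - ψ i (b' j))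
        = ψ i (b' k) - ψ i (b k) := by
      rw [← Finset.sum_sub_distrib, Finset.sum_eq_single k]
      · ring
      · intro j _ hj; rw [hbb j hj]; ring
      · simp
    have h3 := ramp_nonneg t (b k ⬝ᵥ y i)
    have h4 := ramp_le_one t (b' k ⬝ᵥ y i)
    simp only [hψ] at h2 h1 ⊢
    linarith
  have hfd : ∀ k b a, |f (Function.update b k a) - f b| ≤ 1 := fun k b a => by
    have h1 := hone (Function.update b k a) b k fun j hj => by simp [hj]
    have h2 := hone b (Function.update b k a) k fun j hj => by simp [hj]
    rw [abs_le]
    constructor <;> linarith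
  have hfE : ∫ b, f b ∂Measure.pi (fun _ => ν) ≤ 2 * W / t := by
    have h := integral_ciSup_sum_le ν (U := fun i b => (∫ z, ψ i z ∂ν) - ψ i b)
      (V := fun i b => 2 * V i b) (fun i => (hψm i).const_sub _) (fun i => (hVm i).const_mul 2)
      (fun i => (integrable_const _).sub (hψI i)) (fun i => (hVI i).const_mul 2)
      (fun Z => integral_ciSup_sub_le ν hS hψm hVm hψI hVI
        (fun i b => by simp [hV, neg_div])
        (fun i j b => by
          refine (abs_ramp_sub_le ht _ _).trans (le_of_eq ?_)
          simp only [hV]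
          rw [← sub_div, abs_div, abs_of_pos ht]) Z) n (fun _ => 0)
    simp only [zero_add] at h
    refine h.trans ?_
    calc _ ≤ ∫ b, 2 / t * w b ∂Measure.pi (fun _ => ν) := by
          refine integral_mono (integrable_ciSup (fun i => ?_) fun i => ?_) (hw.const_mul _)
            fun b => ciSup_le fun i => ?_
          · have := hVm i
            fun_prop
          · exact integrable_sum_pi ν ((hVI i).const_mul 2) n
          · have h1 := hwy i b
            rw [sum_dotProduct] at h1
            calc ∑ k, 2 * V i (b k) = 2 / t * ∑ k, b k ⬝ᵥ y i := by
                  rw [Finset.mul_sum]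
                  refine Finset.sum_congr rfl fun k _ => ?_
                  simp only [hV]; ring
              _ ≤ _ := by gcongr
      _ = 2 / t * ∫ b, w b ∂Measure.pi (fun _ => ν) := integral_const_mul _ _
      _ ≤ 2 / t * W := by gcongr
      _ = _ := by ring
  refine le_trans (measureReal_mono ?_) (measure_ge_le_of_bounded_differences ν hfm hfC hfd hu)
  rintro b ⟨i, hi⟩
  have h1 := le_ciSup (hbd b) i
  have h2 : ∑ k, ((∫ z, ψ i z ∂ν) - ψ i (b k)) = n * (∫ z, ψ i z ∂ν) - ∑ k, ψ i (b k) := by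
    rw [Finset.sum_sub_distrib]; simp
  have h3 : (n : ℝ) * β ≤ n * ∫ z, ψ i z ∂ν := by gcongr; exact hψE i
  rw [Set.mem_ofPred_eq]
  simp only [hψ] at h1 h2 h3
  simp only [hf, hψ]
  simp only [hf, hψ] at hfE
  linarith

/-- The small ball method. If every direction `y ∈ T` satisfies the small ball estimate
`ν {b | 2 t ≤ ⟨b, y⟩} ≥ β` and `∑ b_k` has mean width at most `W` over `T`, then off an event of
probability `exp (-2 u² / n)` the ramp sums are bounded below uniformly over `T`. -/
theorem exists_event_sum_ramp_ge (hS : MeasurePreserving Neg.neg ν ν)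
    (hI : ∀ j, Integrable (fun b => b j) ν) {T : Set (Fin d → ℝ)} {t β W u : ℝ} (ht : 0 < t)
    (hu : 0 ≤ u) (hβ : ∀ y ∈ T, β ≤ ν.real {b | 2 * t ≤ b ⬝ᵥ y})
    {w : (Fin n → Fin d → ℝ) → ℝ} (hw : Integrable w (Measure.pi fun _ => ν))
    (hwT : ∀ y ∈ T, ∀ b, (∑ k, b k) ⬝ᵥ y ≤ w b)
    (hW : ∫ b, w b ∂Measure.pi (fun _ => ν) ≤ W) :
    ∃ G : Set (Fin n → Fin d → ℝ), MeasurableSet G ∧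
      1 - Real.exp (-2 * u ^ 2 / n) ≤ (Measure.pi fun _ : Fin n => ν).real G ∧
      ∀ b ∈ G, ∀ y ∈ T, n * β - 2 * W / t - u ≤ ∑ k, ramp t (b k ⬝ᵥ y) := by
  rcases T.eq_empty_or_nonempty with rfl | hT
  · exact ⟨Set.univ, .univ, by simp; positivity, by simp⟩
  have := hT.to_subtype
  obtain ⟨e, he⟩ := TopologicalSpace.exists_dense_seq T
  set q := n * β - 2 * W / t - u with hq
  have hcont : ∀ b : Fin n → Fin d → ℝ, Continuous fun y : Fin d → ℝ =>
      ∑ k, ramp t (b k ⬝ᵥ y) := fun b => by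
    refine continuous_finsetSum _ fun k _ => (continuous_ramp t).comp ?_
    unfold dotProduct; fun_prop
  have hmeas : ∀ y : Fin d → ℝ, Measurable fun b : Fin n → Fin d → ℝ =>
      ∑ k, ramp t (b k ⬝ᵥ y) := fun y => by
    refine (continuous_finsetSum _ fun k _ => (continuous_ramp t).comp ?_).measurable
    unfold dotProduct; fun_prop
  set G : ℕ → Set (Fin n → Fin d → ℝ) := fun r =>
    {b | ∃ i : Fin (r + 1), ∑ k, ramp t (b k ⬝ᵥ (e i : Fin d → ℝ)) < q} with hG
  have hGm : ∀ r, MeasurableSet (G r) := fun r => by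
    have : G r = ⋃ i : Fin (r + 1), {b | ∑ k, ramp t (b k ⬝ᵥ (e i : Fin d → ℝ)) < q} := by
      ext b; simp [hG]
    rw [this]
    exact MeasurableSet.iUnion fun i => measurableSet_lt (hmeas _) measurable_const
  have hmono : Monotone G := by
    intro r r' hr b hb
    obtain ⟨i, hi⟩ := hb
    exact ⟨⟨i, by omega⟩, hi⟩
  have hle : (Measure.pi fun _ : Fin n => ν).real (⋃ r, G r) ≤ Real.exp (-2 * u ^ 2 / n) := by
    have h1 := tendsto_measure_iUnion_atTop (μ := Measure.pi fun _ : Fin n => ν) hmono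
    have h2 : ∀ r, (Measure.pi fun _ : Fin n => ν) (G r)
        ≤ ENNReal.ofReal (Real.exp (-2 * u ^ 2 / n)) := fun r => by
      rw [← ENNReal.ofReal_toReal (measure_ne_top _ (G r))]
      refine ENNReal.ofReal_le_ofReal ?_
      exact measure_sum_ramp_lt_le ν hS hI (y := fun i : Fin (r + 1) => (e i : Fin d → ℝ)) ht hu
        (fun i => hβ _ (e i).2) hw (fun i b => hwT _ (e i).2 b) hW
    exact ENNReal.toReal_le_of_le_ofReal (Real.exp_nonneg _) (le_of_tendsto' h1 h2)
  refine ⟨(⋃ r, G r)ᶜ, (MeasurableSet.iUnion hGm).compl, ?_, fun b hb y hy => ?_⟩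
  · rw [probReal_compl_eq_one_sub (MeasurableSet.iUnion hGm)]
    linarith
  · have hcl : IsClosed {z : T | q ≤ ∑ k, ramp t (b k ⬝ᵥ (z : Fin d → ℝ))} :=
      isClosed_le continuous_const ((hcont b).comp continuous_subtype_val)
    have hsub : Set.range e ⊆ {z : T | q ≤ ∑ k, ramp t (b k ⬝ᵥ (z : Fin d → ℝ))} := by
      rintro _ ⟨r, rfl⟩
      by_contra hlt
      exact hb (Set.mem_iUnion.2 ⟨r, ⟨Fin.last r, not_le.1 hlt⟩⟩)
    have hmem : (⟨y, hy⟩ : T) ∈ {z : T | q ≤ ∑ k, ramp t (b k ⬝ᵥ (z : Fin d → ℝ))} :=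
      closure_minimal hsub hcl (he.closure_range ▸ Set.mem_univ _)
    rwa [Set.mem_ofPred_eq] at hmem

end SmallBall

end NoiseBlind

/-! ### Lower tail bounds for linear forms by tilting -/

namespace NoiseBlind

/-- `μ` is a symmetric law on the line with unit second moment and fourth moment at most `K`. -/
structure SymmLaw (μ : Measure ℝ) (K : ℝ) : Prop where
  measurePreserving_neg : MeasurePreserving Neg.neg μ μ
  integrable_four : Integrable (fun x => x ^ 4) μ
  integral_sq : ∫ x, x ^ 2 ∂μ = 1
  integral_four : ∫ x, x ^ 4 ∂μ ≤ K

lemma integral_add_add {F : Type*} [MeasurableSpace F] {P : Measure F} {f g e : F → ℝ}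
    (hf : Integrable f P) (hg : Integrable g P) (he : Integrable e P) :
    ∫ x, (f x + g x + e x) ∂P = (∫ x, f x ∂P) + (∫ x, g x ∂P) + ∫ x, e x ∂P := by
  have hfg : Integrable (fun x => f x + g x) P := hf.add hg
  rw [integral_add hfg he, integral_add hf hg]

lemma sq_integral_mul_le {F : Type*} [MeasurableSpace F] {P : Measure F} {f g : F → ℝ}
    (hf : Integrable (fun x => f x ^ 2) P) (hg : Integrable (fun x => g x ^ 2) P)
    (hfg : Integrable (fun x => f x * g x) P) :
    (∫ x, f x * g x ∂P) ^ 2 ≤ (∫ x, f x ^ 2 ∂P) * ∫ x, g x ^ 2 ∂P := by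
  have h : ∀ t : ℝ, 0 ≤ (∫ x, f x ^ 2 ∂P) * (t * t) + (2 * ∫ x, f x * g x ∂P) * t
      + ∫ x, g x ^ 2 ∂P := fun t => by
    have h0 : 0 ≤ ∫ x, (t * f x + g x) ^ 2 ∂P := integral_nonneg fun x => sq_nonneg _
    have h1 : ∀ x, (t * f x + g x) ^ 2 = t * t * f x ^ 2 + 2 * t * (f x * g x) + g x ^ 2 :=
      fun x => by ring
    simp only [h1] at h0
    rw [integral_add_add (hf.const_mul _) (hfg.const_mul _) hg, integral_const_mul,
      integral_const_mul] at h0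
    linarith
  have := discrim_le_zero h
  rw [discrim] at this
  linarith

lemma integral_eq_zero_of_odd {F : Type*} [MeasurableSpace F] {P : Measure F} {S : F → F}
    (hS : MeasurePreserving S P P) {f : F → ℝ} (hf : AEStronglyMeasurable f P)
    (hodd : ∀ x, f (S x) = -f x) : ∫ x, f x ∂P = 0 := by
  have h := integral_map (f := f) hS.measurable.aemeasurable (by rwa [hS.map_eq])
  rw [hS.map_eq] at h
  simp only [hodd, integral_neg] at h
  linarith

/-- The bounded odd function along which the law of an entry is tilted. -/
noncomputable def tilt (x : ℝ) : ℝ := x / (1 + x ^ 2)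

@[fun_prop]
lemma continuous_tilt : Continuous tilt := by
  unfold tilt
  exact continuous_id.div (by fun_prop) fun x => by positivity

lemma tilt_neg (x : ℝ) : tilt (-x) = -tilt x := by simp [tilt, neg_div]

lemma abs_tilt_le (x : ℝ) : |tilt x| ≤ 1 / 2 := by
  rw [tilt, abs_div, abs_of_pos (show (0 : ℝ) < 1 + x ^ 2 by positivity),
    div_le_div_iff₀ (by positivity) (by norm_num)]
  nlinarith [sq_nonneg (|x| - 1), sq_abs x]

lemma integrable_tilt (μ : Measure ℝ) [IsFiniteMeasure μ] : Integrable tilt μ :=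
  Integrable.of_bound (by fun_prop) (1 / 2) (.of_forall abs_tilt_le)

namespace SymmLaw

variable {μ : Measure ℝ} {K : ℝ}

lemma integrable_sq [IsProbabilityMeasure μ] (h : SymmLaw μ K) : Integrable (fun x => x ^ 2) μ := by
  refine ((integrable_const 1).add h.integrable_four).mono' (by fun_prop) (.of_forall fun x => ?_)
  rw [Real.norm_eq_abs, abs_of_nonneg (sq_nonneg x)]
  simp only [Pi.add_apply]
  nlinarith [sq_nonneg (x ^ 2 - 1), sq_nonneg x]

lemma integrable_id [IsProbabilityMeasure μ] (h : SymmLaw μ K) : Integrable (fun x => x) μ := by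
  refine ((integrable_const 1).add h.integrable_sq).mono' (by fun_prop) (.of_forall fun x => ?_)
  rw [Real.norm_eq_abs]
  simp only [Pi.add_apply]
  nlinarith [sq_nonneg (|x| - 1), sq_abs x]

lemma one_le [IsProbabilityMeasure μ] (h : SymmLaw μ K) : 1 ≤ K := by
  have h0 : 0 ≤ ∫ x, (x ^ 2 - 1) ^ 2 ∂μ := integral_nonneg fun x => sq_nonneg _
  have h1 : ∀ x : ℝ, (x ^ 2 - 1) ^ 2 = x ^ 4 + (-2) * x ^ 2 + 1 := fun x => by ring
  simp only [h1] at h0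
  rw [integral_add_add h.integrable_four (h.integrable_sq.const_mul _) (integrable_const _),
    integral_const_mul, h.integral_sq] at h0
  simp at h0
  linarith [h.integral_four]

lemma integrable_mul_tilt [IsProbabilityMeasure μ] (h : SymmLaw μ K) :
    Integrable (fun x => x * tilt x) μ :=
  h.integrable_id.mul_bdd (c := 1 / 2) (by fun_prop) (.of_forall abs_tilt_le)

lemma integrable_sq_mul_tilt [IsProbabilityMeasure μ] (h : SymmLaw μ K) :
    Integrable (fun x => x ^ 2 * tilt x) μ :=
  h.integrable_sq.mul_bdd (c := 1 / 2) (by fun_prop) (.of_forall abs_tilt_le)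

lemma integral_tilt (h : SymmLaw μ K) : ∫ x, tilt x ∂μ = 0 :=
  integral_eq_zero_of_odd h.measurePreserving_neg (by fun_prop) tilt_neg

lemma integral_sq_mul_tilt (h : SymmLaw μ K) : ∫ x, x ^ 2 * tilt x ∂μ = 0 :=
  integral_eq_zero_of_odd h.measurePreserving_neg (by fun_prop) fun x => by
    simp [tilt_neg]

lemma integral_id (h : SymmLaw μ K) : ∫ x, x ∂μ = 0 :=
  integral_eq_zero_of_odd h.measurePreserving_neg (by fun_prop) fun x => rfl

lemma integral_mul_tilt_le [IsProbabilityMeasure μ] (h : SymmLaw μ K) : ∫ x, x * tilt x ∂μ ≤ 1 := by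
  rw [← h.integral_sq]
  refine integral_mono h.integrable_mul_tilt h.integrable_sq fun x => ?_
  simp only [tilt]
  rw [← mul_div_assoc, div_le_iff₀ (by positivity)]
  nlinarith [sq_nonneg (x * x)]

/-- This is the inequality `(E X²)² ≤ E (X² / (1 + X²)) · E (X² (1 + X²))`. -/
lemma le_integral_mul_tilt [IsProbabilityMeasure μ] (h : SymmLaw μ K) :
    1 / (1 + K) ≤ ∫ x, x * tilt x ∂μ := by
  have hK := h.one_le
  obtain ⟨a, ha⟩ : ∃ a, a = 1 / (1 + K) := ⟨_, rfl⟩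
  rw [← ha]
  have ha0 : 0 < a := by rw [ha]; positivity
  have haK : a * (1 + K) = 1 := by rw [ha]; field_simp
  have hI : Integrable (fun x => x ^ 2 + x ^ 4) μ := h.integrable_sq.add h.integrable_four
  calc a ≤ 2 * a * 1 - a ^ 2 * (1 + ∫ x, x ^ 4 ∂μ) := by
        have : a ^ 2 * (1 + ∫ x, x ^ 4 ∂μ) ≤ a ^ 2 * (1 + K) := by
          gcongr; exact h.integral_four
        have h2 : a ^ 2 * (1 + K) = a := by rw [pow_two, mul_assoc, haK, mul_one]
        linarith
    _ = ∫ x, (2 * a * x ^ 2 - a ^ 2 * (x ^ 2 + x ^ 4)) ∂μ := by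
        rw [integral_sub (h.integrable_sq.const_mul _) (hI.const_mul _), integral_const_mul,
          integral_const_mul, integral_add h.integrable_sq h.integrable_four, h.integral_sq]
    _ ≤ _ := by
        refine integral_mono ((h.integrable_sq.const_mul _).sub
          (hI.const_mul _)) h.integrable_mul_tilt fun x => ?_
        change 2 * a * x ^ 2 - a ^ 2 * (x ^ 2 + x ^ 4) ≤ x * (x / (1 + x ^ 2))
        rw [← mul_div_assoc, le_div_iff₀ (by positivity)]
        nlinarith [mul_nonneg (sq_nonneg x) (sq_nonneg (1 - a * (1 + x ^ 2)))]

/-- The lower bound for linear forms `S = ⟨b, y⟩` in independent copies of a symmetric variable.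
The product density `∏ (1 + v_j tilt (b_j))` moves the mean of `S` to a multiple of `⟨v, y⟩`,
keeps its variance below `|y|²`, and has second moment at most `exp |v|²`. Two applications of
the Cauchy-Schwarz inequality transfer the bound under the tilted law to the original one. -/
theorem le_measure_dotProduct_ge [IsProbabilityMeasure μ] (h : SymmLaw μ K) {d : ℕ}
    {y v : Fin d → ℝ} (hv : ∀ j, |v j| ≤ 1) {ρ : ℝ}
    (hρ : 0 < ρ) (hpos : 0 < v ⬝ᵥ y) (hy : ρ ^ 2 * (y ⬝ᵥ y) ≤ (v ⬝ᵥ y) ^ 2) :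
    (ρ ^ 2 / (4 * ((1 + K) ^ 2 + ρ ^ 2))) ^ 2 * Real.exp (-(v ⬝ᵥ v)) ≤
      (Measure.pi fun _ : Fin d => μ).real {b | v ⬝ᵥ y / (2 * (1 + K)) ≤ b ⬝ᵥ y} := by
  set P := Measure.pi fun _ : Fin d => μ with hP
  have hK := h.one_le
  set ϑ := ∫ x, x * tilt x ∂μ with hϑ
  have hϑ1 := h.integral_mul_tilt_le
  have hϑ0 := h.le_integral_mul_tilt
  have hϑpos : 0 < ϑ := lt_of_lt_of_le (by positivity) hϑ0
  set p : Fin d → ℝ → ℝ := fun j x => 1 + v j * tilt x with hp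
  have hpb : ∀ j x, |v j * tilt x| ≤ 1 / 2 := fun j x => by
    rw [abs_mul]
    calc _ ≤ 1 * (1 / 2) := mul_le_mul (hv j) (abs_tilt_le x) (abs_nonneg _) zero_le_one
      _ = _ := by norm_num
  have hp0 : ∀ j x, 0 ≤ p j x := fun j x => by
    have := (abs_le.1 (hpb j x)).1
    simp only [hp]; linarith
  have hp2 : ∀ j x, ‖p j x‖ ≤ 2 := fun j x => by
    have := abs_le.1 (hpb j x)
    rw [Real.norm_eq_abs, abs_of_nonneg (hp0 j x)]
    simp only [hp]; linarith
  have hpc : ∀ j, Continuous (p j) := fun j => by simp only [hp]; fun_prop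
  set L : (Fin d → ℝ) → ℝ := fun b => ∏ j, p j (b j) with hL
  have hLc : Continuous L := continuous_finsetProd _ fun j _ => (hpc j).comp (continuous_apply j)
  have hL0 : ∀ b, 0 ≤ L b := fun b => Finset.prod_nonneg fun j _ => hp0 j _
  -- Multiplication by `p j` preserves the total mass and the second moment, since `tilt` is odd,
  -- and shifts the mean from `0` to `v j * ϑ`.
  have i0 : ∀ j, ∫ x, p j x ∂μ = 1 := fun j => by
    simp only [hp]
    rw [integral_add (integrable_const _) ((integrable_tilt μ).const_mul _), integral_const_mul,
      h.integral_tilt]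
    simp
  have i1 : ∀ j, ∫ x, x * p j x ∂μ = v j * ϑ := fun j => by
    have : ∀ x, x * p j x = x + v j * (x * tilt x) := fun x => by simp only [hp]; ring
    simp only [this]
    rw [integral_add h.integrable_id (h.integrable_mul_tilt.const_mul _), integral_const_mul,
      h.integral_id, zero_add]
  have i2 : ∀ j, ∫ x, x ^ 2 * p j x ∂μ = 1 := fun j => by
    have : ∀ x, x ^ 2 * p j x = x ^ 2 + v j * (x ^ 2 * tilt x) := fun x => by
      simp only [hp]; ring
    simp only [this]
    rw [integral_add h.integrable_sq (h.integrable_sq_mul_tilt.const_mul _), integral_const_mul,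
      h.integral_sq_mul_tilt, h.integral_sq]
    simp
  have i3 : ∀ j, ∫ x, p j x ^ 2 ∂μ ≤ Real.exp (v j ^ 2) := fun j => by
    have h1 : ∀ x, p j x ^ 2 ≤ 1 + 2 * v j * tilt x + v j ^ 2 := fun x => by
      have := sq_le_sq' (by linarith [(abs_le.1 (abs_tilt_le x)).1])
        ((abs_le.1 (abs_tilt_le x)).2.trans (by norm_num : (1 : ℝ) / 2 ≤ 1))
      simp only [hp]
      nlinarith [mul_le_mul_of_nonneg_left this (sq_nonneg (v j))]
    calc ∫ x, p j x ^ 2 ∂μ ≤ ∫ x, (1 + 2 * v j * tilt x + v j ^ 2) ∂μ := by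
          refine integral_mono (Integrable.of_bound (C := 4) (by fun_prop) (.of_forall fun x => ?_))
            (((integrable_const _).add ((integrable_tilt μ).const_mul _)).add
              (integrable_const _)) h1
          rw [norm_pow]
          nlinarith [hp2 j x, norm_nonneg (p j x)]
      _ = v j ^ 2 + 1 := by
          rw [integral_add_add (integrable_const _) ((integrable_tilt μ).const_mul _)
            (integrable_const _), integral_const_mul, h.integral_tilt]
          simp; ring
      _ ≤ _ := Real.add_one_le_exp _
  have g0 : ∫ b, L b ∂P = 1 := by
    rw [hP, hL, integral_fintype_prod_eq_prod (𝕜 := ℝ)]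
    simp [i0]
  have e1 : ∀ i b, b i * L b = ∏ j, (if j = i then b j * p j (b j) else p j (b j)) := fun i b => by
    have : ∀ j, (if j = i then b j * p j (b j) else p j (b j)) =
        (if j = i then b i else 1) * p j (b j) := fun j => by split_ifs with hj <;> simp [hj]
    simp only [this, Finset.prod_mul_distrib]
    simp [hL]
  have hpI : ∀ j, Integrable (p j) μ := fun j =>
    Integrable.of_bound (hpc j).aestronglyMeasurable 2 (.of_forall (hp2 j))
  have hpI1 : ∀ j, Integrable (fun x => x * p j x) μ := fun j =>
    h.integrable_id.mul_bdd (hpc j).aestronglyMeasurable (.of_forall (hp2 j))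
  have hpI2 : ∀ j, Integrable (fun x => x ^ 2 * p j x) μ := fun j =>
    h.integrable_sq.mul_bdd (hpc j).aestronglyMeasurable (.of_forall (hp2 j))
  have hLI : Integrable L P := Integrable.fintype_prod hpI
  have hI1 : ∀ i, Integrable (fun b => b i * L b) P := fun i => by
    simp only [e1]
    refine Integrable.fintype_prod (f := fun j x => if j = i then x * p j x else p j x) fun j => ?_
    by_cases hj : j = i
    · simpa [hj] using hpI1 i
    · simpa [hj] using hpI j
  have g1 : ∀ i, ∫ b, b i * L b ∂P = v i * ϑ := fun i => by
    simp only [e1]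
    rw [hP, integral_fintype_prod_eq_prod (𝕜 := ℝ)
      (f := fun j x => if j = i then x * p j x else p j x)]
    have : ∀ j, ∫ x, (if j = i then x * p j x else p j x) ∂μ = if j = i then v i * ϑ else 1 :=
      fun j => by
        by_cases hj : j = i
        · simp [hj, i1]
        · simp [hj, i0]
    simp [this]
  have e2 : ∀ i k b, b i * b k * L b = ∏ j, ((if j = i then b j else 1) *
      (if j = k then b j else 1) * p j (b j)) := fun i k b => by
    simp only [Finset.prod_mul_distrib]
    simp [hL]
  have hI2 : ∀ i k, Integrable (fun b => b i * b k * L b) P := fun i k => by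
    simp only [e2]
    refine Integrable.fintype_prod (f := fun j x => (if j = i then x else 1) *
      (if j = k then x else 1) * p j x) fun j => ?_
    by_cases hj : j = i <;> by_cases hk : j = k
    · simpa only [if_pos hj, if_pos hk, ← pow_two] using hpI2 j
    · simpa only [if_pos hj, if_neg hk, mul_one] using hpI1 j
    · simpa only [if_neg hj, if_pos hk, one_mul] using hpI1 j
    · simpa only [if_neg hj, if_neg hk, mul_one, one_mul] using hpI j
  have g2 : ∀ i k, ∫ b, b i * b k * L b ∂P = if i = k then 1 else (v i * ϑ) * (v k * ϑ) :=
      fun i k => by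
    simp only [e2]
    rw [hP, integral_fintype_prod_eq_prod (𝕜 := ℝ)
      (f := fun j x => (if j = i then x else 1) * (if j = k then x else 1) * p j x)]
    by_cases hik : i = k
    · subst hik
      rw [if_pos rfl]
      refine Finset.prod_eq_one fun j _ => ?_
      by_cases hj : j = i
      · simp only [if_pos hj, ← pow_two, i2]
      · simp only [if_neg hj, mul_one, one_mul, i0]
    · rw [if_neg hik]
      have : ∀ j, ∫ x, (if j = i then x else 1) * (if j = k then x else 1) * p j x ∂μ =
          (if j = i then v i * ϑ else 1) * (if j = k then v k * ϑ else 1) := fun j => by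
        by_cases hj : j = i
        · subst hj
          simp only [if_true, if_neg hik, mul_one, i1]
        · by_cases hk : j = k
          · subst hk
            simp only [if_neg hj, if_true, one_mul, i1]
          · simp only [if_neg hj, if_neg hk, mul_one, one_mul, i0]
      rw [Finset.prod_congr rfl fun j _ => this j, Finset.prod_mul_distrib]
      simp
  have hLI2 : Integrable (fun b => L b ^ 2) P := by
    simp only [hL, ← Finset.prod_pow]
    refine Integrable.fintype_prod (f := fun j x => p j x ^ 2) fun j => ?_
    refine Integrable.of_bound (C := 4) (by fun_prop) (.of_forall fun x => ?_)
    rw [norm_pow]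
    nlinarith [hp2 j x, norm_nonneg (p j x)]
  have g3 : ∫ b, L b ^ 2 ∂P ≤ Real.exp (v ⬝ᵥ v) := by
    simp only [hL, ← Finset.prod_pow]
    rw [hP, integral_fintype_prod_eq_prod (𝕜 := ℝ) (f := fun j x => p j x ^ 2), dotProduct,
      Real.exp_sum]
    refine Finset.prod_le_prod (fun j _ => integral_nonneg fun x => sq_nonneg _) fun j _ => ?_
    rw [← pow_two]; exact i3 j
  set S : (Fin d → ℝ) → ℝ := fun b => b ⬝ᵥ y with hS
  have hSc : Continuous S := by simp only [hS, dotProduct]; fun_prop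
  set M := ϑ * (v ⬝ᵥ y) with hM
  have hM0 : 0 < M := mul_pos hϑpos hpos
  have eS1 : ∀ b, S b * L b = ∑ i, y i * (b i * L b) := fun b => by
    simp only [hS, dotProduct, Finset.sum_mul]
    exact Finset.sum_congr rfl fun i _ => by ring
  have hSI : Integrable (fun b => S b * L b) P := by
    simp only [eS1]
    exact integrable_finsetSum _ fun i _ => (hI1 i).const_mul _
  have hSM : ∫ b, S b * L b ∂P = M := by
    simp only [eS1]
    rw [integral_finsetSum _ fun i _ => (hI1 i).const_mul _, hM, dotProduct, Finset.mul_sum]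
    refine Finset.sum_congr rfl fun i _ => ?_
    rw [integral_const_mul, g1]; ring
  have eS2 : ∀ b, S b ^ 2 * L b = ∑ i, ∑ k, y i * y k * (b i * b k * L b) := fun b => by
    simp only [hS, dotProduct]
    rw [pow_two, Finset.sum_mul_sum, Finset.sum_mul]
    simp only [Finset.sum_mul]
    exact Finset.sum_congr rfl fun i _ => Finset.sum_congr rfl fun k _ => by ring
  have hSI2 : Integrable (fun b => S b ^ 2 * L b) P := by
    simp only [eS2]
    exact integrable_finsetSum _ fun i _ => integrable_finsetSum _ fun k _ =>
      (hI2 i k).const_mul _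
  have hSV : ∫ b, S b ^ 2 * L b ∂P ≤ y ⬝ᵥ y + M ^ 2 := by
    simp only [eS2]
    rw [integral_finsetSum _ fun i _ => integrable_finsetSum _ fun k _ => (hI2 i k).const_mul _]
    have hin : ∀ i, ∫ b, ∑ k, y i * y k * (b i * b k * L b) ∂P ≤
        y i * y i + ∑ k, (y i * (v i * ϑ)) * (y k * (v k * ϑ)) := fun i => by
      rw [integral_finsetSum _ fun k _ => (hI2 i k).const_mul _]
      have : ∀ k, ∫ b, y i * y k * (b i * b k * L b) ∂P ≤
          (if i = k then y i * y i else 0) + (y i * (v i * ϑ)) * (y k * (v k * ϑ)) := fun k => by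
        rw [integral_const_mul, g2]
        by_cases hik : i = k
        · subst hik
          simp only [if_true]
          nlinarith [mul_self_nonneg (y i * (v i * ϑ))]
        · simp only [if_neg hik]
          exact le_of_eq (by ring)
      refine (Finset.sum_le_sum fun k _ => this k).trans (le_of_eq ?_)
      rw [Finset.sum_add_distrib]
      simp
    refine (Finset.sum_le_sum fun i _ => hin i).trans (le_of_eq ?_)
    rw [Finset.sum_add_distrib]
    congr 1
    rw [← Finset.sum_mul_sum, pow_two]
    have : ∑ i, y i * (v i * ϑ) = M := by
      rw [hM, dotProduct, Finset.mul_sum]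
      exact Finset.sum_congr rfl fun i _ => by ring
    rw [this]
  -- two applications of the Cauchy-Schwarz inequality
  set A := {b : Fin d → ℝ | M / 2 ≤ S b} with hA
  have hAm : MeasurableSet A := measurableSet_le measurable_const hSc.measurable
  set χ : (Fin d → ℝ) → ℝ := A.indicator 1 with hχ
  have hχm : Measurable χ := measurable_one.indicator hAm
  have hχ01 : ∀ b, χ b = 0 ∨ χ b = 1 := fun b => by
    by_cases hb : b ∈ A <;> simp [hχ, hb]
  have hχ1 : ∀ b, ‖χ b‖ ≤ 1 := fun b => by rcases hχ01 b with hb | hb <;> simp [hb]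
  have hχ2 : ∀ b, χ b ^ 2 = χ b := fun b => by rcases hχ01 b with hb | hb <;> simp [hb]
  have hLχ : Integrable (fun b => L b * χ b) P :=
    hLI.mul_bdd hχm.aestronglyMeasurable (.of_forall hχ1)
  have hSLχ : Integrable (fun b => S b * L b * χ b) P :=
    hSI.mul_bdd hχm.aestronglyMeasurable (.of_forall hχ1)
  set q := ∫ b, L b * χ b ∂P with hq
  have hq0 : 0 ≤ q := integral_nonneg fun b => mul_nonneg (hL0 b) (by
    rcases hχ01 b with hb | hb <;> simp [hb])
  have c1 : M / 2 ≤ ∫ b, S b * L b * χ b ∂P := by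
    have : M ≤ M / 2 * 1 + ∫ b, S b * L b * χ b ∂P := by
      rw [← g0, ← integral_const_mul, ← integral_add (hLI.const_mul _) hSLχ, ← hSM]
      refine integral_mono hSI ((hLI.const_mul _).add hSLχ) fun b => ?_
      simp only [hSM]
      by_cases hb : b ∈ A
      · simp only [hχ, Set.indicator_of_mem hb, Pi.one_apply, mul_one]
        have := mul_nonneg (half_pos hM0).le (hL0 b)
        linarith
      · simp only [hχ, Set.indicator_of_notMem hb, mul_zero, add_zero]
        have hb' : S b ≤ M / 2 := (not_le.1 hb).le
        exact mul_le_mul_of_nonneg_right hb' (hL0 b)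
    linarith
  have c2 : (M / 2) ^ 2 ≤ (y ⬝ᵥ y + M ^ 2) * q := by
    have hs : ∀ b, Real.sqrt (L b) ^ 2 = L b := fun b => Real.sq_sqrt (hL0 b)
    have e1 : ∀ b, S b * L b * χ b = S b * Real.sqrt (L b) * (Real.sqrt (L b) * χ b) := fun b => by
      conv_lhs => rw [← hs b]
      ring
    have e2 : ∀ b, (S b * Real.sqrt (L b)) ^ 2 = S b ^ 2 * L b := fun b => by
      rw [mul_pow, hs]
    have e3 : ∀ b, (Real.sqrt (L b) * χ b) ^ 2 = L b * χ b := fun b => by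
      rw [mul_pow, hs, hχ2]
    have := sq_integral_mul_le (P := P) (f := fun b => S b * Real.sqrt (L b))
      (g := fun b => Real.sqrt (L b) * χ b) (by simpa only [e2] using hSI2)
      (by simpa only [e3] using hLχ) (by simpa only [← e1] using hSLχ)
    simp only [e2, e3, ← e1] at this
    calc (M / 2) ^ 2 ≤ (∫ b, S b * L b * χ b ∂P) ^ 2 := by gcongr
      _ ≤ _ := this
      _ ≤ _ := by gcongr
  have c3 : q ^ 2 ≤ Real.exp (v ⬝ᵥ v) * P.real A := by
    have := sq_integral_mul_le (P := P) (f := L) (g := χ) hLI2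
      (by simp only [hχ2]; exact Integrable.of_bound hχm.aestronglyMeasurable 1 (.of_forall hχ1))
      hLχ
    simp only [hχ2] at this
    rw [hχ, integral_indicator_one hAm] at this
    exact this.trans (by gcongr)
  have c4 : ρ ^ 2 / (4 * ((1 + K) ^ 2 + ρ ^ 2)) ≤ q := by
    have hy0 : 0 ≤ y ⬝ᵥ y := by
      rw [dotProduct]; exact Finset.sum_nonneg fun i _ => mul_self_nonneg _
    have hMy : ρ ^ 2 * (y ⬝ᵥ y) ≤ (1 + K) ^ 2 * M ^ 2 := by
      refine hy.trans ?_
      have h1 : 1 ≤ (1 + K) * ϑ := by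
        rw [div_le_iff₀ (by positivity)] at hϑ0; linarith
      have h2 : v ⬝ᵥ y ≤ (1 + K) * M := by
        rw [hM, ← mul_assoc]; exact le_mul_of_one_le_left hpos.le h1
      rw [← mul_pow]; gcongr
    have hpos' : 0 < y ⬝ᵥ y + M ^ 2 := by positivity
    have h3 : (M / 2) ^ 2 / (y ⬝ᵥ y + M ^ 2) ≤ q := by
      rw [div_le_iff₀ hpos']; linarith
    refine le_trans ?_ h3
    rw [div_le_div_iff₀ (by positivity) hpos']
    nlinarith
  have hsub : P.real A ≤ P.real {b | v ⬝ᵥ y / (2 * (1 + K)) ≤ b ⬝ᵥ y} := by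
    refine measureReal_mono fun b hb => ?_
    refine le_trans ?_ (show M / 2 ≤ b ⬝ᵥ y from hb)
    rw [hM]
    calc v ⬝ᵥ y / (2 * (1 + K)) = 1 / (1 + K) * (v ⬝ᵥ y) / 2 := by field_simp
      _ ≤ _ := by gcongr
  refine le_trans ?_ hsub
  rw [Real.exp_neg, ← div_eq_mul_inv, div_le_iff₀ (Real.exp_pos _), mul_comm (P.real A)]
  refine le_trans ?_ c3
  gcongr

end SymmLaw

end NoiseBlind

/-! ### Lower tail bounds in the super-Gaussian case -/

namespace NoiseBlind

lemma le_gaussianReal_abs_gt {t : ℝ} (ht : 1 ≤ t) :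
    2 * Real.exp (-(4 * t ^ 2)) ≤ (gaussianReal 0 1).real {g | t < |g|} := by
  have hsub : Set.Ioc t (t + 1) ⊆ {g : ℝ | t < |g|} := fun g hg =>
    lt_of_lt_of_le hg.1 (le_abs_self g)
  refine le_trans ?_ (measureReal_mono hsub)
  rw [Measure.real, gaussianReal_apply_eq_integral 0 one_ne_zero, ENNReal.toReal_ofReal
    (integral_nonneg fun x => gaussianPDFReal_nonneg _ _ _)]
  have hpdf : ∀ x ∈ Set.Ioc t (t + 1), 2 * Real.exp (-(4 * t ^ 2)) ≤ gaussianPDFReal 0 1 x := by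
    intro x hx
    rw [gaussianPDFReal]
    simp only [NNReal.coe_one, mul_one, sub_zero]
    have h1 : Real.sqrt (2 * Real.pi) ≤ 2.6 := by
      rw [Real.sqrt_le_left (by norm_num)]
      linarith [Real.pi_lt_d2]
    have h2 : (5.4 : ℝ) ≤ Real.exp 2 := by
      have := Real.exp_one_gt_d9
      have h3 : Real.exp 2 = Real.exp 1 * Real.exp 1 := by rw [← Real.exp_add]; norm_num
      nlinarith
    have h3 : 0 < Real.sqrt (2 * Real.pi) := Real.sqrt_pos.2 (by positivity)
    have h4 : Real.exp (-(4 * t ^ 2)) * Real.exp 2 ≤ Real.exp (-x ^ 2 / 2) := by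
      rw [← Real.exp_add, Real.exp_le_exp]
      have : x ^ 2 ≤ (2 * t) ^ 2 := by
        have := hx.1; have := hx.2
        gcongr <;> linarith
      nlinarith
    have h5 := Real.exp_pos (-(4 * t ^ 2))
    rw [inv_mul_eq_div, le_div_iff₀ h3]
    nlinarith
  calc 2 * Real.exp (-(4 * t ^ 2)) = ∫ _x in Set.Ioc t (t + 1), 2 * Real.exp (-(4 * t ^ 2)) := by
        simp
    _ ≤ _ := setIntegral_mono_on (integrableOn_const (by simp))
        (integrable_gaussianPDFReal 0 1).integrableOn measurableSet_Ioc hpdf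

namespace SymmLaw

variable {μ : Measure ℝ} [IsProbabilityMeasure μ] {K σ : ℝ}

/-- Each of the two tails of a symmetric super-Gaussian variable has at least half the mass of the
two-sided Gaussian tail. -/
lemma le_measure_gt (h : SymmLaw μ K) (hσ : 0 < σ)
    (hG : ∀ t : ℝ, 0 < t → gaussianReal 0 1 {g | t < |σ * g|} ≤ μ {x | t < |x|})
    {t : ℝ} (ht : 1 ≤ t) :
    Real.exp (-(4 * t ^ 2)) ≤ μ.real {x | σ * t < x} ∧
      Real.exp (-(4 * t ^ 2)) ≤ μ.real {x | σ * t < -x} := by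
  have h1 : {g : ℝ | σ * t < |σ * g|} = {g | t < |g|} := by
    ext g
    simp only [Set.mem_ofPred_eq, abs_mul, abs_of_pos hσ, mul_lt_mul_iff_right₀ hσ]
  have h2 := hG (σ * t) (by positivity)
  rw [h1] at h2
  have h3 : (gaussianReal 0 1).real {g | t < |g|} ≤ μ.real {x | σ * t < |x|} :=
    ENNReal.toReal_mono (measure_ne_top _ _) h2
  have h4 : {x : ℝ | σ * t < |x|} ⊆ {x | σ * t < x} ∪ {x | σ * t < -x} := fun x hx => by
    rwa [Set.mem_union, Set.mem_ofPred_eq, Set.mem_ofPred_eq, ← lt_abs]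
  have h5 : μ.real {x | σ * t < -x} = μ.real {x | σ * t < x} := by
    have := h.measurePreserving_neg.measureReal_preimage (s := {x | σ * t < x})
      (measurableSet_lt measurable_const measurable_id).nullMeasurableSet
    rw [← this]; rfl
  have h6 := (measureReal_mono (μ := μ) h4).trans (measureReal_union_le _ _)
  have h7 := le_gaussianReal_abs_gt ht
  rw [h5] at h6 ⊢
  constructor <;> linarith

/-- Half of the mass of a box in the coordinates of `J` lies where the remaining coordinates
contribute nonnegatively to a linear form, by symmetry in those coordinates. -/
lemma prod_le_measure_dotProduct_ge (h : SymmLaw μ K) {d : ℕ} (J : Finset (Fin d))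
    (y c : Fin d → ℝ) :
    (∏ j ∈ J, μ.real {x | c j ≤ x * y j}) / 2 ≤
      (Measure.pi fun _ : Fin d => μ).real {b | ∑ j ∈ J, c j ≤ b ⬝ᵥ y} := by
  set P := Measure.pi fun _ : Fin d => μ with hP
  set box : Set (Fin d → ℝ) :=
    Set.pi Set.univ fun j => if j ∈ J then {x | c j ≤ x * y j} else Set.univ with hbox
  have hboxm : MeasurableSet box := MeasurableSet.univ_pi fun j => by
    by_cases hj : j ∈ J
    · simp only [hj, if_true]
      exact measurableSet_le measurable_const (by fun_prop)
    · simp [hj]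
  have hPbox : P.real box = ∏ j ∈ J, μ.real {x | c j ≤ x * y j} := by
    rw [Measure.real, hP, hbox, Measure.pi_pi, ENNReal.toReal_prod,
      ← Finset.prod_subset (Finset.subset_univ J)]
    · exact Finset.prod_congr rfl fun j hj => by simp [hj, Measure.real]
    · intro j _ hj; simp [hj]
  set R : (Fin d → ℝ) → ℝ := fun b => ∑ j ∈ Jᶜ, b j * y j with hR
  have hRm : Measurable R := by simp only [hR]; fun_prop
  set F : (Fin d → ℝ) → Fin d → ℝ := fun b j => if j ∈ J then b j else -b j with hF
  have hFp : MeasurePreserving F P P := by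
    have := measurePreserving_pi (fun _ : Fin d => μ) (fun _ : Fin d => μ)
      (f := fun j x => if j ∈ J then x else -x) fun j => by
        by_cases hj : j ∈ J
        · simp only [hj, if_true]
          exact MeasurePreserving.id μ
        · simpa [hj] using h.measurePreserving_neg
    exact this
  have hE : MeasurableSet (box ∩ {b | 0 ≤ R b}) :=
    hboxm.inter (measurableSet_le measurable_const hRm)
  have hflip : F ⁻¹' (box ∩ {b | 0 ≤ R b}) = box ∩ {b | R b ≤ 0} := by
    ext b
    have h1 : F b ∈ box ↔ b ∈ box := by
      simp only [hbox, Set.mem_univ_pi]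
      refine forall_congr' fun j => ?_
      by_cases hj : j ∈ J <;> simp [hj, hF]
    have h2 : R (F b) = -R b := by
      simp only [hR, ← Finset.sum_neg_distrib]
      refine Finset.sum_congr rfl fun j hj => ?_
      simp [hF, Finset.mem_compl.1 hj]
    rw [Set.mem_preimage, Set.mem_inter_iff, Set.mem_inter_iff, h1, Set.mem_ofPred_eq,
      Set.mem_ofPred_eq, h2, neg_nonneg]
  have hcover : box ⊆ (box ∩ {b | 0 ≤ R b}) ∪ (box ∩ {b | R b ≤ 0}) := fun b hb => by
    rcases le_total 0 (R b) with h0 | h0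
    · exact Or.inl ⟨hb, h0⟩
    · exact Or.inr ⟨hb, h0⟩
  have h1 := (measureReal_mono (μ := P) hcover).trans (measureReal_union_le _ _)
  rw [← hflip, hFp.measureReal_preimage hE.nullMeasurableSet, hPbox] at h1
  have h2 : box ∩ {b | 0 ≤ R b} ⊆ {b | ∑ j ∈ J, c j ≤ b ⬝ᵥ y} := by
    rintro b ⟨hb, h0⟩
    have h3 : b ⬝ᵥ y = (∑ j ∈ J, b j * y j) + R b := by
      rw [dotProduct, hR, Finset.sum_add_sum_compl]
    have h4 : ∑ j ∈ J, c j ≤ ∑ j ∈ J, b j * y j := Finset.sum_le_sum fun j hj => by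
      have := hb j (Set.mem_univ j)
      simpa [hj] using this
    have h0' : 0 ≤ R b := h0
    rw [Set.mem_ofPred_eq, h3]
    linarith
  have h3 := measureReal_mono (μ := P) h2
  linarith

/-- For a super-Gaussian variable the lower bound for linear forms holds at the level `α` in every
direction: if most of the mass of `y` sits in coordinates below `4 / α`, then the law is tilted
along these; otherwise the few large coordinates alone reach the level, each being large with the
probability that it has for a Gaussian variable. -/
theorem le_measure_dotProduct_ge_of_superGaussian (h : SymmLaw μ K) (hσ : 0 < σ)
    (hG : ∀ t : ℝ, 0 < t → gaussianReal 0 1 {g | t < |σ * g|} ≤ μ {x | t < |x|})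
    {d : ℕ} {y : Fin d → ℝ} (hy : y ⬝ᵥ y = 1) {α : ℝ} (hα : 1 ≤ α) :
    ((1 / 8) ^ 2 / (4 * ((1 + K) ^ 2 + (1 / 8) ^ 2))) ^ 2 * Real.exp (-(α ^ 2 / 4)) ≤
      (Measure.pi fun _ : Fin d => μ).real
        {b | min (1 / (16 * (1 + K))) (σ / 8) * α ≤ b ⬝ᵥ y} := by
  have hK := h.one_le
  set J : Finset (Fin d) := Finset.univ.filter fun j => 1 < |α / 4 * y j| with hJ
  have hsplit : (∑ j ∈ J, y j * y j) + ∑ j ∈ Jᶜ, y j * y j = 1 := by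
    rw [Finset.sum_add_sum_compl]; exact hy
  have hJ0 : 0 ≤ ∑ j ∈ J, y j * y j := Finset.sum_nonneg fun j _ => mul_self_nonneg _
  have hJ0' : 0 ≤ ∑ j ∈ Jᶜ, y j * y j := Finset.sum_nonneg fun j _ => mul_self_nonneg _
  rcases le_total (1 / 2) (∑ j ∈ Jᶜ, y j * y j) with hc | hc
  · set v : Fin d → ℝ := fun j => if j ∈ Jᶜ then α / 4 * y j else 0 with hv
    have hvy : v ⬝ᵥ y = α / 4 * ∑ j ∈ Jᶜ, y j * y j := by
      simp only [dotProduct, hv, ite_mul, zero_mul]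
      rw [Finset.sum_ite_mem, Finset.univ_inter, Finset.mul_sum]
      exact Finset.sum_congr rfl fun j _ => by ring
    have hvv : v ⬝ᵥ v = α ^ 2 / 16 * ∑ j ∈ Jᶜ, y j * y j := by
      simp only [dotProduct, hv, ite_mul, zero_mul]
      rw [Finset.sum_ite_mem, Finset.univ_inter, Finset.mul_sum]
      exact Finset.sum_congr rfl fun j hj => by rw [if_pos hj]; ring
    have hle : α / 8 ≤ v ⬝ᵥ y := by rw [hvy]; nlinarith
    have h1 := h.le_measure_dotProduct_ge (y := y) (v := v) (fun j => by
      by_cases hj : j ∈ J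
      · simp [hv, hj]
      · have : |α / 4 * y j| ≤ 1 := by simpa [hJ] using hj
        simpa [hv, hj] using this) (ρ := 1 / 8) (by norm_num) (by linarith)
      (by rw [hy]; nlinarith)
    refine le_trans ?_ (h1.trans (measureReal_mono fun b hb => ?_))
    · gcongr
      rw [hvv]
      nlinarith [sq_nonneg α]
    · refine le_trans ?_ (show v ⬝ᵥ y / (2 * (1 + K)) ≤ b ⬝ᵥ y from hb)
      calc min (1 / (16 * (1 + K))) (σ / 8) * α ≤ 1 / (16 * (1 + K)) * α := by
            gcongr; exact min_le_left _ _
        _ = α / 8 / (2 * (1 + K)) := by field_simp; norm_num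
        _ ≤ _ := by gcongr
  · have h1 := h.prod_le_measure_dotProduct_ge J y (fun j => σ * |α / 4 * y j| * |y j|)
    refine le_trans ?_ (h1.trans (measureReal_mono fun b hb => ?_))
    · have hprod : Real.exp (-(α ^ 2 / 4)) ≤
          ∏ j ∈ J, μ.real {x | σ * |α / 4 * y j| * |y j| ≤ x * y j} := by
        calc Real.exp (-(α ^ 2 / 4)) ≤ Real.exp (∑ j ∈ J, -(4 * |α / 4 * y j| ^ 2)) := by
              rw [Real.exp_le_exp, Finset.sum_neg_distrib, neg_le_neg_iff]
              have : ∑ j ∈ J, 4 * |α / 4 * y j| ^ 2 = α ^ 2 / 4 * ∑ j ∈ J, y j * y j := by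
                rw [Finset.mul_sum]
                exact Finset.sum_congr rfl fun j _ => by rw [sq_abs]; ring
              rw [this]
              nlinarith [sq_nonneg α]
          _ = ∏ j ∈ J, Real.exp (-(4 * |α / 4 * y j| ^ 2)) := Real.exp_sum _ _
          _ ≤ _ := by
              refine Finset.prod_le_prod (fun j _ => Real.exp_nonneg _) fun j hj => ?_
              have hj1 : 1 < |α / 4 * y j| := by simpa [hJ] using hj
              obtain ⟨h2, h3⟩ := h.le_measure_gt hσ hG hj1.le
              rcases le_total 0 (y j) with h0 | h0
              · refine h2.trans (measureReal_mono fun x hx => ?_)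
                rw [Set.mem_ofPred_eq] at hx ⊢
                rw [abs_of_nonneg h0]
                exact mul_le_mul_of_nonneg_right hx.le h0
              · refine h3.trans (measureReal_mono fun x hx => ?_)
                rw [Set.mem_ofPred_eq] at hx ⊢
                rw [abs_of_nonpos h0]
                have := mul_le_mul_of_nonneg_right hx.le (neg_nonneg.2 h0)
                linarith
      have hβ : ((1 / 8 : ℝ) ^ 2 / (4 * ((1 + K) ^ 2 + (1 / 8) ^ 2))) ^ 2 ≤ 1 / 2 := by
        have h2 : (1 / 8 : ℝ) ^ 2 / (4 * ((1 + K) ^ 2 + (1 / 8) ^ 2)) ≤ 1 / 2 := by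
          rw [div_le_div_iff₀ (by positivity) (by norm_num)]
          nlinarith
        have h3 : 0 ≤ (1 / 8 : ℝ) ^ 2 / (4 * ((1 + K) ^ 2 + (1 / 8) ^ 2)) := by positivity
        nlinarith
      nlinarith [Real.exp_pos (-(α ^ 2 / 4))]
    · refine le_trans ?_ (show ∑ j ∈ J, σ * |α / 4 * y j| * |y j| ≤ b ⬝ᵥ y from hb)
      have : ∑ j ∈ J, σ * |α / 4 * y j| * |y j| = σ * (α / 4) * ∑ j ∈ J, y j * y j := by
        rw [Finset.mul_sum]
        refine Finset.sum_congr rfl fun j _ => ?_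
        rw [abs_mul, abs_of_pos (show 0 < α / 4 by linarith), ← abs_mul_abs_self (y j)]
        ring
      rw [this]
      calc min (1 / (16 * (1 + K))) (σ / 8) * α ≤ σ / 8 * α := by
            gcongr; exact min_le_right _ _
        _ = σ * (α / 4) * (1 / 2) := by ring
        _ ≤ _ := by gcongr; linarith

end SymmLaw

end NoiseBlind

/-! ### Moments of sums of independent symmetric variables -/

namespace NoiseBlind

lemma sum_antidiagonal_le_mul_sum {f g : ℕ → ℝ} (hf : ∀ i, 0 ≤ f i) (hg : ∀ i, 0 ≤ g i)
    (n : ℕ) : ∑ i ∈ Finset.range n, ∑ p ∈ Finset.HasAntidiagonal.antidiagonal i, f p.1 * g p.2 ≤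
      (∑ i ∈ Finset.range n, f i) * ∑ i ∈ Finset.range n, g i := by
  rw [Finset.sum_mul_sum, ← Finset.sum_product' (f := fun i j => f i * g j)]
  calc _ = ∑ p ∈ (Finset.range n ×ˢ Finset.range n).filter (fun p => p.1 + p.2 ∈ Finset.range n),
        f p.1 * g p.2 := by
        rw [← Finset.sum_fiberwise_of_maps_to (t := Finset.range n)
          (g := fun p : ℕ × ℕ => p.1 + p.2) (fun p hp => (Finset.mem_filter.1 hp).2)]
        refine Finset.sum_congr rfl fun i hi => Finset.sum_congr ?_ fun _ _ => rfl
        ext p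
        simp only [Finset.mem_range, Finset.HasAntidiagonal.mem_antidiagonal, Finset.mem_filter,
          Finset.mem_product] at hi ⊢
        omega
    _ ≤ _ := Finset.sum_le_sum_of_subset_of_nonneg (Finset.filter_subset _ _)
        fun p _ _ => mul_nonneg (hf _) (hg _)

section Moments

variable {μ : Measure ℝ} [IsProbabilityMeasure μ]

lemma memLp_sum_pi {q : ℝ≥0∞} (hμ : MemLp (fun x => x) q μ) (n : ℕ) :
    MemLp (fun b : Fin n → ℝ => ∑ k, b k) q (Measure.pi fun _ => μ) :=
  memLp_finsetSum _ fun k _ =>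
    hμ.comp_measurePreserving (measurePreserving_eval (fun _ : Fin n => μ) k)

lemma integrable_pow_of_memLp {F : Type*} [MeasurableSpace F] {P : Measure F}
    [IsFiniteMeasure P] {f : F → ℝ} {q j : ℕ} (hf : MemLp f q P) (hj : j ≤ q) :
    Integrable (fun x => f x ^ j) P := by
  have h := (hf.mono_exponent (p := (j : ℝ≥0∞)) (by exact_mod_cast hj)).integrable_norm_pow'
  exact h.mono (hf.aestronglyMeasurable.pow j) (.of_forall fun x => by simp)

lemma integral_sum_pow_succ {q : ℕ} (hμ : MemLp (fun x => x) q μ) (n : ℕ) :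
    ∫ b : Fin (n + 1) → ℝ, (∑ k, b k) ^ q ∂Measure.pi (fun _ => μ) =
      ∑ p ∈ Finset.HasAntidiagonal.antidiagonal q, (q.choose p.1 : ℝ) * ((∫ x, x ^ p.1 ∂μ) *
        ∫ b : Fin n → ℝ, (∑ k, b k) ^ p.2 ∂Measure.pi (fun _ => μ)) := by
  rw [integral_pi_succ]
  simp only [Fin.sum_univ_succ, Fin.cons_zero, Fin.cons_succ]
  simp only [(Commute.all (_ : ℝ) _).add_pow']
  rw [integral_finsetSum]
  · refine Finset.sum_congr rfl fun p _ => ?_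
    simp only [nsmul_eq_mul]
    rw [integral_const_mul, integral_prod_mul (fun x : ℝ => x ^ p.1)
      (fun b : Fin n → ℝ => (∑ k, b k) ^ p.2)]
  · intro p hp
    have hp' := Finset.HasAntidiagonal.mem_antidiagonal.1 hp
    simp only [nsmul_eq_mul]
    refine Integrable.const_mul ?_ _
    exact (integrable_pow_of_memLp hμ (by omega)).mul_prod
      (integrable_pow_of_memLp (memLp_sum_pi hμ n) (by omega))

lemma measurePreserving_neg_pi (h : MeasurePreserving Neg.neg μ μ) (n : ℕ) :
    MeasurePreserving Neg.neg (Measure.pi fun _ : Fin n => μ) (Measure.pi fun _ => μ) :=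
  measurePreserving_pi (fun _ : Fin n => μ) (fun _ => μ) (f := fun _ x => -x) fun _ => h

lemma integral_pow_nonneg {F : Type*} [MeasurableSpace F] {P : Measure F} {S : F → F}
    (hS : MeasurePreserving S P P) {f : F → ℝ} (hf : AEStronglyMeasurable f P)
    (hodd : ∀ x, f (S x) = -f x) (i : ℕ) : 0 ≤ ∫ x, f x ^ i ∂P := by
  rcases Nat.even_or_odd i with hi | hi
  · exact integral_nonneg fun x => hi.pow_nonneg _
  · exact (integral_eq_zero_of_odd hS (hf.pow i) fun x => by
      simp only [Pi.pow_apply, hodd, hi.neg_pow]).ge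

/-- The truncated exponential series `∑_{i ≤ q} l ^ i E S ^ i / i!` is submultiplicative over
independent symmetric summands, because all its terms are nonnegative. -/
lemma sum_moments_le_pow (h : MeasurePreserving Neg.neg μ μ) {q : ℕ}
    (hμ : MemLp (fun x => x) q μ) {l : ℝ} (hl : 0 ≤ l) : ∀ n : ℕ,
    ∑ i ∈ Finset.range (q + 1), l ^ i / i.factorial *
        ∫ b : Fin n → ℝ, (∑ k, b k) ^ i ∂Measure.pi (fun _ => μ) ≤
      (∑ i ∈ Finset.range (q + 1), l ^ i / i.factorial * ∫ x, x ^ i ∂μ) ^ n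
  | 0 => by
      rw [Finset.sum_eq_single 0]
      · simp
      · intro i _ hi; simp [hi]
      · simp
  | n + 1 => by
      have hx : ∀ i, 0 ≤ ∫ x, x ^ i ∂μ := fun i =>
        integral_pow_nonneg h aestronglyMeasurable_id (fun x => rfl) i
      have hb : ∀ i, 0 ≤ ∫ b : Fin n → ℝ, (∑ k, b k) ^ i ∂Measure.pi (fun _ => μ) := fun i =>
        integral_pow_nonneg (measurePreserving_neg_pi h n)
          (by fun_prop : Measurable fun b : Fin n → ℝ => ∑ k, b k).aestronglyMeasurable
          (fun b => by simp) i
      have hg : 0 ≤ ∑ i ∈ Finset.range (q + 1), l ^ i / i.factorial * ∫ x, x ^ i ∂μ :=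
        Finset.sum_nonneg fun i _ => mul_nonneg (by positivity) (hx i)
      rw [pow_succ']
      refine le_trans ?_ (mul_le_mul_of_nonneg_left (sum_moments_le_pow h hμ hl n) hg)
      refine le_trans (le_of_eq ?_) (sum_antidiagonal_le_mul_sum
        (fun i => mul_nonneg (by positivity) (hx i))
        (fun i => mul_nonneg (by positivity) (hb i)) (q + 1))
      refine Finset.sum_congr rfl fun i hi => ?_
      have hiq : i ≤ q := by simpa [Nat.lt_succ_iff] using hi
      rw [integral_sum_pow_succ (hμ.mono_exponent (by exact_mod_cast hiq)) n, Finset.mul_sum]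
      refine Finset.sum_congr rfl fun p hp => ?_
      have hp' : p.1 + p.2 = i := Finset.HasAntidiagonal.mem_antidiagonal.1 hp
      have hc : (i.choose p.1 : ℝ) * (p.1.factorial * p.2.factorial) = i.factorial := by
        rw [← hp']
        exact_mod_cast (by
          rw [← mul_assoc, Nat.choose_symm_add]
          exact Nat.add_choose_mul_factorial_mul_factorial p.1 p.2)
      have h1 : (p.1.factorial : ℝ) ≠ 0 := by positivity
      have h2 : (p.2.factorial : ℝ) ≠ 0 := by positivity
      have h3 : (i.factorial : ℝ) ≠ 0 := by positivity
      have hl' : l ^ i = l ^ p.1 * l ^ p.2 := by rw [← pow_add, hp']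
      rw [hl']
      field_simp
      rw [← hc]
      ring

lemma SymmLaw.memLp_two {K : ℝ} (h : SymmLaw μ K) : MemLp (fun x => x) 2 μ :=
  (memLp_two_iff_integrable_sq (by fun_prop)).2 h.integrable_sq

lemma SymmLaw.integral_sum_sq {K : ℝ} (h : SymmLaw μ K) : ∀ n : ℕ,
    ∫ b : Fin n → ℝ, (∑ k, b k) ^ 2 ∂Measure.pi (fun _ => μ) = n
  | 0 => by simp
  | n + 1 => by
      rw [integral_sum_pow_succ (by exact_mod_cast h.memLp_two) n]
      simp [Finset.Nat.antidiagonal_succ, h.integral_id, h.integral_sq, h.integral_sum_sq n]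

/-- The constant in `integral_sum_pow_le`. -/
noncomputable def momentConst (κ γ : ℝ) : ℝ :=
  4 * Real.exp ((1 / 2 + (Real.exp 1 * κ) ^ 2 *
    ∑' i : ℕ, 4 * ((i : ℝ) ^ ⌈2 * γ - 2⌉₊ * (1 / 2) ^ i)) * (1 / (2 * Real.exp 1 * κ)) ^ 2) *
    (2 * Real.exp 1 * κ) ^ 2

lemma momentConst_pos {κ : ℝ} (hκ : 0 < κ) (γ : ℝ) : 0 < momentConst κ γ := by
  unfold momentConst; positivity

/-- A sum of `n ≥ (2 r) ^ (2 γ - 1)` independent copies of a symmetric variable, whose moments up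
to order `2 r` grow like `‖X‖_i ≤ κ i ^ γ`, has a `2 r`-th moment of Gaussian size. The truncated
exponential series is used at `l ~ √(r / n)`; then all its terms of order at least `4` together
are of order `l²`. -/
theorem integral_sum_pow_le {K : ℝ} (h : SymmLaw μ K) {κ γ : ℝ} (hκ : 0 < κ) (hγ : 1 ≤ γ)
    {r n : ℕ} (hr : 2 ≤ r) (hμ : MemLp (fun x => x) (2 * r : ℕ) μ)
    (hmom : ∀ i : ℕ, 4 ≤ i → i ≤ 2 * r → ∫ x, x ^ i ∂μ ≤ (κ * (i : ℝ) ^ γ) ^ i)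
    (hn : ((2 * r : ℕ) : ℝ) ^ (2 * γ - 1) ≤ n) :
    ∫ b : Fin n → ℝ, (∑ k, b k) ^ (2 * r) ∂Measure.pi (fun _ => μ)
      ≤ (momentConst κ γ * n * r) ^ r := by
  set e := Real.exp 1 with he
  have he0 : 0 < e := Real.exp_pos 1
  set Γ := ∑' i : ℕ, 4 * ((i : ℝ) ^ ⌈2 * γ - 2⌉₊ * (1 / 2) ^ i) with hΓ
  have hsum : Summable fun i : ℕ => 4 * ((i : ℝ) ^ ⌈2 * γ - 2⌉₊ * (1 / 2 : ℝ) ^ i) :=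
    (summable_pow_mul_geometric_of_norm_lt_one ⌈2 * γ - 2⌉₊ (r := (1 / 2 : ℝ))
      (by norm_num)).mul_left 4
  have hΓ0 : 0 ≤ Γ := tsum_nonneg fun i => by positivity
  obtain ⟨c, hc⟩ : ∃ c, c = 1 / (2 * e * κ) := ⟨_, rfl⟩
  have hc0 : 0 < c := by rw [hc]; positivity
  have hec : e * κ * c = 1 / 2 := by rw [hc]; field_simp
  have hr0 : (0 : ℝ) < r := by exact_mod_cast (by omega : 0 < r)
  have hD0 : (0 : ℝ) < (2 * r : ℕ) := by exact_mod_cast (by omega : 0 < 2 * r)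
  have hn0 : (0 : ℝ) < n := lt_of_lt_of_le (Real.rpow_pos_of_pos hD0 _) hn
  set l := c * Real.sqrt (r / n) with hl
  have hl0 : 0 < l := mul_pos hc0 (Real.sqrt_pos.2 (div_pos hr0 hn0))
  have hl2 : l ^ 2 = c ^ 2 * (r / n) := by
    rw [hl, mul_pow, Real.sq_sqrt (div_pos hr0 hn0).le]
  have hlD : l * ((2 * r : ℕ) : ℝ) ^ (γ - 1) ≤ c := by
    refine le_of_sq_le_sq ?_ hc0.le
    have h1 : (((2 * r : ℕ) : ℝ) ^ (γ - 1)) ^ 2 * (2 * r : ℕ) =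
        ((2 * r : ℕ) : ℝ) ^ (2 * γ - 1) := by
      rw [← Real.rpow_natCast, ← Real.rpow_mul hD0.le, ← Real.rpow_add_one hD0.ne']
      congr 1; push_cast; ring
    rw [mul_pow, hl2, mul_assoc]
    refine mul_le_of_le_one_right (sq_nonneg c) ?_
    rw [div_mul_eq_mul_div, div_le_one hn0]
    refine le_trans ?_ hn
    rw [← h1, mul_comm]
    gcongr
    linarith
  have hli : ∀ i : ℕ, 1 ≤ i → i ≤ 2 * r → e * κ * (l * (i : ℝ) ^ (γ - 1)) ≤ 1 / 2 :=
      fun i _ hi => by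
    rw [← hec]
    refine mul_le_mul_of_nonneg_left (le_trans ?_ hlD) (by positivity)
    gcongr
  have hterm : ∀ i : ℕ, 4 ≤ i → i ≤ 2 * r → l ^ i / i.factorial * ∫ x, x ^ i ∂μ ≤
      l ^ 2 * (e * κ) ^ 2 * (4 * ((i : ℝ) ^ ⌈2 * γ - 2⌉₊ * (1 / 2) ^ i)) := fun i hi hir => by
    have hi0 : (0 : ℝ) < i := by exact_mod_cast (by omega : 0 < i)
    have hi1 : (1 : ℝ) ≤ i := by exact_mod_cast (by omega : 1 ≤ i)
    have hfac : (i : ℝ) ^ i / i.factorial ≤ e ^ i := by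
      have := Real.pow_div_factorial_le_exp (i : ℝ) hi0.le i
      rwa [he, ← Real.exp_nat_mul, mul_one]
    set z := e * κ * (l * (i : ℝ) ^ (γ - 1)) with hz
    have hz0 : 0 ≤ z := by positivity
    have hz1 := hli i (by omega) hir
    calc l ^ i / i.factorial * ∫ x, x ^ i ∂μ
        ≤ l ^ i / i.factorial * (κ * (i : ℝ) ^ γ) ^ i := by
          gcongr; exact hmom i hi hir
      _ = (κ * l * (i : ℝ) ^ (γ - 1)) ^ i * ((i : ℝ) ^ i / i.factorial) := by
          have : (i : ℝ) ^ γ = (i : ℝ) ^ (γ - 1) * i := by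
            rw [← Real.rpow_add_one hi0.ne']; congr 1; ring
          rw [this]
          ring
      _ ≤ (κ * l * (i : ℝ) ^ (γ - 1)) ^ i * e ^ i := by gcongr
      _ = z ^ i := by rw [hz]; ring
      _ = z ^ 2 * z ^ (i - 2) := by rw [← pow_add]; congr 1; omega
      _ ≤ z ^ 2 * (1 / 2) ^ (i - 2) := by gcongr
      _ = l ^ 2 * (e * κ) ^ 2 * (((i : ℝ) ^ (γ - 1)) ^ 2 * (1 / 2) ^ (i - 2)) := by rw [hz]; ring
      _ = l ^ 2 * (e * κ) ^ 2 * (4 * ((i : ℝ) ^ (2 * γ - 2) * (1 / 2) ^ i)) := by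
          have h1 : ((i : ℝ) ^ (γ - 1)) ^ 2 = (i : ℝ) ^ (2 * γ - 2) := by
            rw [← Real.rpow_natCast, ← Real.rpow_mul hi0.le]; congr 1; push_cast; ring
          have h2 : (1 / 2 : ℝ) ^ i = (1 / 2) ^ (i - 2) * (1 / 2) ^ 2 := by
            rw [← pow_add]; congr 1; omega
          rw [h1, h2]; ring
      _ ≤ _ := by
          gcongr
          rw [← Real.rpow_natCast]
          exact Real.rpow_le_rpow_of_exponent_le hi1 (Nat.le_ceil _)
  set H := 1 / 2 + (e * κ) ^ 2 * Γ with hH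
  have hg : ∑ i ∈ Finset.range (2 * r + 1), l ^ i / i.factorial * ∫ x, x ^ i ∂μ
      ≤ 1 + H * l ^ 2 := by
    have hsplit : ∑ i ∈ Finset.range (2 * r + 1), l ^ i / i.factorial * ∫ x, x ^ i ∂μ =
        (∑ i ∈ Finset.range 4, l ^ i / i.factorial * ∫ x, x ^ i ∂μ) +
        ∑ i ∈ Finset.Ico 4 (2 * r + 1), l ^ i / i.factorial * ∫ x, x ^ i ∂μ :=
      (Finset.sum_range_add_sum_Ico _ (by omega)).symm
    have h3 : ∫ x, x ^ 3 ∂μ = 0 := integral_eq_zero_of_odd h.measurePreserving_neg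
      (by fun_prop) fun x => by ring
    have hlow : ∑ i ∈ Finset.range 4, l ^ i / i.factorial * ∫ x, x ^ i ∂μ = 1 + l ^ 2 / 2 := by
      simp [Finset.sum_range_succ, h3, h.integral_id, h.integral_sq]
    have hhigh : ∑ i ∈ Finset.Ico 4 (2 * r + 1), l ^ i / i.factorial * ∫ x, x ^ i ∂μ ≤
        l ^ 2 * (e * κ) ^ 2 * Γ := by
      calc _ ≤ ∑ i ∈ Finset.Ico 4 (2 * r + 1),
            l ^ 2 * (e * κ) ^ 2 * (4 * ((i : ℝ) ^ ⌈2 * γ - 2⌉₊ * (1 / 2) ^ i)) :=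
            Finset.sum_le_sum fun i hi => by
              have := Finset.mem_Ico.1 hi
              exact hterm i this.1 (by omega)
        _ ≤ _ := by
            rw [← Finset.mul_sum]
            gcongr
            exact hsum.sum_le_tsum _ fun i _ => by positivity
    rw [hsplit, hlow, hH]
    linarith
  have hmain := sum_moments_le_pow h.measurePreserving_neg hμ hl0.le n
  have hb : ∀ i, 0 ≤ ∫ b : Fin n → ℝ, (∑ k, b k) ^ i ∂Measure.pi (fun _ => μ) := fun i =>
    integral_pow_nonneg (measurePreserving_neg_pi h.measurePreserving_neg n)
      (by fun_prop : Measurable fun b : Fin n → ℝ => ∑ k, b k).aestronglyMeasurable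
      (fun b => by simp) i
  have hlast := Finset.single_le_sum (f := fun i : ℕ => l ^ i / i.factorial *
    ∫ b : Fin n → ℝ, (∑ k, b k) ^ i ∂Measure.pi (fun _ => μ))
    (fun i _ => mul_nonneg (by positivity) (hb i)) (Finset.self_mem_range_succ (2 * r))
  have hx0 : 0 ≤ ∑ i ∈ Finset.range (2 * r + 1), l ^ i / i.factorial * ∫ x, x ^ i ∂μ :=
    Finset.sum_nonneg fun i _ => mul_nonneg (by positivity)
      (integral_pow_nonneg h.measurePreserving_neg aestronglyMeasurable_id (fun x => rfl) i)
  have hexp : (∑ i ∈ Finset.range (2 * r + 1), l ^ i / i.factorial * ∫ x, x ^ i ∂μ) ^ n ≤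
      Real.exp (H * c ^ 2) ^ r := by
    calc _ ≤ Real.exp (H * l ^ 2) ^ n := by
          gcongr
          refine hg.trans ?_
          rw [add_comm]
          exact Real.add_one_le_exp _
      _ = _ := by
          rw [← Real.exp_nat_mul, ← Real.exp_nat_mul, hl2]
          congr 1
          field_simp
  have hfin := (hlast.trans hmain).trans hexp
  have hfac : ((2 * r).factorial : ℝ) ≤ (4 * (r : ℝ) ^ 2) ^ r := by
    have h1 : ((2 * r).factorial : ℝ) ≤ ((2 * r : ℕ) : ℝ) ^ (2 * r) := by
      exact_mod_cast Nat.factorial_le_pow _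
    refine h1.trans (le_of_eq ?_)
    rw [pow_mul]
    congr 1
    push_cast
    ring
  have hf0 : (0 : ℝ) < (2 * r).factorial := by positivity
  rw [div_mul_eq_mul_div, div_le_iff₀ hf0, mul_comm (l ^ (2 * r)), ← le_div_iff₀ (by positivity)]
    at hfin
  refine hfin.trans ?_
  calc Real.exp (H * c ^ 2) ^ r * ((2 * r).factorial : ℝ) / l ^ (2 * r)
      ≤ Real.exp (H * c ^ 2) ^ r * (4 * (r : ℝ) ^ 2) ^ r / l ^ (2 * r) := by gcongr
    _ = (Real.exp (H * c ^ 2) * (4 * (r : ℝ) ^ 2) / l ^ 2) ^ r := by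
        rw [pow_mul, ← mul_pow, ← div_pow]
    _ = _ := by
        have hcc : c⁻¹ = 2 * e * κ := by rw [hc]; simp
        have hM : momentConst κ γ = 4 * Real.exp (H * c ^ 2) * (c⁻¹) ^ 2 := by
          rw [hcc, hc]; rfl
        congr 1
        rw [hl2, hM]
        field_simp

end Moments

end NoiseBlind

/-! ### The two events for the random matrix -/

namespace NoiseBlind

section Sqrt

variable {F : Type*} [MeasurableSpace F] {P : Measure F} [IsProbabilityMeasure P] {f : F → ℝ}

lemma integrable_sqrt (hf : Integrable f P) : Integrable (fun x => Real.sqrt (f x)) P := by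
  refine ((integrable_const 1).add hf.abs).mono'
    (Real.continuous_sqrt.comp_aestronglyMeasurable hf.aestronglyMeasurable)
    (.of_forall fun x => ?_)
  rw [Real.norm_eq_abs, abs_of_nonneg (Real.sqrt_nonneg _)]
  change Real.sqrt (f x) ≤ 1 + |f x|
  rw [Real.sqrt_le_left (by positivity)]
  nlinarith [abs_nonneg (f x), le_abs_self (f x)]

lemma integral_sqrt_le (hf : Integrable f P) (h0 : ∀ x, 0 ≤ f x) :
    ∫ x, Real.sqrt (f x) ∂P ≤ Real.sqrt (∫ x, f x ∂P) := by
  have h1 : ∀ x, Real.sqrt (f x) ^ 2 = f x := fun x => Real.sq_sqrt (h0 x)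
  have h := sq_integral_mul_le (P := P) (f := fun x => Real.sqrt (f x)) (g := fun _ => 1)
    (by simpa only [h1] using hf) (by simp) (by simpa using integrable_sqrt hf)
  simp only [h1, mul_one] at h
  exact Real.le_sqrt_of_sq_le (by simpa using h)

end Sqrt

lemma dotProduct_le_sqrt_mul_sqrt {d : ℕ} (a b : Fin d → ℝ) :
    a ⬝ᵥ b ≤ Real.sqrt (a ⬝ᵥ a) * Real.sqrt (b ⬝ᵥ b) := by
  have h := Real.sum_mul_le_sqrt_mul_sqrt Finset.univ a b
  simpa only [dotProduct, pow_two] using h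

section Events

variable {μ : Measure ℝ} [IsProbabilityMeasure μ] {K : ℝ}

lemma measurePreserving_coord (n d : ℕ) (j : Fin d) :
    MeasurePreserving (fun (b : Fin n → Fin d → ℝ) k => b k j)
      (Measure.pi fun _ => Measure.pi fun _ => μ) (Measure.pi fun _ => μ) :=
  measurePreserving_pi (fun _ : Fin n => Measure.pi fun _ : Fin d => μ) (fun _ => μ)
    (f := fun _ x => x j) fun _ => measurePreserving_eval (fun _ : Fin d => μ) j

lemma integral_coord {n d : ℕ} (j : Fin d) {f : (Fin n → ℝ) → ℝ}
    (hf : Integrable f (Measure.pi fun _ => μ)) :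
    Integrable (fun b : Fin n → Fin d → ℝ => f fun k => b k j)
        (Measure.pi fun _ => Measure.pi fun _ => μ) ∧
      ∫ b : Fin n → Fin d → ℝ, f (fun k => b k j) ∂Measure.pi (fun _ => Measure.pi fun _ => μ) =
        ∫ x, f x ∂Measure.pi fun _ => μ := by
  have hj := measurePreserving_coord (μ := μ) n d j
  refine ⟨hj.integrable_comp_of_integrable hf, ?_⟩
  rw [← hj.map_eq, integral_map hj.measurable.aemeasurable]
  rw [hj.map_eq]; exact hf.aestronglyMeasurable

lemma SymmLaw.integrable_eval (h : SymmLaw μ K) {d : ℕ} (j : Fin d) :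
    Integrable (fun b : Fin d → ℝ => b j) (Measure.pi fun _ => μ) :=
  integrable_comp_eval (μ := fun _ : Fin d => μ) (f := fun x => x) h.integrable_id

/-- The event behind the quotient property. If each direction `y ∈ T` is reached at level `α` by a
single column with probability of order `exp (-α² / 4)`, where `α² = log (e N / m)`, then with high
probability every direction is reached by some column: the expected number of successes is of
order `N (m / N) ^ (1 / 4)`, whereas the mean width, divided by `α`, and the deviations
are of order `√(N m)`. -/
theorem SymmLaw.exists_event_columns (h : SymmLaw μ K) {m N : ℕ} (hm : 0 < m) {α c β : ℝ}
    (hα : 1 ≤ α) (hαN : Real.exp (α ^ 2) = Real.exp 1 * N / m) (hc : 0 < c) (hβ : 0 < β)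
    (hN : 3 * ((2 / c + 1) / β) ^ 4 * m ≤ N) {T : Set (Fin m → ℝ)} (hT : ∀ y ∈ T, y ⬝ᵥ y ≤ α ^ 2)
    (hp : ∀ y ∈ T, β * Real.exp (-(α ^ 2 / 4)) ≤
      (Measure.pi fun _ => μ).real {b : Fin m → ℝ | 2 * (c * α) ≤ b ⬝ᵥ y}) :
    ∃ G : Set (Fin N → Fin m → ℝ), MeasurableSet G ∧
      1 - Real.exp (-2 * m) ≤ (Measure.pi fun _ => Measure.pi fun _ => μ).real G ∧
      ∀ b ∈ G, ∀ y ∈ T, ∃ i, c * α ≤ b i ⬝ᵥ y := by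
  have hm0 : (0 : ℝ) < m := by exact_mod_cast hm
  have hα0 : 0 < α := by linarith
  set D := (2 / c + 1) / β with hD
  have hD0 : 0 < D := by positivity
  have hN0 : (0 : ℝ) < N := lt_of_lt_of_le (by positivity) hN
  set Q : (Fin N → Fin m → ℝ) → ℝ := fun b => (∑ k, b k) ⬝ᵥ (∑ k, b k) with hQ
  have hsq : Integrable (fun x : Fin N → ℝ => (∑ k, x k) ^ 2) (Measure.pi fun _ => μ) :=
    integrable_pow_of_memLp (q := 2) (by exact_mod_cast memLp_sum_pi h.memLp_two N) le_rfl
  have hQe : ∀ b, Q b = ∑ j, (∑ k, b k j) ^ 2 := fun b => by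
    simp only [hQ, dotProduct, Finset.sum_apply, pow_two]
  have hQI : Integrable Q (Measure.pi fun _ => Measure.pi fun _ => μ) := by
    have : Q = fun b => ∑ j, (∑ k, b k j) ^ 2 := funext hQe
    rw [this]
    exact integrable_finsetSum _ fun j _ => (integral_coord j hsq).1
  have hQE : ∫ b, Q b ∂Measure.pi (fun _ => Measure.pi fun _ => μ) = N * m := by
    simp only [hQe]
    rw [integral_finsetSum _ fun j _ => (integral_coord j hsq).1]
    have : ∀ j, ∫ b : Fin N → Fin m → ℝ, (∑ k, b k j) ^ 2
        ∂Measure.pi (fun _ => Measure.pi fun _ => μ) = N := fun j =>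
      (integral_coord j hsq).2.trans (h.integral_sum_sq N)
    simp [this, mul_comm]
  have hQ0 : ∀ b, 0 ≤ Q b := fun b => by rw [hQe]; positivity
  obtain ⟨G, hGm, hGp, hG⟩ := exists_event_sum_ramp_ge (n := N) (Measure.pi fun _ : Fin m => μ)
    (measurePreserving_neg_pi h.measurePreserving_neg m) h.integrable_eval (T := T)
    (t := c * α) (β := β * Real.exp (-(α ^ 2 / 4))) (W := α * Real.sqrt (N * m))
    (u := Real.sqrt (N * m)) (by positivity) (Real.sqrt_nonneg _) hp
    (w := fun b => α * Real.sqrt (Q b)) ((integrable_sqrt hQI).const_mul α)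
    (fun y hy b => by
      refine (dotProduct_le_sqrt_mul_sqrt _ _).trans ?_
      rw [mul_comm]
      gcongr
      rw [Real.sqrt_le_left hα0.le]
      exact hT y hy)
    (by
      rw [integral_const_mul]
      gcongr
      exact (integral_sqrt_le hQI hQ0).trans (by rw [hQE]))
  refine ⟨G, hGm, ?_, fun b hb y hy => ?_⟩
  · convert hGp using 4
    rw [Real.sq_sqrt (by positivity)]
    field_simp
  · have h1 := hG b hb y hy
    have hpos : 0 < N * (β * Real.exp (-(α ^ 2 / 4))) - 2 * (α * Real.sqrt (N * m)) / (c * α)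
        - Real.sqrt (N * m) := by
      set x := Real.exp (-(α ^ 2 / 4)) with hx
      have hx0 : 0 < x := Real.exp_pos _
      have hx4 : x ^ 4 * (Real.exp 1 * N) = m := by
        have : x ^ 4 = (Real.exp (α ^ 2))⁻¹ := by
          rw [hx, ← Real.exp_nat_mul, ← Real.exp_neg]
          congr 1
          push_cast
          ring
        rw [this, hαN]
        field_simp
      have hlt : D * Real.sqrt (N * m) < N * x := by
        refine lt_of_pow_lt_pow_left₀ 4 (by positivity) ?_
        have h2 : (D * Real.sqrt (N * m)) ^ 4 = D ^ 4 * m * (N ^ 2 * m) := by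
          have : Real.sqrt (N * m) ^ 4 = (N * m : ℝ) ^ 2 := by
            rw [show (4 : ℕ) = 2 * 2 from rfl, pow_mul, Real.sq_sqrt (by positivity)]
          rw [mul_pow, this]; ring
        have h3 : (N * x) ^ 4 = N ^ 3 * (m / Real.exp 1) := by
          rw [← hx4]; field_simp
        rw [h2, h3]
        have he : Real.exp 1 < 3 := Real.exp_one_lt_d9.trans (by norm_num)
        calc D ^ 4 * m * (N ^ 2 * m) = 3 * D ^ 4 * m * ((N : ℝ) ^ 2 * (m / 3)) := by ring
          _ ≤ N * ((N : ℝ) ^ 2 * (m / 3)) := by gcongr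
          _ < N * ((N : ℝ) ^ 2 * (m / Real.exp 1)) := by gcongr
          _ = _ := by ring
      have h4 : 2 * (α * Real.sqrt (N * m)) / (c * α) + Real.sqrt (N * m) =
          β * (D * Real.sqrt (N * m)) := by
        rw [hD]; field_simp
      nlinarith
    have h2 := hpos.trans_le h1
    obtain ⟨i, -, hi⟩ := Finset.exists_lt_of_sum_lt (s := Finset.univ) (f := fun _ => (0 : ℝ))
      (g := fun k => ramp (c * α) (b k ⬝ᵥ y)) (by simpa using h2)
    refine ⟨i, ?_⟩
    by_contra hlt
    rw [ramp_eq_zero (by positivity) (not_le.1 hlt).le] at hi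
    exact lt_irrefl _ hi

/-- The probability in the small ball estimate `ℙ(⟨b, v⟩ ≥ 1 / (2 (1 + K))) ≥ smallBallProb K` for
unit vectors `v`. -/
noncomputable def smallBallProb (K : ℝ) : ℝ :=
  (1 ^ 2 / (4 * ((1 + K) ^ 2 + 1 ^ 2))) ^ 2 * Real.exp (-1)

lemma smallBallProb_pos (K : ℝ) : 0 < smallBallProb K := by
  unfold smallBallProb
  positivity

/-- The event behind the null space property: uniformly over the unit vectors `v` with
`‖v‖₁ ≤ √k`, the squared norm of the image of `v` is at least a multiple of `m`. The mean width
over these vectors is found by splitting `W = ∑ b_i` at the level `θ ~ √(m r)`, beyond which each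
coordinate has second moment at most `θ² exp (-2 r)`. -/
theorem SymmLaw.exists_event_rows (h : SymmLaw μ K) {m N r : ℕ} (hr : 2 ≤ r) {k C : ℝ} (hk : 0 < k)
    (hC : 0 < C) (hm : 0 < m) (hμ : MemLp (fun x => x) (2 * r : ℕ) μ)
    (hmom : ∫ b : Fin m → ℝ, (∑ i, b i) ^ (2 * r) ∂Measure.pi (fun _ => μ) ≤ (C * m * r) ^ r)
    (hkr : N * Real.exp (-(2 * r)) ≤ Real.exp 1 ^ 2 * k)
    (hsmall : 4 * (Real.exp 1 * Real.sqrt (C * m * r) * Real.sqrt k) ≤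
      smallBallProb K / (32 * (1 + K)) * m) :
    ∃ G : Set (Fin m → Fin N → ℝ), MeasurableSet G ∧
      1 - Real.exp (-(smallBallProb K ^ 2 / 8) * m) ≤
        (Measure.pi fun _ => Measure.pi fun _ => μ).real G ∧
      ∀ b ∈ G, ∀ v : Fin N → ℝ, v ⬝ᵥ v = 1 → ∑ j, |v j| ≤ Real.sqrt k →
        (1 / (4 * (1 + K))) ^ 2 * (smallBallProb K / 2) * m ≤ ∑ i, (b i ⬝ᵥ v) ^ 2 := by
  have hK := h.one_le
  have hβ0 := smallBallProb_pos K
  set β := smallBallProb K with hβ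
  set e := Real.exp 1 with he
  have he0 : 0 < e := Real.exp_pos 1
  have he3 : e < 3 := Real.exp_one_lt_d9.trans (by norm_num)
  have hr0 : (0 : ℝ) < r := by exact_mod_cast (by omega : 0 < r)
  have hm0 : (0 : ℝ) < m := by exact_mod_cast hm
  set θ := e * Real.sqrt (C * m * r) with hθ
  have hθ0 : 0 < θ := by positivity
  have hθ2 : θ ^ 2 = e ^ 2 * (C * m * r) := by rw [hθ, mul_pow, Real.sq_sqrt (by positivity)]
  -- The excess over the level `θ` of one coordinate of the sum of the rows.
  set ex : (Fin m → ℝ) → ℝ := fun x => max (|∑ i, x i| - θ) 0 with hex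
  have hexm : Measurable ex := by simp only [hex]; fun_prop
  have hexle : ∀ x, ex x ^ 2 ≤ θ ^ 2 / θ ^ (2 * r) * (∑ i, x i) ^ (2 * r) := fun x => by
    have hpow : (∑ i, x i) ^ (2 * r) = |∑ i, x i| ^ (2 * r) := ((even_two_mul r).pow_abs _).symm
    simp only [hex]
    rcases le_total (|∑ i, x i| - θ) 0 with h0 | h0
    · rw [max_eq_right h0, hpow, zero_pow two_ne_zero]; positivity
    · rw [max_eq_left h0, hpow]
      have h1 : θ ≤ |∑ i, x i| := by linarith
      set s := |∑ i, x i| with hs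
      have hs0 : 0 < s := by linarith
      obtain ⟨q, hq⟩ : ∃ q, 2 * r = q + 2 := ⟨2 * r - 2, by omega⟩
      rw [hq, div_mul_eq_mul_div, le_div_iff₀ (by positivity), pow_add, pow_add]
      have h2 : (s - θ) ^ 2 ≤ s ^ 2 := by gcongr; linarith
      have h3 : θ ^ q ≤ s ^ q := by gcongr
      calc (s - θ) ^ 2 * (θ ^ q * θ ^ 2) ≤ s ^ 2 * (s ^ q * θ ^ 2) := by gcongr
        _ = _ := by ring
  have hpowI : Integrable (fun x : Fin m → ℝ => (∑ i, x i) ^ (2 * r)) (Measure.pi fun _ => μ) :=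
    integrable_pow_of_memLp (memLp_sum_pi hμ m) le_rfl
  have hexI : Integrable (fun x => ex x ^ 2) (Measure.pi fun _ => μ) :=
    (hpowI.const_mul (θ ^ 2 / θ ^ (2 * r))).mono' (hexm.pow_const 2).aestronglyMeasurable
      (.of_forall fun x => by
        rw [Real.norm_eq_abs, abs_of_nonneg (sq_nonneg _)]; exact hexle x)
  have hexE : ∫ x, ex x ^ 2 ∂Measure.pi (fun _ => μ) ≤ θ ^ 2 * Real.exp (-(2 * r)) := by
    calc _ ≤ ∫ x : Fin m → ℝ, θ ^ 2 / θ ^ (2 * r) * (∑ i, x i) ^ (2 * r)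
          ∂Measure.pi (fun _ => μ) := integral_mono hexI (hpowI.const_mul _) hexle
      _ ≤ θ ^ 2 / θ ^ (2 * r) * (C * m * r) ^ r := by rw [integral_const_mul]; gcongr
      _ = _ := by
          have h1 : Real.exp (-(2 * r : ℝ)) = (e ^ (2 * r))⁻¹ := by
            rw [he, ← Real.exp_nat_mul, Real.exp_neg]; push_cast; ring_nf
          have h2 : θ ^ (2 * r) = e ^ (2 * r) * (C * m * r) ^ r := by
            rw [pow_mul, hθ2, mul_pow, ← pow_mul]
          rw [h1, h2]
          field_simp
  set Q : (Fin m → Fin N → ℝ) → ℝ := fun b => ∑ j, ex (fun i => b i j) ^ 2 with hQ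
  have hQI : Integrable Q (Measure.pi fun _ => Measure.pi fun _ => μ) :=
    integrable_finsetSum _ fun j _ => (integral_coord j hexI).1
  have hQ0 : ∀ b, 0 ≤ Q b := fun b => Finset.sum_nonneg fun j _ => sq_nonneg _
  have hQE : ∫ b, Q b ∂Measure.pi (fun _ => Measure.pi fun _ => μ) ≤ (e * θ) ^ 2 * k := by
    simp only [hQ]
    rw [integral_finsetSum _ fun j _ => (integral_coord j hexI).1]
    calc _ ≤ ∑ _j : Fin N, θ ^ 2 * Real.exp (-(2 * r)) := Finset.sum_le_sum fun j _ => by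
          rw [(integral_coord j hexI).2]; exact hexE
      _ = θ ^ 2 * (N * Real.exp (-(2 * r))) := by simp; ring
      _ ≤ θ ^ 2 * (e ^ 2 * k) := by gcongr
      _ = _ := by ring
  have hp : ∀ v : Fin N → ℝ, v ⬝ᵥ v = 1 → β ≤ (Measure.pi fun _ => μ).real
      {b : Fin N → ℝ | 2 * (1 / (4 * (1 + K))) ≤ b ⬝ᵥ v} := fun v hv => by
    have h1 := h.le_measure_dotProduct_ge (y := v) (v := v) (fun j => by
      have : v j ^ 2 ≤ 1 := by
        rw [← hv, dotProduct, pow_two]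
        exact Finset.single_le_sum (f := fun j => v j * v j) (fun j _ => mul_self_nonneg _)
          (Finset.mem_univ j)
      exact abs_le_one_iff_mul_self_le_one.2 (by rwa [← pow_two]))
      (ρ := 1) one_pos (by rw [hv]; exact one_pos) (by rw [hv]; norm_num)
    rw [hv] at h1
    have h2 : 2 * (1 / (4 * (1 + K))) = 1 / (2 * (1 + K)) := by field_simp; norm_num
    rw [h2]
    exact h1
  obtain ⟨G, hGm, hGp, hG⟩ := exists_event_sum_ramp_ge (n := m) (Measure.pi fun _ : Fin N => μ)
    (measurePreserving_neg_pi h.measurePreserving_neg N) h.integrable_eval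
    (T := {v | v ⬝ᵥ v = 1 ∧ ∑ j, |v j| ≤ Real.sqrt k})
    (t := 1 / (4 * (1 + K))) (β := β) (W := θ * Real.sqrt k + e * θ * Real.sqrt k)
    (u := β / 4 * m) (by positivity) (by positivity) (fun v hv => hp v hv.1)
    (w := fun b => θ * Real.sqrt k + Real.sqrt (Q b))
    ((integrable_const _).add (integrable_sqrt hQI))
    (fun v hv b => by
      have hW : ∀ j, (∑ i, b i) j * v j ≤ θ * |v j| + ex (fun i => b i j) * |v j| := fun j => by
        have h1 : |∑ i, b i j| ≤ θ + ex (fun i => b i j) := by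
          simp only [hex]
          linarith [le_max_left (|∑ i, b i j| - θ) 0]
        calc (∑ i, b i) j * v j ≤ |∑ i, b i j| * |v j| := by
              rw [Finset.sum_apply, ← abs_mul]; exact le_abs_self _
          _ ≤ (θ + ex fun i => b i j) * |v j| := by gcongr
          _ = _ := by ring
      calc (∑ i, b i) ⬝ᵥ v ≤ ∑ j, (θ * |v j| + ex (fun i => b i j) * |v j|) :=
            Finset.sum_le_sum fun j _ => hW j
        _ = θ * ∑ j, |v j| + ∑ j, ex (fun i => b i j) * |v j| := by
            rw [Finset.sum_add_distrib, Finset.mul_sum]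
        _ ≤ θ * Real.sqrt k + Real.sqrt (Q b) * 1 := by
            gcongr
            · exact hv.2
            · refine (Real.sum_mul_le_sqrt_mul_sqrt _ _ _).trans (le_of_eq ?_)
              have : ∑ j, |v j| ^ 2 = 1 := by
                simp only [pow_two, abs_mul_abs_self]; exact hv.1
              rw [this, Real.sqrt_one]
        _ = _ := by rw [mul_one])
    (by
      rw [integral_add (integrable_const _) (integrable_sqrt hQI)]
      simp only [integral_const, probReal_univ, one_smul]
      gcongr
      refine (integral_sqrt_le hQI hQ0).trans ?_
      rw [Real.sqrt_le_left (by positivity)]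
      refine hQE.trans (le_of_eq ?_)
      rw [mul_pow _ (Real.sqrt k), Real.sq_sqrt hk.le])
  refine ⟨G, hGm, ?_, fun b hb v hv1 hv2 => ?_⟩
  · convert hGp using 4
    field_simp
    norm_num
  · have h1 := hG b hb v ⟨hv1, hv2⟩
    have h2 : 2 * (θ * Real.sqrt k + e * θ * Real.sqrt k) / (1 / (4 * (1 + K))) ≤ β / 4 * m := by
      rw [div_le_iff₀ (by positivity)]
      have h3 : θ * Real.sqrt k + e * θ * Real.sqrt k ≤ 4 * (θ * Real.sqrt k) := by
        have : e * (θ * Real.sqrt k) ≤ 3 * (θ * Real.sqrt k) := by gcongr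
        linarith
      calc _ ≤ 2 * (β / (32 * (1 + K)) * m) := by linarith
        _ = _ := by field_simp; norm_num
    have h4 : β / 2 * m ≤ ∑ i, ramp (1 / (4 * (1 + K))) (b i ⬝ᵥ v) := by
      refine le_trans ?_ h1
      linarith
    calc (1 / (4 * (1 + K))) ^ 2 * (β / 2) * m
        ≤ (1 / (4 * (1 + K))) ^ 2 * ∑ i, ramp (1 / (4 * (1 + K))) (b i ⬝ᵥ v) := by
          rw [mul_assoc]; gcongr
      _ ≤ _ := by
          rw [Finset.mul_sum]
          exact Finset.sum_le_sum fun i _ => ramp_le_sq (by positivity)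

end Events

end NoiseBlind

/-! ### Deterministic recovery estimates -/

namespace NoiseBlind

section VecNorm

variable {n : ℕ}

lemma vecNorm_nonneg (p : ℝ≥0∞) [Fact (1 ≤ p)] (x : Fin n → ℝ) : 0 ≤ vecNorm p x := norm_nonneg _

lemma vecNorm_add_le (p : ℝ≥0∞) [Fact (1 ≤ p)] (x y : Fin n → ℝ) :
    vecNorm p (x + y) ≤ vecNorm p x + vecNorm p y := by
  simpa [vecNorm] using norm_add_le (WithLp.toLp p x) (WithLp.toLp p y)

lemma vecNorm_sub_le (p : ℝ≥0∞) [Fact (1 ≤ p)] (x y : Fin n → ℝ) :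
    vecNorm p (x - y) ≤ vecNorm p x + vecNorm p y := by
  simpa [vecNorm] using norm_sub_le (WithLp.toLp p x) (WithLp.toLp p y)

lemma vecNorm_smul (p : ℝ≥0∞) [Fact (1 ≤ p)] (a : ℝ) (x : Fin n → ℝ) :
    vecNorm p (a • x) = |a| * vecNorm p x := by
  simp [vecNorm, norm_smul]

lemma vecNorm_one (x : Fin n → ℝ) : vecNorm 1 x = ∑ j, |x j| := by
  rw [vecNorm, PiLp.norm_eq_of_L1]
  simp

lemma vecNorm_two (x : Fin n → ℝ) : vecNorm 2 x = Real.sqrt (x ⬝ᵥ x) := by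
  rw [vecNorm, EuclideanSpace.norm_eq]
  simp [dotProduct, pow_two]

lemma vecNorm_two_sq (x : Fin n → ℝ) : vecNorm 2 x ^ 2 = x ⬝ᵥ x := by
  rw [vecNorm_two, Real.sq_sqrt]
  exact Finset.sum_nonneg fun i _ => mul_self_nonneg _

lemma abs_le_vecNorm_top (x : Fin n → ℝ) (j : Fin n) : |x j| ≤ vecNorm ∞ x :=
  PiLp.norm_apply_le (WithLp.toLp ∞ x) j

lemma vecNorm_ofReal {p : ℝ} (hp : 1 ≤ p) (x : Fin n → ℝ) :
    vecNorm (ENNReal.ofReal p) x = (∑ j, |x j| ^ p) ^ (1 / p) := by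
  have h : (ENNReal.ofReal p).toReal = p := ENNReal.toReal_ofReal (by linarith)
  rw [vecNorm, PiLp.norm_eq_sum (by rw [h]; linarith), h]
  simp

lemma continuous_vecNorm (p : ℝ≥0∞) [Fact (1 ≤ p)] :
    Continuous (vecNorm p : (Fin n → ℝ) → ℝ) :=
  continuous_norm.comp (PiLp.continuous_toLp p _)

lemma vecNorm_two_eq_zero {x : Fin n → ℝ} (h : vecNorm 2 x = 0) : x = 0 := by
  simpa [vecNorm] using h

/-- Interpolation between `ℓ₁` and `ℓ₂`, with the two norms compared at the scale `√S`. -/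
lemma vecNorm_le_of_vecNorm_one_le {S R c p : ℝ} (hS : 0 < S) (hR : 0 ≤ R) (hp1 : 1 ≤ p)
    (hp2 : p ≤ 2) (x : Fin n → ℝ) (h1 : vecNorm 1 x ≤ Real.sqrt S * R)
    (h2 : vecNorm 2 x ≤ c * R) :
    vecNorm (ENNReal.ofReal p) x ≤ (1 + c ^ 2) * (S ^ (1 / p - 1 / 2) * R) := by
  have hp0 : 0 < p := by linarith
  have hsq : Real.sqrt S ^ 2 = S := Real.sq_sqrt hS.le
  have hs0 : 0 < Real.sqrt S := Real.sqrt_pos.2 hS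
  rw [vecNorm_ofReal hp1]
  rcases hR.eq_or_lt with rfl | hR
  · have hx : x = 0 := vecNorm_two_eq_zero (le_antisymm (by simpa using h2) (vecNorm_nonneg 2 x))
    subst hx
    simp [Real.zero_rpow hp0.ne', Real.zero_rpow (inv_ne_zero hp0.ne')]
  · -- The level at which the two bounds balance.
    set b := R / Real.sqrt S with hb
    have hb0 : 0 < b := by positivity
    have hbR : Real.sqrt S * R = S * b := by
      rw [hb]; field_simp; rw [hsq]
    have hRb : R ^ 2 = S * b ^ 2 := by
      rw [hb, div_pow, hsq]; field_simp
    have hpt : ∀ a : ℝ, 0 ≤ a → a ^ p ≤ b ^ (p - 1) * a + b ^ (p - 2) * a ^ 2 := fun a ha => by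
      rcases ha.eq_or_lt with rfl | ha
      · simp [Real.zero_rpow hp0.ne']
      · rcases le_total a b with hab | hab
        · have : a ^ p = a ^ (p - 1) * a := by
            rw [← Real.rpow_add_one ha.ne']; congr 1; ring
          rw [this]
          have h3 : a ^ (p - 1) ≤ b ^ (p - 1) := Real.rpow_le_rpow ha.le hab (by linarith)
          have h4 : 0 ≤ b ^ (p - 2) * a ^ 2 := by positivity
          nlinarith
        · have : a ^ p = a ^ (p - 2) * a ^ 2 := by
            rw [← Real.rpow_natCast, ← Real.rpow_add ha]; congr 1; push_cast; ring
          rw [this]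
          have h3 : a ^ (p - 2) ≤ b ^ (p - 2) :=
            Real.rpow_le_rpow_of_nonpos hb0 hab (by linarith)
          have h4 : 0 ≤ b ^ (p - 1) * a := by positivity
          nlinarith [mul_le_mul_of_nonneg_right h3 (sq_nonneg a)]
    have hsum : ∑ j, |x j| ^ p ≤ (1 + c ^ 2) * (S * b ^ p) := by
      calc ∑ j, |x j| ^ p ≤ ∑ j, (b ^ (p - 1) * |x j| + b ^ (p - 2) * |x j| ^ 2) :=
            Finset.sum_le_sum fun j _ => hpt _ (abs_nonneg _)
        _ = b ^ (p - 1) * vecNorm 1 x + b ^ (p - 2) * vecNorm 2 x ^ 2 := by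
            rw [Finset.sum_add_distrib, ← Finset.mul_sum, ← Finset.mul_sum, vecNorm_one,
              vecNorm_two_sq]
            simp [dotProduct, pow_two]
        _ ≤ b ^ (p - 1) * (S * b) + b ^ (p - 2) * (c * R) ^ 2 := by
            have := vecNorm_nonneg 2 x
            rw [← hbR]
            gcongr
        _ = (1 + c ^ 2) * (S * b ^ p) := by
            have e1 : b ^ p = b ^ (p - 1) * b := by
              rw [← Real.rpow_add_one hb0.ne']; congr 1; ring
            have e2 : b ^ p = b ^ (p - 2) * b ^ 2 := by
              rw [← Real.rpow_natCast, ← Real.rpow_add hb0]; congr 1; push_cast; ring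
            have e3 : b ^ (p - 2) * (c * R) ^ 2 = c ^ 2 * (S * b ^ p) := by
              rw [mul_pow, hRb, e2]; ring
            rw [e3, e1]; ring
    have h0 : 0 ≤ ∑ j, |x j| ^ p := Finset.sum_nonneg fun j _ => by positivity
    calc (∑ j, |x j| ^ p) ^ (1 / p) ≤ ((1 + c ^ 2) * (S * b ^ p)) ^ (1 / p) := by
          gcongr
      _ = (1 + c ^ 2) ^ (1 / p) * (S ^ (1 / p) * b) := by
          rw [Real.mul_rpow (by positivity) (by positivity),
            Real.mul_rpow hS.le (by positivity), ← Real.rpow_mul hb0.le,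
            mul_one_div_cancel hp0.ne', Real.rpow_one]
      _ ≤ (1 + c ^ 2) ^ (1 : ℝ) * (S ^ (1 / p) * b) := by
          gcongr
          · nlinarith [sq_nonneg c]
          · rw [div_le_one hp0]; exact hp1
      _ = (1 + c ^ 2) * (S ^ (1 / p - 1 / 2) * R) := by
          rw [Real.rpow_one, Real.rpow_sub hS, hb, ← Real.sqrt_eq_rpow]
          ring

end VecNorm

section Recovery

variable {m N : ℕ} {A : Matrix (Fin m) (Fin N) ℝ}

/-- The homogeneous form of a lower bound for `‖A v‖₂` on the unit vectors with `‖v‖₁ ≤ √k`. -/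
lemma vecNorm_two_le {k c₀ : ℝ} (hk : 0 < k) (hc₀ : 0 < c₀)
    (hA : ∀ v : Fin N → ℝ, v ⬝ᵥ v = 1 → ∑ j, |v j| ≤ Real.sqrt k →
      c₀ ^ 2 ≤ A.mulVec v ⬝ᵥ A.mulVec v) (h : Fin N → ℝ) :
    vecNorm 2 h ≤ vecNorm 1 h / Real.sqrt k + vecNorm 2 (A.mulVec h) / c₀ := by
  have hk' : 0 < Real.sqrt k := Real.sqrt_pos.2 hk
  have n1 := vecNorm_nonneg 1 h
  have n2 := vecNorm_nonneg 2 (A.mulVec h)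
  rcases (vecNorm_nonneg 2 h).eq_or_lt with h0 | h0
  · rw [← h0]; positivity
  rcases le_total (vecNorm 2 h * Real.sqrt k) (vecNorm 1 h) with hle | hle
  · have : vecNorm 2 h ≤ vecNorm 1 h / Real.sqrt k := by rwa [le_div_iff₀ hk']
    have : 0 ≤ vecNorm 2 (A.mulVec h) / c₀ := by positivity
    linarith
  · set v := (vecNorm 2 h)⁻¹ • h with hv
    have hv1 : v ⬝ᵥ v = 1 := by
      rw [← vecNorm_two_sq, hv, vecNorm_smul, abs_of_pos (inv_pos.2 h0),
        inv_mul_cancel₀ h0.ne', one_pow]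
    have hv2 : ∑ j, |v j| ≤ Real.sqrt k := by
      rw [← vecNorm_one, hv, vecNorm_smul, abs_of_pos (inv_pos.2 h0), inv_mul_le_iff₀ h0]
      exact hle
    have h3 := hA v hv1 hv2
    rw [← vecNorm_two_sq, hv, Matrix.mulVec_smul, vecNorm_smul, abs_of_pos (inv_pos.2 h0)] at h3
    have h4 := le_of_sq_le_sq h3 (by positivity)
    rw [inv_mul_eq_div, le_div_iff₀ h0, mul_comm, ← le_div_iff₀ hc₀] at h4
    have : 0 ≤ vecNorm 1 h / Real.sqrt k := by positivity
    linarith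

lemma decoder_nonempty {η : ℝ} {y : Fin m → ℝ} (h : (feasible A η y).Nonempty) :
    (decoder A η y).Nonempty := by
  obtain ⟨x, hx⟩ := h
  have hclosed : IsClosed (feasible A η y) := by
    have hc : Continuous fun z : Fin N → ℝ => vecNorm 2 (A.mulVec z - y) :=
      (continuous_vecNorm 2).comp ((Continuous.matrix_mulVec continuous_const continuous_id).sub
        continuous_const)
    exact isClosed_le hc continuous_const
  have hnorm : ∀ z : Fin N → ℝ, ‖z‖ ≤ vecNorm 1 z := fun z => by
    rw [pi_norm_le_iff_of_nonneg (vecNorm_nonneg 1 z), vecNorm_one]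
    exact fun j => Finset.single_le_sum (f := fun j => |z j|) (fun _ _ => abs_nonneg _)
      (Finset.mem_univ j)
  have hev : ∀ᶠ z in Filter.cocompact (Fin N → ℝ) ⊓ Filter.principal (feasible A η y),
      vecNorm 1 x ≤ vecNorm 1 z := by
    refine Filter.Eventually.filter_mono inf_le_left ?_
    filter_upwards [(tendsto_norm_cocompact_atTop (E := Fin N → ℝ)).eventually_ge_atTop
      (vecNorm 1 x)] with z hz
    exact hz.trans (hnorm z)
  obtain ⟨z, hz, hmin⟩ := (continuous_vecNorm 1).continuousOn.exists_isMinOn' hclosed hx hev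
  exact ⟨z, hz, hmin⟩

/-- The `ℓ₁` error of a decoder output that competes with the feasible point `x + u`. -/
lemma vecNorm_one_sub_le {s : ℕ} {x z u x₀ : Fin N → ℝ} (hx₀ : hammingNorm x₀ ≤ s)
    (hz : vecNorm 1 z ≤ vecNorm 1 (x + u)) :
    vecNorm 1 (x - z) ≤
      2 * (Real.sqrt s * vecNorm 2 (x - z)) + 2 * vecNorm 1 (x - x₀) + vecNorm 1 u := by
  set h := x - z with hh
  set J := Finset.univ.filter fun j => x₀ j ≠ 0 with hJ
  have hcard : (J.card : ℝ) ≤ s := by exact_mod_cast hx₀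
  have hpt : ∀ j, |h j| + |x j| ≤ |z j| + 2 * (if j ∈ J then |h j| else 0) + 2 * |(x - x₀) j| :=
      fun j => by
    have hj : h j = x j - z j := rfl
    by_cases hJj : j ∈ J
    · have h1 : |x j| ≤ |z j| + |h j| := by
        have := abs_add_le (z j) (h j)
        rwa [hj, add_sub_cancel] at this
      rw [if_pos hJj]
      linarith [abs_nonneg ((x - x₀) j)]
    · have h0 : x₀ j = 0 := by simpa [hJ] using hJj
      have h1 : |h j| ≤ |x j| + |z j| := by rw [hj]; exact abs_sub _ _
      rw [if_neg hJj, Pi.sub_apply, h0, sub_zero]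
      linarith
  have hsum := Finset.sum_le_sum fun j (_ : j ∈ Finset.univ) => hpt j
  rw [Finset.sum_add_distrib, Finset.sum_add_distrib, Finset.sum_add_distrib, ← Finset.mul_sum,
    ← Finset.mul_sum, ← vecNorm_one, ← vecNorm_one, ← vecNorm_one, ← vecNorm_one,
    Finset.sum_ite_mem, Finset.univ_inter] at hsum
  have hJs : ∑ j ∈ J, |h j| ≤ Real.sqrt s * vecNorm 2 h := by
    calc ∑ j ∈ J, |h j| = ∑ j ∈ J, 1 * |h j| := by simp
      _ ≤ Real.sqrt (∑ j ∈ J, 1 ^ 2) * Real.sqrt (∑ j ∈ J, |h j| ^ 2) :=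
          Real.sum_mul_le_sqrt_mul_sqrt _ _ _
      _ ≤ Real.sqrt s * vecNorm 2 h := by
          rw [vecNorm_two]
          gcongr
          · simpa using hcard
          · simp only [sq_abs, dotProduct, ← pow_two]
            exact Finset.sum_le_sum_of_subset_of_nonneg (Finset.subset_univ _)
              fun _ _ _ => sq_nonneg _
  have := vecNorm_add_le 1 x u
  linarith

/-- Robust recovery from a lower bound for `‖A v‖₂` over the unit vectors with `‖v‖₁ ≤ √k` and the
possibility to write the noise, up to a remainder of norm at most `η`, as `A u` with a vector `u`
of small `ℓ₁`-norm. The decoder output then competes with the feasible point `x + u`. -/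
theorem robustRecovery_of_lower_bound {η c c₀ d : ℝ} {s : ℕ} (hη : 0 ≤ η) (hs : 1 ≤ s)
    (hc : 0 < c) (hc1 : c ≤ 1) (hsS : 16 * s ≤ c * sStar m N) (hc₀ : 0 < c₀) (hd : 0 ≤ d)
    (hA : ∀ v : Fin N → ℝ, v ⬝ᵥ v = 1 → ∑ j, |v j| ≤ Real.sqrt (c * sStar m N) →
      c₀ ^ 2 ≤ A.mulVec v ⬝ᵥ A.mulVec v)
    {T : (Fin m → ℝ) → ℝ} (hT : ∀ w, max (vecNorm 2 w - η) 0 ≤ T w)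
    (hu : ∀ w, ∃ u : Fin N → ℝ, vecNorm 2 (A.mulVec u - w) ≤ η ∧
      vecNorm 1 u ≤ d * Real.sqrt (sStar m N) * T w) :
    RobustRecovery A η s (4 * (1 + (1 / Real.sqrt c + 1) ^ 2)) fun w =>
      (1 + (1 / Real.sqrt c + 1) ^ 2) * (2 / c₀) * η +
        (1 + (1 / Real.sqrt c + 1) ^ 2) * (1 / c₀ + 2 * d) * T w := by
  intro x w
  set S := sStar m N with hS
  set M := 1 + (1 / Real.sqrt c + 1) ^ 2 with hM
  have hM0 : 0 < M := by positivity
  have hs0 : (1 : ℝ) ≤ s := by exact_mod_cast hs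
  have hS0 : 0 < S := by
    by_contra hneg
    nlinarith
  have hsS' : (s : ℝ) ≤ S := by nlinarith
  have hk : 0 < c * S := by positivity
  obtain ⟨u, hu1, hu2⟩ := hu w
  have hfeas : x + u ∈ feasible A η (A.mulVec x + w) := by
    change vecNorm 2 (A.mulVec (x + u) - (A.mulVec x + w)) ≤ η
    rw [Matrix.mulVec_add, add_sub_add_left_eq_sub]
    exact hu1
  refine ⟨decoder_nonempty ⟨_, hfeas⟩, fun z hz p hp1 hp2 => ?_⟩
  obtain ⟨hzf, hzmin⟩ := hz
  have hzu : vecNorm 1 z ≤ vecNorm 1 (x + u) := hzmin hfeas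
  set h := x - z with hh
  have hT0 : 0 ≤ T w := (le_max_right _ _).trans (hT w)
  have hAh : vecNorm 2 (A.mulVec h) ≤ 2 * η + T w := by
    have e : A.mulVec h = -(1 : ℝ) • (A.mulVec z - (A.mulVec x + w)) - w := by
      rw [hh, Matrix.mulVec_sub]
      ext j
      simp only [Pi.sub_apply, Pi.smul_apply, Pi.add_apply, smul_eq_mul]
      ring
    have h1 := vecNorm_sub_le 2 (-(1 : ℝ) • (A.mulVec z - (A.mulVec x + w))) w
    rw [vecNorm_smul, abs_neg, abs_one, one_mul, ← e] at h1
    have h2 : vecNorm 2 (A.mulVec z - (A.mulVec x + w)) ≤ η := hzf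
    linarith [(le_max_left _ _).trans (hT w)]
  have h2 := vecNorm_two_le hk hc₀ hA h
  -- The bound for one competitor in the best `s`-term approximation.
  have key : ∀ x₀ : Fin N → ℝ, hammingNorm x₀ ≤ s → vecNorm (ENNReal.ofReal p) h ≤
      4 * M / (s : ℝ) ^ (1 - 1 / p) * vecNorm 1 (x - x₀) +
        S ^ (1 / p - 1 / 2) * (M * (2 / c₀) * η + M * (1 / c₀ + 2 * d) * T w) := by
    intro x₀ hx₀
    have h1 := vecNorm_one_sub_le hx₀ hzu
    have hσ := vecNorm_nonneg 1 (x - x₀)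
    set σ := vecNorm 1 (x - x₀) with hσdef
    set H1 := vecNorm 1 h with hH1
    set H2 := vecNorm 2 h with hH2
    set F := vecNorm 2 (A.mulVec h) with hF
    have hF0 : 0 ≤ F := vecNorm_nonneg 2 _
    have hH10 : 0 ≤ H1 := vecNorm_nonneg 1 _
    have hsS0 : 0 < Real.sqrt S := Real.sqrt_pos.2 hS0
    set k' := Real.sqrt (c * S) with hk'
    have hk'0 : 0 < k' := Real.sqrt_pos.2 hk
    have hsk : 4 * Real.sqrt s ≤ k' := by
      refine Real.le_sqrt_of_sq_le ?_
      rw [mul_pow, Real.sq_sqrt (by positivity)]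
      linarith
    have hkS : k' = Real.sqrt c * Real.sqrt S := Real.sqrt_mul hc.le _
    have hc' : 0 < Real.sqrt c := Real.sqrt_pos.2 hc
    have hc1' : Real.sqrt c ≤ 1 := by
      rwa [Real.sqrt_le_left zero_le_one, one_pow]
    set R := 4 * σ / Real.sqrt S + (2 / c₀ * η + (1 / c₀ + 2 * d) * T w) with hR
    have hR0 : 0 ≤ R := by positivity
    have hFR : F / c₀ ≤ R := by
      have e1 : F / c₀ ≤ (2 * η + T w) / c₀ := by gcongr
      have e2 : (2 * η + T w) / c₀ = 2 / c₀ * η + 1 / c₀ * T w := by ring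
      have e3 : 0 ≤ 4 * σ / Real.sqrt S := by positivity
      have e4 : 0 ≤ 2 * d * T w := by positivity
      rw [hR]
      linarith
    have hH1R : H1 ≤ Real.sqrt S * R := by
      have e1 : 2 * (Real.sqrt s * H2) ≤ H1 / 2 + Real.sqrt S * (F / c₀) / 2 := by
        have e2 : 2 * (Real.sqrt s * H2) ≤ k' / 2 * (H1 / k' + F / c₀) := by
          have : 0 ≤ H1 / k' + F / c₀ := by positivity
          calc 2 * (Real.sqrt s * H2) ≤ 2 * (Real.sqrt s * (H1 / k' + F / c₀)) := by gcongr
            _ = 2 * Real.sqrt s * (H1 / k' + F / c₀) := by ring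
            _ ≤ _ := by gcongr; linarith
        have e3 : k' / 2 * (H1 / k' + F / c₀) = H1 / 2 + k' * (F / c₀) / 2 := by
          field_simp
        have e4 : k' * (F / c₀) ≤ Real.sqrt S * (F / c₀) := by
          gcongr
          rw [hkS]
          exact mul_le_of_le_one_left hsS0.le hc1'
        linarith
      have e5 : Real.sqrt S * (F / c₀) ≤ Real.sqrt S * (2 / c₀ * η + 1 / c₀ * T w) := by
        gcongr
        calc F / c₀ ≤ (2 * η + T w) / c₀ := by gcongr
          _ = _ := by ring
      have e6 : Real.sqrt S * R = 4 * σ + Real.sqrt S * (2 / c₀ * η + 1 / c₀ * T w)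
          + 2 * (d * Real.sqrt S * T w) := by
        rw [hR]; field_simp; ring
      linarith
    have hH2R : H2 ≤ (1 / Real.sqrt c + 1) * R := by
      have e1 : H1 / k' ≤ 1 / Real.sqrt c * R := by
        rw [div_le_iff₀ hk'0, hkS]
        refine hH1R.trans (le_of_eq ?_)
        field_simp
      linarith
    refine (vecNorm_le_of_vecNorm_one_le hS0 hR0 hp1 hp2 h hH1R hH2R).trans ?_
    have hp0 : 0 < p := by linarith
    have e1 : S ^ (1 / p - 1 / 2) / Real.sqrt S ≤ 1 / (s : ℝ) ^ (1 - 1 / p) := by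
      have : S ^ (1 / p - 1 / 2) / Real.sqrt S = 1 / S ^ (1 - 1 / p) := by
        rw [Real.sqrt_eq_rpow, ← Real.rpow_sub hS0, one_div (S ^ _), ← Real.rpow_neg hS0.le]
        congr 1
        ring
      rw [this]
      have h1p : 1 / p ≤ 1 := by rw [div_le_one hp0]; exact hp1
      gcongr
    calc M * (S ^ (1 / p - 1 / 2) * R)
        = 4 * M * σ * (S ^ (1 / p - 1 / 2) / Real.sqrt S) +
          S ^ (1 / p - 1 / 2) * (M * (2 / c₀) * η + M * (1 / c₀ + 2 * d) * T w) := by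
          rw [hR]; field_simp
      _ ≤ 4 * M * σ * (1 / (s : ℝ) ^ (1 - 1 / p)) +
          S ^ (1 / p - 1 / 2) * (M * (2 / c₀) * η + M * (1 / c₀ + 2 * d) * T w) := by
          gcongr
      _ = _ := by ring
  set a := 4 * M / (s : ℝ) ^ (1 - 1 / p) with ha
  have ha0 : 0 < a := by positivity
  set b := S ^ (1 / p - 1 / 2) * (M * (2 / c₀) * η + M * (1 / c₀ + 2 * d) * T w) with hb
  have hinf : (vecNorm (ENNReal.ofReal p) h - b) / a ≤ bestTermError s x := by
    refine le_csInf ⟨_, 0, by simp, rfl⟩ ?_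
    rintro _ ⟨x₀, hx₀, rfl⟩
    rw [div_le_iff₀ ha0]
    linarith [key x₀ hx₀]
  rw [div_le_iff₀ ha0] at hinf
  linarith

end Recovery

end NoiseBlind

/-! ### Quotient properties by duality, and the clipped norm -/

namespace NoiseBlind

section Quotient

variable {m N : ℕ} {A : Matrix (Fin m) (Fin N) ℝ}

/-- The dual form of a quotient property: `w` is the image of a vector of `ℓ₁`-norm at most `ρ` as
soon as no functional separates it from the absolute convex hull of the columns, scaled by `ρ`. -/
lemma exists_mulVec_eq {w : Fin m → ℝ} {ρ : ℝ} (hρ : 0 ≤ ρ)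
    (h : ∀ y : Fin m → ℝ, 0 < y ⬝ᵥ w → ∃ i, y ⬝ᵥ w ≤ ρ * |(fun j => A j i) ⬝ᵥ y|) :
    ∃ u, A.mulVec u = w ∧ vecNorm 1 u ≤ ρ := by
  set ball : Set (Fin N → ℝ) := {u | vecNorm 1 u ≤ ρ} with hball
  have hcomp : IsCompact ball := by
    refine Metric.isCompact_of_isClosed_isBounded
      (isClosed_le (continuous_vecNorm 1) continuous_const)
      (Metric.isBounded_closedBall (x := (0 : Fin N → ℝ)) (r := ρ) |>.subset fun u hu => ?_)
    rw [mem_closedBall_zero_iff, pi_norm_le_iff_of_nonneg hρ]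
    intro j
    refine le_trans ?_ (show vecNorm 1 u ≤ ρ from hu)
    rw [vecNorm_one]
    exact Finset.single_le_sum (f := fun j => |u j|) (fun _ _ => abs_nonneg _) (Finset.mem_univ j)
  have hconv : Convex ℝ ball := by
    intro u hu v hv a b ha hb hab
    change vecNorm 1 (a • u + b • v) ≤ ρ
    refine (vecNorm_add_le 1 _ _).trans ?_
    rw [vecNorm_smul, vecNorm_smul, abs_of_nonneg ha, abs_of_nonneg hb]
    have hu' : vecNorm 1 u ≤ ρ := hu
    have hv' : vecNorm 1 v ≤ ρ := hv
    calc a * vecNorm 1 u + b * vecNorm 1 v ≤ a * ρ + b * ρ := by gcongr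
      _ = ρ := by rw [← add_mul, hab, one_mul]
  have hcont : Continuous fun u : Fin N → ℝ => A.mulVec u :=
    Continuous.matrix_mulVec continuous_const continuous_id
  by_contra hcon
  have hnot : w ∉ (fun u => A.mulVec u) '' ball := by
    rintro ⟨u, hu, huw⟩
    exact hcon ⟨u, huw, hu⟩
  obtain ⟨f, c, hf1, hf2⟩ := geometric_hahn_banach_closed_point
    (hconv.linear_image (Matrix.mulVecLin A)) (hcomp.image hcont).isClosed hnot
  set y : Fin m → ℝ := fun j => f (Pi.single j 1) with hy
  have hfy : ∀ x, f x = y ⬝ᵥ x := fun x => by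
    have := f.toLinearMap.pi_apply_eq_sum_univ x
    simp only [ContinuousLinearMap.coe_coe, smul_eq_mul] at this
    rw [this, dotProduct]
    refine Finset.sum_congr rfl fun j _ => ?_
    rw [hy, mul_comm]
    congr 2
    ext k
    simp [Pi.single_apply, eq_comm]
  have hc0 : 0 < c := by
    have := hf1 (A.mulVec 0) ⟨0, by
      change vecNorm 1 (0 : Fin N → ℝ) ≤ ρ
      simpa [vecNorm_one] using hρ, rfl⟩
    simpa using this
  obtain ⟨i, hi⟩ := h y (by rw [← hfy]; linarith)
  set q := (fun j => A j i) ⬝ᵥ y with hq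
  have hval : ∀ a : ℝ, y ⬝ᵥ A.mulVec (Pi.single i a) = a * q := fun a => by
    simp only [Matrix.mulVec_single, hq, dotProduct, Finset.mul_sum]
    refine Finset.sum_congr rfl fun j _ => ?_
    simp
    ring
  have hmem : ∀ a : ℝ, |a| = ρ → a * q < c := fun a ha => by
    rw [← hval, ← hfy]
    refine hf1 _ ⟨Pi.single i a, ?_, rfl⟩
    change vecNorm 1 (Pi.single i a) ≤ ρ
    rw [vecNorm_one, Finset.sum_eq_single i]
    · simp [ha]
    · intro j _ hj; simp [hj]
    · simp
  rw [hfy] at hf2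
  rcases abs_cases q with ⟨h1, _⟩ | ⟨h1, _⟩
  · have := hmem ρ (abs_of_nonneg hρ)
    rw [h1] at hi
    linarith
  · have := hmem (-ρ) (by rw [abs_neg, abs_of_nonneg hρ])
    rw [h1] at hi
    linarith

/-- The part of the noise beyond the level `η` is absorbed by a quotient property. -/
lemma exists_absorb_noise {q : (Fin m → ℝ) → ℝ} {ρ η : ℝ} (hη : 0 ≤ η)
    (hq : ∀ (a : ℝ) w, 0 ≤ a → q (a • w) = a * q w)
    (hA : ∀ w, ∃ u, A.mulVec u = w ∧ vecNorm 1 u ≤ ρ * q w) (w : Fin m → ℝ) :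
    ∃ u : Fin N → ℝ, vecNorm 2 (A.mulVec u - w) ≤ η ∧
      vecNorm 1 u ≤ ρ * (q w / vecNorm 2 w * max (vecNorm 2 w - η) 0) := by
  rcases le_or_gt (vecNorm 2 w) η with h | h
  · refine ⟨0, ?_, ?_⟩
    · have := vecNorm_sub_le 2 0 w
      simp only [Matrix.mulVec_zero]
      refine this.trans ?_
      simpa [vecNorm] using h
    · rw [max_eq_right (by linarith)]
      simp [vecNorm_one]
  · have hw0 : 0 < vecNorm 2 w := by linarith
    obtain ⟨u, hu1, hu2⟩ := hA ((1 - η / vecNorm 2 w) • w)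
    have ha : 0 ≤ 1 - η / vecNorm 2 w := by rw [sub_nonneg, div_le_one hw0]; exact h.le
    refine ⟨u, ?_, hu2.trans (le_of_eq ?_)⟩
    · have e : (1 - η / vecNorm 2 w) • w - w = (-(η / vecNorm 2 w)) • w := by
        rw [sub_smul, one_smul, neg_smul]; abel
      rw [hu1, e, vecNorm_smul, abs_neg, abs_of_nonneg (by positivity), div_mul_cancel₀ _ hw0.ne']
    · rw [hq _ _ ha, max_eq_left (by linarith)]
      congr 1
      field_simp

lemma clippedNorm_smul {α a : ℝ} (ha : 0 ≤ a) (w : Fin m → ℝ) :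
    clippedNorm α (a • w) = a * clippedNorm α w := by
  rw [clippedNorm, clippedNorm, vecNorm_smul, vecNorm_smul, abs_of_nonneg ha,
    mul_max_of_nonneg _ _ ha]
  congr 1
  ring

lemma scaled_column_dotProduct (B : Matrix (Fin m) (Fin N) ℝ) (i : Fin N) (y : Fin m → ℝ) :
    (fun j => scaled B j i) ⬝ᵥ y = ((fun j => B j i) ⬝ᵥ y) / Real.sqrt m := by
  simp only [scaled, dotProduct, Matrix.smul_apply, smul_eq_mul, Finset.sum_div]
  exact Finset.sum_congr rfl fun j _ => by ring

end Quotient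

section Laws

variable {μ : Measure ℝ} [IsProbabilityMeasure μ] {K : ℝ}

/-- The directions on which the dual of the clipped `ℓ₂`-norm equals one. -/
def dualClippedSphere (m : ℕ) (α : ℝ) : Set (Fin m → ℝ) :=
  {y | (∀ w : Fin m → ℝ, w ⬝ᵥ w ≤ 1 → (∀ j, α * |w j| ≤ 1) → w ⬝ᵥ y ≤ 1) ∧
    ∃ w : Fin m → ℝ, w ⬝ᵥ w ≤ 1 ∧ (∀ j, α * |w j| ≤ 1) ∧ w ⬝ᵥ y = 1}

lemma dotProduct_self_le_of_mem_dualClippedSphere {m : ℕ} {α : ℝ} (hα : 1 ≤ α) {y : Fin m → ℝ}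
    (hy : y ∈ dualClippedSphere m α) : y ⬝ᵥ y ≤ α ^ 2 := by
  have hα0 : 0 < α := by linarith
  rw [← vecNorm_two_sq]
  refine pow_le_pow_left₀ (vecNorm_nonneg 2 y) ?_ 2
  rcases (vecNorm_nonneg 2 y).eq_or_lt with h0 | h0
  · rw [← h0]; exact hα0.le
  have hyj : ∀ j, |y j| ≤ vecNorm 2 y := fun j => PiLp.norm_apply_le (WithLp.toLp 2 y) j
  have h1 := hy.1 ((1 / (α * vecNorm 2 y)) • y) (by
    rw [smul_dotProduct, dotProduct_smul, ← vecNorm_two_sq, smul_eq_mul, smul_eq_mul]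
    have : 1 / (α * vecNorm 2 y) * (1 / (α * vecNorm 2 y) * vecNorm 2 y ^ 2) = 1 / α ^ 2 := by
      field_simp
    rw [this, div_le_one (by positivity)]
    nlinarith) (fun j => by
    rw [Pi.smul_apply, smul_eq_mul, abs_mul, abs_of_pos (by positivity)]
    have : α * (1 / (α * vecNorm 2 y) * |y j|) = |y j| / vecNorm 2 y := by field_simp
    rw [this, div_le_one h0]
    exact hyj j)
  rw [smul_dotProduct, ← vecNorm_two_sq, smul_eq_mul] at h1
  have : 1 / (α * vecNorm 2 y) * vecNorm 2 y ^ 2 = vecNorm 2 y / α := by field_simp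
  rwa [this, div_le_one hα0] at h1

/-- The norming functional of a direction on the dual clipped sphere is itself a tilt. -/
lemma SymmLaw.le_measure_dualClippedSphere (h : SymmLaw μ K) {m : ℕ} {α : ℝ} (hα : 1 ≤ α)
    {y : Fin m → ℝ} (hy : y ∈ dualClippedSphere m α) :
    ((1 / 2) ^ 2 / (4 * ((1 + K) ^ 2 + (1 / 2) ^ 2))) ^ 2 * Real.exp (-(α ^ 2 / 4)) ≤
      (Measure.pi fun _ : Fin m => μ).real {b | 1 / (4 * (1 + K)) * α ≤ b ⬝ᵥ y} := by
  have hα0 : 0 < α := by linarith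
  have hK := h.one_le
  have hyy := dotProduct_self_le_of_mem_dualClippedSphere hα hy
  obtain ⟨w, hw1, hw2, hwy⟩ := hy.2
  have hvy : (α / 2) • w ⬝ᵥ y = α / 2 := by rw [smul_dotProduct, hwy, smul_eq_mul, mul_one]
  have h1 := h.le_measure_dotProduct_ge (y := y) (v := (α / 2) • w) (fun j => by
    rw [Pi.smul_apply, smul_eq_mul, abs_mul, abs_of_pos (by positivity)]
    linarith [hw2 j]) (ρ := 1 / 2) (by norm_num) (by rw [hvy]; positivity)
    (by rw [hvy]; linarith)
  rw [hvy] at h1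
  refine le_trans ?_ (h1.trans (le_of_eq ?_))
  · gcongr
    rw [smul_dotProduct, dotProduct_smul, smul_eq_mul, smul_eq_mul]
    nlinarith [sq_nonneg α]
  · congr 2
    ext b
    have : α / 2 / (2 * (1 + K)) = 1 / (4 * (1 + K)) * α := by field_simp; norm_num
    rw [this]

/-- A functional that is positive at `w` is a multiple of one on the dual clipped sphere. -/
lemma exists_dualClippedSphere {m : ℕ} {α : ℝ} (hα : 1 ≤ α) {y w : Fin m → ℝ}
    (hyw : 0 < y ⬝ᵥ w) : ∃ M, 0 < M ∧ M⁻¹ • y ∈ dualClippedSphere m α ∧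
      y ⬝ᵥ w ≤ clippedNorm α w * M := by
  have hα0 : 0 < α := by linarith
  set ball : Set (Fin m → ℝ) := {v | v ⬝ᵥ v ≤ 1 ∧ ∀ j, α * |v j| ≤ 1} with hball
  have hdot : Continuous fun v : Fin m → ℝ => v ⬝ᵥ v := by unfold dotProduct; fun_prop
  have hcl : IsClosed ball := by
    have : ball = {v | v ⬝ᵥ v ≤ 1} ∩ ⋂ j, {v : Fin m → ℝ | α * |v j| ≤ 1} := by
      ext v; simp [hball]
    rw [this]
    refine (isClosed_le hdot continuous_const).inter (isClosed_iInter fun j => ?_)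
    exact isClosed_le (by fun_prop) continuous_const
  have hbd : ball ⊆ Metric.closedBall 0 1 := fun v hv => by
    rw [mem_closedBall_zero_iff, pi_norm_le_iff_of_nonneg zero_le_one]
    intro j
    rw [Real.norm_eq_abs]
    nlinarith [hv.2 j, abs_nonneg (v j)]
  have hcomp : IsCompact ball :=
    Metric.isCompact_of_isClosed_isBounded hcl (Metric.isBounded_closedBall.subset hbd)
  obtain ⟨v, hv, hmax⟩ := hcomp.exists_isMaxOn ⟨0, by simp [hball]⟩
    (f := fun v => v ⬝ᵥ y) (by unfold dotProduct; fun_prop)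
  have hw0 : w ≠ 0 := by rintro rfl; simp at hyw
  have hq0 : 0 < clippedNorm α w := by
    refine lt_of_lt_of_le ?_ (le_max_left _ _)
    exact (vecNorm_nonneg 2 w).lt_of_ne fun h => hw0 (vecNorm_two_eq_zero h.symm)
  have hwball : (clippedNorm α w)⁻¹ • w ∈ ball := by
    refine ⟨?_, fun j => ?_⟩
    · rw [← vecNorm_two_sq, vecNorm_smul, abs_of_pos (inv_pos.2 hq0)]
      have : (clippedNorm α w)⁻¹ * vecNorm 2 w ≤ 1 := by
        rw [inv_mul_le_iff₀ hq0, mul_one]; exact le_max_left _ _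
      exact pow_le_one₀ (mul_nonneg (inv_pos.2 hq0).le (vecNorm_nonneg 2 w)) this
    · rw [Pi.smul_apply, smul_eq_mul, abs_mul, abs_of_pos (inv_pos.2 hq0), mul_left_comm,
        inv_mul_le_iff₀ hq0, mul_one]
      refine le_trans ?_ (le_max_right _ _)
      gcongr
      exact abs_le_vecNorm_top w j
  have hle : y ⬝ᵥ w ≤ clippedNorm α w * (v ⬝ᵥ y) := by
    have := hmax hwball
    simp only [Set.mem_ofPred_eq, smul_dotProduct, smul_eq_mul] at this
    rwa [inv_mul_le_iff₀ hq0, dotProduct_comm w y] at this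
  have hM0 : 0 < v ⬝ᵥ y := by
    by_contra hneg
    nlinarith
  refine ⟨v ⬝ᵥ y, hM0, ⟨fun u hu1 hu2 => ?_, v, hv.1, hv.2, ?_⟩, hle⟩
  · rw [dotProduct_smul, smul_eq_mul, inv_mul_le_iff₀ hM0, mul_one]
    exact hmax (show u ∈ ball from ⟨hu1, hu2⟩)
  · rw [dotProduct_smul, smul_eq_mul, inv_mul_cancel₀ hM0.ne']

end Laws

section Transfer

variable {Ω Ω' : Type*} [MeasurableSpace Ω] [MeasurableSpace Ω'] {P : Measure Ω} {Q : Measure Ω'}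
  {X : Ω' → ℝ}

lemma map_pi_pi {ι κ : Type*} [Fintype ι] [Fintype κ] {f : ι → κ → Ω → ℝ} {μ : Measure ℝ}
    [IsProbabilityMeasure μ] (hf : ∀ i j, Measurable (f i j))
    (hind : iIndepFun (fun q : ι × κ => f q.1 q.2) P) (hlaw : ∀ i j, P.map (f i j) = μ) :
    P.map (fun ω i j => f i j ω) = Measure.pi fun _ => Measure.pi fun _ => μ := by
  have h1 := hind.map_fun_eq_pi_map fun q : ι × κ => (hf q.1 q.2).aemeasurable
  simp only [hlaw] at h1
  have h2 := Measure.infinitePi_map_curry (fun (_ : ι) (_ : κ) => μ)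
  simp only [Measure.infinitePi_eq_pi] at h2
  have hm : Measurable fun ω (q : ι × κ) => f q.1 q.2 ω :=
    measurable_pi_lambda _ fun q => hf q.1 q.2
  rw [← h2, ← h1, Measure.map_map (MeasurableEquiv.curry ι κ ℝ).measurable hm]
  rfl

lemma IIDEntries.measurePreserving_rows {m N : ℕ} {B : Ω → Matrix (Fin m) (Fin N) ℝ}
    [IsProbabilityMeasure (Q.map X)] (hB : IIDEntries B P X Q) :
    MeasurePreserving (fun ω (j : Fin m) (i : Fin N) => B ω j i) P
      (Measure.pi fun _ => Measure.pi fun _ => Q.map X) :=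
  ⟨measurable_pi_lambda _ fun j => measurable_pi_lambda _ fun i => hB.measurable j i,
    map_pi_pi (f := fun j i ω => B ω j i) hB.measurable hB.indep fun j i => (hB.ident j i).map_eq⟩

lemma IIDEntries.measurePreserving_columns {m N : ℕ} {B : Ω → Matrix (Fin m) (Fin N) ℝ}
    [IsProbabilityMeasure (Q.map X)] (hB : IIDEntries B P X Q) :
    MeasurePreserving (fun ω (i : Fin N) (j : Fin m) => B ω j i) P
      (Measure.pi fun _ => Measure.pi fun _ => Q.map X) :=
  ⟨measurable_pi_lambda _ fun i => measurable_pi_lambda _ fun j => hB.measurable j i,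
    map_pi_pi (f := fun i j ω => B ω j i) (fun i j => hB.measurable j i)
      (hB.indep.precomp (g := Prod.swap) Prod.swap_injective) fun i j => (hB.ident j i).map_eq⟩

lemma WeakMoment.memLp_and_integral_le {k κ γ : ℝ} (hX : AEMeasurable X Q)
    (hw : WeakMoment X Q k κ γ) (hκ : 0 < κ) {i : ℕ} (hi : 4 ≤ i) (hik : i ≤ k) :
    MemLp (fun x => x) i (Q.map X) ∧ ∫ x, x ^ i ∂Q.map X ≤ (κ * (i : ℝ) ^ γ) ^ i := by
  have hi0 : i ≠ 0 := by omega
  have h := hw i (by exact_mod_cast hi) hik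
  rw [ENNReal.ofReal_natCast] at h
  have hnorm : eLpNorm (fun x => x) i (Q.map X) = eLpNorm X i Q :=
    eLpNorm_map_measure aestronglyMeasurable_id hX
  have hmem : MemLp (fun x => x) i (Q.map X) :=
    ⟨aestronglyMeasurable_id, by rw [hnorm]; exact h.trans_lt ENNReal.ofReal_lt_top⟩
  refine ⟨hmem, ?_⟩
  have hc : 0 ≤ κ * (i : ℝ) ^ γ := by positivity
  rw [← hnorm, hmem.eLpNorm_eq_integral_rpow_norm (by exact_mod_cast hi0)
    (ENNReal.natCast_ne_top i), ENNReal.ofReal_le_ofReal_iff hc] at h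
  simp only [ENNReal.toReal_natCast, Real.rpow_natCast] at h
  have h0 : 0 ≤ ∫ x, ‖x‖ ^ i ∂Q.map X := integral_nonneg fun x => by positivity
  calc ∫ x, x ^ i ∂Q.map X ≤ ∫ x, ‖x‖ ^ i ∂Q.map X := by
        have habs : Integrable (fun x : ℝ => ‖x‖ ^ i) (Q.map X) := hmem.integrable_norm_pow hi0
        refine integral_mono (habs.mono (by fun_prop) (.of_forall fun x => by simp)) habs
          fun x => ?_
        simp only [Real.norm_eq_abs, ← abs_pow]
        exact le_abs_self _
    _ = ((∫ x, ‖x‖ ^ i ∂Q.map X) ^ ((i : ℝ)⁻¹)) ^ i := (Real.rpow_inv_natCast_pow h0 hi0).symm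
    _ ≤ _ := by gcongr

lemma SymmetricUnitVariance.symmLaw [IsProbabilityMeasure Q] (hX : SymmetricUnitVariance X Q)
    {K : ℝ} (h4 : MemLp (fun x => x) (4 : ℕ) (Q.map X)) (hK : ∫ x, x ^ 4 ∂Q.map X ≤ K) :
    SymmLaw (Q.map X) K := by
  have hXm : AEMeasurable X Q := hX.symmetric.aemeasurable_fst
  have : IsProbabilityMeasure (Q.map X) := Measure.isProbabilityMeasure_map hXm
  have hneg : MeasurePreserving Neg.neg (Q.map X) (Q.map X) := by
    refine ⟨measurable_neg, ?_⟩
    rw [AEMeasurable.map_map_of_aemeasurable measurable_neg.aemeasurable hXm]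
    exact hX.symmetric.map_eq.symm
  refine ⟨hneg, integrable_pow_of_memLp h4 le_rfl, ?_, hK⟩
  have hvar : variance (fun x => x) (Q.map X) = 1 := by
    rw [← hX.variance_eq, variance_map (by fun_prop) hXm]
    rfl
  have h0 : ∫ x, x ∂Q.map X = 0 :=
    integral_eq_zero_of_odd hneg aestronglyMeasurable_id fun x => rfl
  rw [variance_eq_integral (by fun_prop), h0] at hvar
  simpa using hvar

end Transfer

end NoiseBlind

/-! ### Recovery with random matrices -/

namespace NoiseBlind

section Assembly

variable {Ω Ω' : Type*} [MeasurableSpace Ω] [MeasurableSpace Ω'] {P : Measure Ω} {Q : Measure Ω'}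
  {X : Ω' → ℝ} {m N : ℕ} {B : Ω → Matrix (Fin m) (Fin N) ℝ}

/-- The bound on the fourth moment that the weak moment assumption gives. -/
noncomputable def fourthMomentBound (κ γ : ℝ) : ℝ := (κ * ((4 : ℕ) : ℝ) ^ γ) ^ 4

lemma one_le_log {m N : ℕ} (hm : 0 < m) (hmN : m ≤ N) : 1 ≤ Real.log (Real.exp 1 * N / m) := by
  have hm0 : (0 : ℝ) < m := by exact_mod_cast hm
  have h : (m : ℝ) ≤ N := by exact_mod_cast hmN
  have hN0 : (0 : ℝ) < N := hm0.trans_le h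
  rw [Real.le_log_iff_exp_le (by positivity), le_div_iff₀ hm0]
  gcongr

/-- The null space event pulled back to the probability space of the entries. The parameter
`k = a s_*` is chosen such that `k log (N / k)` is a small multiple of `m`, and the moment of order
`2 r`, with `2 r` close to `log (N / k)`, is used. -/
lemma exists_event_lower_bound {κ γ : ℝ} (hκ : 0 < κ) [IsProbabilityMeasure P]
    (h : SymmLaw (Q.map X) (fourthMomentBound κ γ)) (hXm : AEMeasurable X Q)
    [IsProbabilityMeasure Q] (hB : IIDEntries B P X Q)
    (hw : WeakMoment X Q (max 4 (Real.log N)) κ γ) (hm : 0 < m) (hmN : Real.exp 4 * m ≤ N)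
    (hlog : Real.log N ^ max (2 * γ - 1) 1 ≤ m) {a : ℝ} (ha0 : 0 < a) (ha1 : a ≤ 1)
    (ha : 32 * Real.exp 1 ^ 2 * momentConst κ (max γ 1) * Real.sqrt a ≤
      (smallBallProb (fourthMomentBound κ γ) / (32 * (1 + fourthMomentBound κ γ))) ^ 2)
    (hk : 1 ≤ a * sStar m N) :
    ∃ G : Set Ω, MeasurableSet G ∧
      1 - Real.exp (-(smallBallProb (fourthMomentBound κ γ) ^ 2 / 8) * m) ≤ P.real G ∧
      ∀ ω ∈ G, ∀ v : Fin N → ℝ, v ⬝ᵥ v = 1 → ∑ j, |v j| ≤ Real.sqrt (a * sStar m N) →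
        (1 / (4 * (1 + fourthMomentBound κ γ))) ^ 2 *
            (smallBallProb (fourthMomentBound κ γ) / 2) ≤
          (scaled (B ω)).mulVec v ⬝ᵥ (scaled (B ω)).mulVec v := by
  have : IsProbabilityMeasure (Q.map X) := Measure.isProbabilityMeasure_map hXm
  set K := fourthMomentBound κ γ with hK
  have hK1 := h.one_le
  have hβ0 := smallBallProb_pos K
  set C := momentConst κ (max γ 1) with hC
  have hC0 : 0 < C := momentConst_pos hκ _
  have hm0 : (0 : ℝ) < m := by exact_mod_cast hm
  have hm1 : (1 : ℝ) ≤ m := by exact_mod_cast hm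
  have hmN' : (m : ℝ) ≤ N := by
    have : (1 : ℝ) ≤ Real.exp 4 := Real.one_le_exp (by norm_num)
    nlinarith
  have hN0 : (0 : ℝ) < N := by linarith
  have hl1 : 1 ≤ Real.log (Real.exp 1 * N / m) := one_le_log hm (by exact_mod_cast hmN')
  have hleq : Real.log (Real.exp 1 * N / m) = 1 + Real.log (N / m) := by
    rw [mul_div_assoc, Real.log_mul (Real.exp_pos 1).ne' (by positivity), Real.log_exp]
  set l := Real.log (Real.exp 1 * N / m) with hl
  have hl0 : 0 < l := by linarith
  set k := a * sStar m N with hkdef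
  have hkl : k = a * (m / l) := rfl
  have hk0 : 0 < k := by linarith
  have hkm : k ≤ m := by
    rw [hkl]
    have : (m : ℝ) / l ≤ m := div_le_self hm0.le hl1
    nlinarith
  set L := Real.log (N / k) with hL
  have hL4 : 4 ≤ L := by
    rw [hL, Real.le_log_iff_exp_le (by positivity), le_div_iff₀ hk0]
    refine le_trans ?_ hmN
    gcongr
  have hLN : L ≤ Real.log N := by
    rw [hL]
    refine Real.log_le_log (by positivity) (div_le_self hN0.le hk)
  -- Since `L ≤ 2 l + log (1 / a)` is at most of order `l / √a`, the factor `a` in `k` leaves `√a`.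
  have hkL : k * L ≤ 4 * Real.sqrt a * m := by
    have h1 : L ≤ 2 * l + Real.log (1 / a) := by
      have h2 : (N : ℝ) / k = N / m * l * (1 / a) := by rw [hkl]; field_simp
      rw [hL, h2, Real.log_mul (by positivity) (by positivity),
        Real.log_mul (by positivity) hl0.ne']
      have := Real.log_le_sub_one_of_pos hl0
      linarith
    have h3 : Real.log (1 / a) ≤ 2 * (1 / Real.sqrt a) - 2 := by
      have h4 : 1 / a = (1 / Real.sqrt a) ^ 2 := by
        rw [div_pow, one_pow, Real.sq_sqrt ha0.le]
      have h5 := Real.log_le_sub_one_of_pos (show 0 < 1 / Real.sqrt a by positivity)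
      rw [h4, Real.log_pow]
      push_cast
      linarith
    have hsa : 0 < Real.sqrt a := Real.sqrt_pos.2 ha0
    have hsa1 : Real.sqrt a ≤ 1 := by rwa [Real.sqrt_le_left zero_le_one, one_pow]
    have haa : a = Real.sqrt a * Real.sqrt a := (Real.mul_self_sqrt ha0.le).symm
    have h6 : L ≤ l * (4 / Real.sqrt a) := by
      have h7 : 1 ≤ 1 / Real.sqrt a := by rw [le_div_iff₀ hsa]; linarith
      have h8 : l * 1 ≤ l * (1 / Real.sqrt a) := by gcongr
      have h9 : 1 * (1 / Real.sqrt a) ≤ l * (1 / Real.sqrt a) := by gcongr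
      have h10 : l * (4 / Real.sqrt a) = 4 * (l * (1 / Real.sqrt a)) := by ring
      linarith
    calc k * L ≤ k * (l * (4 / Real.sqrt a)) := by gcongr
      _ = a * m * (4 / Real.sqrt a) := by rw [hkl]; field_simp
      _ = 4 * Real.sqrt a * m := by
          rw [haa, Real.sqrt_mul_self hsa.le]; field_simp
  set r := ⌊L / 2⌋₊ with hr
  have hr2 : 2 ≤ r := Nat.le_floor (by push_cast; linarith)
  have hr0 : (0 : ℝ) < r := by exact_mod_cast (by omega : 0 < r)
  have hrL : 2 * (r : ℝ) ≤ L := by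
    have := Nat.floor_le (show 0 ≤ L / 2 by linarith)
    linarith
  have hrL' : L - 2 ≤ 2 * (r : ℝ) := by
    have := Nat.lt_floor_add_one (L / 2)
    linarith
  have hri : ∀ i : ℕ, i ≤ 2 * r → (i : ℝ) ≤ max 4 (Real.log N) := fun i hi => by
    have : (i : ℝ) ≤ 2 * r := by exact_mod_cast hi
    exact le_max_of_le_right (by linarith)
  have hlogN : 1 ≤ Real.log N := by linarith
  have hmom := integral_sum_pow_le h (n := m) hκ (le_max_right γ 1) hr2
    (hw.memLp_and_integral_le hXm hκ (by omega) (hri _ le_rfl)).1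
    (fun i hi hir => (hw.memLp_and_integral_le hXm hκ hi (hri i hir)).2.trans (by
      have : (1 : ℝ) ≤ i := by exact_mod_cast (by omega : 1 ≤ i)
      gcongr
      exact le_max_left _ _)) (by
      have e1 : 2 * max γ 1 - 1 = max (2 * γ - 1) 1 := by
        rcases le_total γ 1 with hg | hg
        · rw [max_eq_right hg, max_eq_right (by linarith)]; norm_num
        · rw [max_eq_left hg, max_eq_left (by linarith)]
      rw [e1]
      refine le_trans ?_ hlog
      gcongr
      push_cast
      linarith)
  obtain ⟨G, hGm, hGp, hG⟩ := h.exists_event_rows (N := N) hr2 hk0 hC0 hm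
    (hw.memLp_and_integral_le hXm hκ (by omega) (hri _ le_rfl)).1 hmom (by
      have h1 : Real.exp (-(2 * r : ℝ)) ≤ Real.exp (2 - L) := by gcongr; linarith
      have h2 : Real.exp (2 - L) = Real.exp 1 ^ 2 * (k / N) := by
        rw [Real.exp_sub, hL, Real.exp_log (by positivity), ← Real.exp_nat_mul]
        field_simp
        norm_num
      calc (N : ℝ) * Real.exp (-(2 * r)) ≤ N * (Real.exp 1 ^ 2 * (k / N)) := by
            rw [← h2]; gcongr
        _ = _ := by field_simp) (by
      refine le_of_sq_le_sq ?_ (by positivity)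
      have h1 : (4 * (Real.exp 1 * Real.sqrt (C * m * r) * Real.sqrt k)) ^ 2 =
          8 * Real.exp 1 ^ 2 * C * m * (k * (2 * r)) := by
        rw [mul_pow, mul_pow, mul_pow, Real.sq_sqrt (by positivity), Real.sq_sqrt hk0.le]
        ring
      rw [h1, mul_pow]
      calc 8 * Real.exp 1 ^ 2 * C * m * (k * (2 * r))
          ≤ 8 * Real.exp 1 ^ 2 * C * m * (4 * Real.sqrt a * m) := by
            refine mul_le_mul_of_nonneg_left ?_ (by positivity)
            exact (mul_le_mul_of_nonneg_left hrL hk0.le).trans hkL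
        _ = 32 * Real.exp 1 ^ 2 * C * Real.sqrt a * (m : ℝ) ^ 2 := by ring
        _ ≤ _ := by gcongr)
  have hmp := hB.measurePreserving_rows
  refine ⟨_, hmp.measurable hGm, ?_, fun ω hω v hv1 hv2 => ?_⟩
  · rwa [hmp.measureReal_preimage hGm.nullMeasurableSet]
  · have h1 := hG _ hω v hv1 hv2
    have h2 : (scaled (B ω)).mulVec v ⬝ᵥ (scaled (B ω)).mulVec v =
        (∑ i, ((fun j => B ω i j) ⬝ᵥ v) ^ 2) / m := by
      rw [scaled, Matrix.smul_mulVec, smul_dotProduct, dotProduct_smul, smul_eq_mul, smul_eq_mul,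
        ← mul_assoc]
      have : 1 / Real.sqrt m * (1 / Real.sqrt m) = 1 / (m : ℝ) := by
        rw [div_mul_div_comm, Real.mul_self_sqrt hm0.le, one_mul]
      rw [this, one_div_mul_eq_div]
      congr 1
      simp only [dotProduct, pow_two]
      rfl
    rw [h2, le_div_iff₀ hm0]
    exact h1

/-- A quotient property follows from a column event, if the norm `q` of the noise is dominated by
functionals that are multiples of directions in `T`. -/
lemma exists_event_quotient {K : ℝ} [IsProbabilityMeasure (Q.map X)] (h : SymmLaw (Q.map X) K)
    (hB : IIDEntries B P X Q) (hm : 0 < m) (hmN : m ≤ N) {c β : ℝ} (hc : 0 < c) (hβ : 0 < β)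
    (hN : 3 * ((2 / c + 1) / β) ^ 4 * m ≤ N) {T : Set (Fin m → ℝ)} {q : (Fin m → ℝ) → ℝ}
    (hq : ∀ w, 0 ≤ q w)
    (hT : ∀ y ∈ T, y ⬝ᵥ y ≤ Real.log (Real.exp 1 * N / m))
    (hp : ∀ y ∈ T, β * Real.exp (-(Real.log (Real.exp 1 * N / m) / 4)) ≤
      (Measure.pi fun _ => Q.map X).real
        {b : Fin m → ℝ | 2 * (c * Real.sqrt (Real.log (Real.exp 1 * N / m))) ≤ b ⬝ᵥ y})
    (hTq : ∀ y w : Fin m → ℝ, 0 < y ⬝ᵥ w → ∃ M, 0 < M ∧ M⁻¹ • y ∈ T ∧ y ⬝ᵥ w ≤ q w * M) :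
    ∃ G : Set Ω, MeasurableSet G ∧ 1 - Real.exp (-2 * m) ≤ P.real G ∧
      ∀ ω ∈ G, ∀ w, ∃ u, (scaled (B ω)).mulVec u = w ∧
        vecNorm 1 u ≤ 1 / c * Real.sqrt (sStar m N) * q w := by
  have hm0 : (0 : ℝ) < m := by exact_mod_cast hm
  have hl1 := one_le_log hm hmN
  set l := Real.log (Real.exp 1 * N / m) with hl
  have hl0 : 0 < l := by linarith
  have hl2 : Real.sqrt l ^ 2 = l := Real.sq_sqrt hl0.le
  have hN0 : (0 : ℝ) < N := lt_of_lt_of_le hm0 (by exact_mod_cast hmN)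
  obtain ⟨G, hGm, hGp, hG⟩ := h.exists_event_columns (N := N) hm (α := Real.sqrt l)
    (Real.one_le_sqrt.2 hl1) (by rw [hl2, hl, Real.exp_log (by positivity)]) hc hβ hN
    (T := T) (by rwa [hl2]) (by rwa [hl2])
  have hmp := hB.measurePreserving_columns
  refine ⟨_, hmp.measurable hGm, ?_, fun ω hω w => ?_⟩
  · rwa [hmp.measureReal_preimage hGm.nullMeasurableSet]
  · refine exists_mulVec_eq (by have := hq w; positivity) fun y hyw => ?_
    obtain ⟨M, hM0, hMT, hM⟩ := hTq y w hyw
    obtain ⟨i, hi⟩ := hG _ hω _ hMT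
    rw [dotProduct_smul, smul_eq_mul, le_inv_mul_iff₀ hM0] at hi
    refine ⟨i, hM.trans ?_⟩
    rw [scaled_column_dotProduct, abs_div, abs_of_nonneg (Real.sqrt_nonneg m)]
    have hS : Real.sqrt (sStar m N) = Real.sqrt m / Real.sqrt l := Real.sqrt_div hm0.le _
    rw [hS]
    have hsl : 0 < Real.sqrt l := Real.sqrt_pos.2 hl0
    have hsm : 0 < Real.sqrt m := Real.sqrt_pos.2 hm0
    have e : 1 / c * (Real.sqrt m / Real.sqrt l) * q w *
        (|(fun j => B ω j i) ⬝ᵥ y| / Real.sqrt m) =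
        q w * (|(fun j => B ω j i) ⬝ᵥ y| / (c * Real.sqrt l)) := by
      field_simp
    rw [e]
    refine mul_le_mul_of_nonneg_left ?_ (hq w)
    rw [le_div_iff₀ (by positivity)]
    exact hi.trans (le_abs_self _)

/-- The number `a` such that the null space property holds at the order `a s_*`. -/
noncomputable def orderConst (κ γ : ℝ) : ℝ :=
  (min 1 ((smallBallProb (fourthMomentBound κ γ) / (32 * (1 + fourthMomentBound κ γ))) ^ 2 /
    (32 * Real.exp 1 ^ 2 * momentConst κ (max γ 1)))) ^ 2

/-- The lower bound for `‖A v‖₂` in the null space property. -/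
noncomputable def lowerConst (κ γ : ℝ) : ℝ :=
  Real.sqrt ((1 / (4 * (1 + fourthMomentBound κ γ))) ^ 2 *
    (smallBallProb (fourthMomentBound κ γ) / 2))

/-- The exponent in the failure probability. -/
noncomputable def probConst (κ γ : ℝ) : ℝ :=
  min (smallBallProb (fourthMomentBound κ γ) ^ 2 / 8) 2

/-- The interpolation constant of the error bound. -/
noncomputable def interpConst (κ γ : ℝ) : ℝ := 1 + (1 / Real.sqrt (orderConst κ γ) + 1) ^ 2

lemma fourthMomentBound_pos {κ : ℝ} (hκ : 0 < κ) (γ : ℝ) : 0 < fourthMomentBound κ γ := by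
  unfold fourthMomentBound; positivity

lemma orderConst_pos {κ : ℝ} (hκ : 0 < κ) (γ : ℝ) : 0 < orderConst κ γ := by
  have h1 := fourthMomentBound_pos hκ γ
  have h2 := smallBallProb_pos (fourthMomentBound κ γ)
  have h3 := momentConst_pos hκ (max γ 1)
  unfold orderConst
  positivity

lemma lowerConst_pos {κ : ℝ} (hκ : 0 < κ) (γ : ℝ) : 0 < lowerConst κ γ := by
  have h1 := fourthMomentBound_pos hκ γ
  have h2 := smallBallProb_pos (fourthMomentBound κ γ)
  unfold lowerConst
  positivity

lemma probConst_pos (κ γ : ℝ) : 0 < probConst κ γ := by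
  have h2 := smallBallProb_pos (fourthMomentBound κ γ)
  unfold probConst
  positivity

lemma interpConst_pos (κ γ : ℝ) : 0 < interpConst κ γ := by
  unfold interpConst; positivity

/-- The common part of both regimes: a quotient property with respect to a homogeneous norm `q`
of the noise, which dominates the `ℓ₂`-norm, combines with the null space event. -/
theorem holdsWithProb_robustRecovery {κ γ : ℝ} (hκ : 0 < κ)
    [IsProbabilityMeasure P] [IsProbabilityMeasure Q] {s : ℕ} {η : ℝ} (hs : 1 ≤ s) (hη : 0 ≤ η)
    (hX : SymmetricUnitVariance X Q) (hB : IIDEntries B P X Q)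
    (hw : WeakMoment X Q (max 4 (Real.log N)) κ γ) (hmN : Real.exp 4 * m ≤ N)
    (hlog : Real.log N ^ max (2 * γ - 1) 1 ≤ m) (hsS : s ≤ orderConst κ γ / 16 * sStar m N)
    {q : (Fin m → ℝ) → ℝ} (hq : ∀ (a : ℝ) w, 0 ≤ a → q (a • w) = a * q w)
    (hq2 : ∀ w, vecNorm 2 w ≤ q w) {d : ℝ} (hd : 0 ≤ d)
    (hquot : SymmLaw (Q.map X) (fourthMomentBound κ γ) → 0 < m →
      ∃ G : Set Ω, MeasurableSet G ∧ 1 - Real.exp (-2 * m) ≤ P.real G ∧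
        ∀ ω ∈ G, ∀ w, ∃ u, (scaled (B ω)).mulVec u = w ∧
          vecNorm 1 u ≤ d * Real.sqrt (sStar m N) * q w) :
    HoldsWithProb P (1 - 3 * Real.exp (-probConst κ γ * m)) (fun ω =>
      RobustRecovery (scaled (B ω)) η s (4 * interpConst κ γ) (fun w =>
        interpConst κ γ * (2 / lowerConst κ γ) * η +
          interpConst κ γ * (1 / lowerConst κ γ + 2 * d) *
            (q w / vecNorm 2 w * max (vecNorm 2 w - η) 0))) := by
  have hm : 0 < m := by
    rcases Nat.eq_zero_or_pos m with rfl | hm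
    · have : (1 : ℝ) ≤ s := by exact_mod_cast hs
      simp [sStar] at hsS
      omega
    · exact hm
  have hm0 : (0 : ℝ) < m := by exact_mod_cast hm
  have hXm : AEMeasurable X Q := hX.symmetric.aemeasurable_fst
  have h4 := hw.memLp_and_integral_le hXm hκ (i := 4) le_rfl
    (by push_cast; exact le_max_left _ _)
  have hlaw : SymmLaw (Q.map X) (fourthMomentBound κ γ) := hX.symmLaw h4.1 h4.2
  have hs1 : (1 : ℝ) ≤ s := by exact_mod_cast hs
  have ha0 := orderConst_pos hκ γ
  set a := orderConst κ γ with ha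
  have hK0 := fourthMomentBound_pos hκ γ
  have hβ0 := smallBallProb_pos (fourthMomentBound κ γ)
  have hC0 := momentConst_pos hκ (max γ 1)
  set e := min 1 ((smallBallProb (fourthMomentBound κ γ) /
    (32 * (1 + fourthMomentBound κ γ))) ^ 2 /
    (32 * Real.exp 1 ^ 2 * momentConst κ (max γ 1))) with he
  have he0 : 0 < e := by positivity
  have hae : a = e ^ 2 := rfl
  have ha1 : a ≤ 1 := by rw [hae]; exact pow_le_one₀ he0.le (min_le_left _ _)
  have hsS' : 16 * (s : ℝ) ≤ a * sStar m N := by linarith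
  obtain ⟨G₁, hG₁m, hG₁p, hG₁⟩ := exists_event_lower_bound hκ hlaw hXm hB hw hm hmN hlog
    ha0 ha1 (by
      rw [hae, Real.sqrt_sq he0.le, mul_comm, ← le_div_iff₀ (by positivity)]
      exact min_le_right _ _) (by linarith)
  obtain ⟨G₂, hG₂m, hG₂p, hG₂⟩ := hquot hlaw hm
  refine ⟨G₁ ∩ G₂, hG₁m.inter hG₂m, ?_, fun ω hω => ?_⟩
  · have h1 : P.real (G₁ ∩ G₂)ᶜ ≤ P.real G₁ᶜ + P.real G₂ᶜ := by
      rw [Set.compl_inter]; exact measureReal_union_le _ _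
    rw [probReal_compl_eq_one_sub (hG₁m.inter hG₂m), probReal_compl_eq_one_sub hG₁m,
      probReal_compl_eq_one_sub hG₂m] at h1
    have h2 : Real.exp (-(smallBallProb (fourthMomentBound κ γ) ^ 2 / 8) * m) ≤
        Real.exp (-probConst κ γ * m) := by
      gcongr
      exact min_le_left _ _
    have h3 : Real.exp (-2 * m) ≤ Real.exp (-probConst κ γ * m) := by
      gcongr
      exact min_le_right _ _
    have h5 := Real.exp_pos (-probConst κ γ * m)
    linarith
  · have hc₀ := lowerConst_pos hκ γ
    have hc₀2 : lowerConst κ γ ^ 2 = (1 / (4 * (1 + fourthMomentBound κ γ))) ^ 2 *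
        (smallBallProb (fourthMomentBound κ γ) / 2) := Real.sq_sqrt (by positivity)
    refine robustRecovery_of_lower_bound hη hs ha0 ha1 hsS' hc₀ hd
      (fun v hv1 hv2 => by rw [hc₀2]; exact hG₁ ω hω.1 v hv1 hv2) (fun w => ?_)
      (exists_absorb_noise hη hq (hG₂ ω hω.2))
    rcases (vecNorm_nonneg 2 w).eq_or_lt with h0 | h0
    · rw [← h0, max_eq_right (by linarith)]; simp
    · refine le_mul_of_one_le_left (le_max_right _ _) ?_
      rw [le_div_iff₀ h0, one_mul]
      exact hq2 w

end Assembly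

end NoiseBlind

theorem theorem2p6 :
    -- part (a)
    (∀ κ γ : ℝ, 0 < κ → 1 / 2 ≤ γ →
      ∃ c₁ c₂ c₃ Ct C D E : ℝ,
        0 < c₁ ∧ 0 < c₂ ∧ 0 < c₃ ∧ 0 < Ct ∧ 0 < C ∧ 0 < D ∧ 0 < E ∧
        ∀ (m N : ℕ) (Ω : Type*) (Ω' : Type*) [MeasurableSpace Ω] [MeasurableSpace Ω']
          (P : Measure Ω) (Q : Measure Ω') [IsProbabilityMeasure P] [IsProbabilityMeasure Q]
          (X : Ω' → ℝ) (B : Ω → Matrix (Fin m) (Fin N) ℝ) (s : ℕ) (η : ℝ),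
          m ≤ N → 1 ≤ s → 0 ≤ η →
          SymmetricUnitVariance X Q →
          IIDEntries B P X Q →
          WeakMoment X Q (max 4 (Real.log N)) κ γ →
          Ct * m ≤ N →
          c₃ * Real.log N ^ max (2 * γ - 1) 1 ≤ m →
          s ≤ c₂ * sStar m N →
          HoldsWithProb P (1 - 3 * Real.exp (-c₁ * m)) (fun ω =>
            RobustRecovery (scaled (B ω)) η s C (fun w =>
              D * η + E * (clippedNorm (Real.sqrt (Real.log (Real.exp 1 * N / m))) w / vecNorm 2 w)
                * max (vecNorm 2 w - η) 0))) ∧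
    -- part (b)
    (∀ κ γ σ : ℝ, 0 < κ → 1 / 2 ≤ γ → 0 < σ → σ ≤ 1 →
      ∃ c₁ c₂ Ct C D E : ℝ,
        0 < c₁ ∧ 0 < c₂ ∧ 0 < Ct ∧ 0 < C ∧ 0 < D ∧ 0 < E ∧
        ∀ (m N : ℕ) (Ω : Type*) (Ω' : Type*) [MeasurableSpace Ω] [MeasurableSpace Ω']
          (P : Measure Ω) (Q : Measure Ω') [IsProbabilityMeasure P] [IsProbabilityMeasure Q]
          (X : Ω' → ℝ) (B : Ω → Matrix (Fin m) (Fin N) ℝ) (s : ℕ) (η : ℝ),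
          m ≤ N → 1 ≤ s → 0 ≤ η →
          SymmetricUnitVariance X Q →
          IIDEntries B P X Q →
          WeakMoment X Q (max 4 (Real.log N)) κ γ →
          SuperGaussian X Q σ →
          Ct * m ≤ N →
          Real.log N ^ max (2 * γ - 1) 1 ≤ m →
          s ≤ c₂ * sStar m N →
          HoldsWithProb P (1 - 3 * Real.exp (-c₁ * m)) (fun ω =>
            RobustRecovery (scaled (B ω)) η s C (fun w =>
              D * η + E * max (vecNorm 2 w - η) 0))) := by
  refine ⟨fun κ γ hκ hγ => ?_, fun κ γ σ hκ hγ hσ _ => ?_⟩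
  · have hK := fourthMomentBound_pos hκ γ
    have hI := interpConst_pos κ γ
    have hL := lowerConst_pos hκ γ
    have ha := orderConst_pos hκ γ
    -- `2 c` and `β` are the level and the probability in the small ball estimate for columns.
    obtain ⟨β, hβ⟩ : ∃ β, β = ((1 / 2) ^ 2 /
      (4 * ((1 + fourthMomentBound κ γ) ^ 2 + (1 / 2) ^ 2))) ^ 2 := ⟨_, rfl⟩
    have hβ0 : 0 < β := by rw [hβ]; positivity
    obtain ⟨c, hc⟩ : ∃ c, c = 1 / (4 * (1 + fourthMomentBound κ γ)) / 2 := ⟨_, rfl⟩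
    have hc0 : 0 < c := by rw [hc]; positivity
    refine ⟨probConst κ γ, orderConst κ γ / 16, 1, max (Real.exp 4) (3 * ((2 / c + 1) / β) ^ 4),
      4 * interpConst κ γ, interpConst κ γ * (2 / lowerConst κ γ),
      interpConst κ γ * (1 / lowerConst κ γ + 2 * (1 / c)), probConst_pos κ γ, by positivity,
      one_pos, by positivity, by positivity, by positivity, by positivity, ?_⟩
    intro m N Ω Ω' _ _ P Q _ _ X B s η hmN hs hη hX hB hw hN hlog hsS
    rw [one_mul] at hlog
    have hN1 : Real.exp 4 * m ≤ N := le_trans (by gcongr; exact le_max_left _ _) hN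
    have hN2 : 3 * ((2 / c + 1) / β) ^ 4 * m ≤ N := le_trans (by gcongr; exact le_max_right _ _) hN
    have : IsProbabilityMeasure (Q.map X) :=
      Measure.isProbabilityMeasure_map hX.symmetric.aemeasurable_fst
    simp only [mul_assoc (interpConst κ γ * (1 / lowerConst κ γ + 2 * (1 / c)))]
    refine holdsWithProb_robustRecovery hκ hs hη hX hB hw hN1 hlog hsS
      (q := clippedNorm (Real.sqrt (Real.log (Real.exp 1 * N / m))))
      (fun a w ha => clippedNorm_smul ha w) (fun w => le_max_left _ _)
      (by positivity) fun hlaw hm => ?_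
    have hl := one_le_log hm hmN
    have hα := Real.one_le_sqrt.2 hl
    have hα2 : Real.sqrt (Real.log (Real.exp 1 * N / m)) ^ 2 = Real.log (Real.exp 1 * N / m) :=
      Real.sq_sqrt (by linarith)
    refine exists_event_quotient hlaw hB hm hmN hc0 hβ0 hN2
      (T := dualClippedSphere m (Real.sqrt (Real.log (Real.exp 1 * N / m))))
      (fun w => (vecNorm_nonneg 2 w).trans (le_max_left _ _))
      (fun y hy => (dotProduct_self_le_of_mem_dualClippedSphere hα hy).trans_eq hα2)
      (fun y hy => ?_) fun y w => exists_dualClippedSphere hα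
    have h := hlaw.le_measure_dualClippedSphere hα hy
    rw [hα2, ← hβ] at h
    rwa [← mul_assoc, show 2 * c = 1 / (4 * (1 + fourthMomentBound κ γ)) by rw [hc]; ring]
  · have hK := fourthMomentBound_pos hκ γ
    have hI := interpConst_pos κ γ
    have hL := lowerConst_pos hκ γ
    have ha := orderConst_pos hκ γ
    -- `2 c` and `β` come from the super-Gaussian small ball estimate, for unit vectors.
    obtain ⟨β, hβ⟩ : ∃ β, β = ((1 / 8) ^ 2 /
      (4 * ((1 + fourthMomentBound κ γ) ^ 2 + (1 / 8) ^ 2))) ^ 2 := ⟨_, rfl⟩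
    have hβ0 : 0 < β := by rw [hβ]; positivity
    obtain ⟨c, hc⟩ : ∃ c, c = min (1 / (16 * (1 + fourthMomentBound κ γ))) (σ / 8) / 2 := ⟨_, rfl⟩
    have hc0 : 0 < c := by rw [hc]; positivity
    refine ⟨probConst κ γ, orderConst κ γ / 16, max (Real.exp 4) (3 * ((2 / c + 1) / β) ^ 4),
      4 * interpConst κ γ, interpConst κ γ * (2 / lowerConst κ γ),
      interpConst κ γ * (1 / lowerConst κ γ + 2 * (1 / c)), probConst_pos κ γ, by positivity,
      by positivity, by positivity, by positivity, by positivity, ?_⟩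
    intro m N Ω Ω' _ _ P Q _ _ X B s η hmN hs hη hX hB hw hG hN hlog hsS
    have hN1 : Real.exp 4 * m ≤ N := le_trans (by gcongr; exact le_max_left _ _) hN
    have hN2 : 3 * ((2 / c + 1) / β) ^ 4 * m ≤ N := le_trans (by gcongr; exact le_max_right _ _) hN
    have hXm : AEMeasurable X Q := hX.symmetric.aemeasurable_fst
    have : IsProbabilityMeasure (Q.map X) := Measure.isProbabilityMeasure_map hXm
    -- For `w = 0` the quotient is `0`, and so is the maximum, since `0 ≤ η`.
    have hratio : ∀ w : Fin m → ℝ, max (vecNorm 2 w - η) 0 =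
        vecNorm 2 w / vecNorm 2 w * max (vecNorm 2 w - η) 0 := fun w => by
      rcases eq_or_ne (vecNorm 2 w) 0 with h0 | h0
      · rw [h0, max_eq_right (by linarith), mul_zero]
      · rw [div_self h0, one_mul]
    refine cast ?_ (holdsWithProb_robustRecovery hκ hs hη hX hB hw hN1 hlog hsS (q := vecNorm 2)
      (d := 1 / c) (fun a w h => by rw [vecNorm_smul, abs_of_nonneg h]) (fun w => le_rfl)
      (by positivity) fun hlaw hm => ?_)
    · simp only [← hratio]
    have hl := one_le_log hm hmN
    have hα := Real.one_le_sqrt.2 hl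
    have hα2 : Real.sqrt (Real.log (Real.exp 1 * N / m)) ^ 2 = Real.log (Real.exp 1 * N / m) :=
      Real.sq_sqrt (by linarith)
    refine exists_event_quotient hlaw hB hm hmN hc0 hβ0 hN2 (T := {y | y ⬝ᵥ y = 1})
      (vecNorm_nonneg 2) (fun y hy => by rw [Set.mem_ofPred_eq] at hy; rwa [hy])
      (fun y hy => ?_) fun y w hyw => ?_
    · have hG' : ∀ t : ℝ, 0 < t →
          gaussianReal 0 1 {g | t < |σ * g|} ≤ Q.map X {x | t < |x|} := fun t ht => by
        rw [Measure.map_apply_of_aemeasurable hXm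
          (measurableSet_lt measurable_const continuous_abs.measurable)]
        exact hG t ht
      have h := hlaw.le_measure_dotProduct_ge_of_superGaussian hσ hG' hy hα
      rw [hα2, ← hβ] at h
      rwa [← mul_assoc, show 2 * c = min (1 / (16 * (1 + fourthMomentBound κ γ))) (σ / 8) by
        rw [hc]; ring]
    · have hcs : y ⬝ᵥ w ≤ vecNorm 2 w * vecNorm 2 y := by
        rw [mul_comm, vecNorm_two, vecNorm_two]
        exact dotProduct_le_sqrt_mul_sqrt y w
      have hy0 : 0 < vecNorm 2 y := by
        refine (vecNorm_nonneg 2 y).lt_of_ne fun h0 => ?_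
        rw [← h0] at hcs
        linarith
      refine ⟨vecNorm 2 y, hy0, ?_, hcs⟩
      rw [Set.mem_ofPred_eq, ← vecNorm_two_sq, vecNorm_smul, abs_of_pos (inv_pos.2 hy0),
        inv_mul_cancel₀ hy0.ne', one_pow]
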